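/- Let $f:\mathbb R^d\times\Xi\to\mathbb R$ ($d\ge 1$) be a loss function, $\xi_1,\xi_2,\dots$ i.i.d. with law $\Pi$ on $\Xi$, $F(x)=\mathbb E f(x,\xi)$ (finite for every $x$), and let $x^*$ minimize $F$. For a fixed $x_0\in\mathbb R^d$, $\eta>0$ and $\tfrac12<\alpha<1$ let $$x_i=x_{i-1}-\eta_i\nabla f(x_{i-1},\xi_i),\quad \eta_i=\eta i^{-\alpha}\ (i\ge1),\qquad \bar x_n=\frac1n\sum_{i=1}^n x_i .$$ Write $\delta_n=x_n-x^*$, $\epsilon_n=\nabla F(x_{n-1})-\nabla f(x_{n-1},\xi_n)$, $\mathbb E_{n-1}$ for the conditional expectation given $\xi_1,\dots,\xi_{n-1}$, $A=\nabla^2F(x^*)$, $S=\mathbb E[\nabla f(x^*,\xi)\nabla f(x^*,\xi)^T]$ (finite) and $\Sigma=A^{-1}SA^{-1}$; $\|\cdot\|$ is the Euclidean norm of a vector and the operator norm of a matrix. Assume: 1. $F$ is continuously differentiable, and there are $c,L>0$ such that for all $x,y$: $F(y)\ge F(x)+\langle\nabla F(x),y-x\rangle+\frac c2\|x-y\|^2$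 and $\|\nabla F(x)-\nabla F(y)\|\le L\|x-y\|$. Moreover $\nabla^2F(x^*)$ exists, and $\nabla F(x)=A(x-x^*)+O(\|x-x^*\|^2)$ as $x\to x^*$. 2. For every $\xi$ the function $f(\cdot,\xi)$ is continuously differentiable, and every $x\in\mathbb R^d$ has a neighbourhood $U$ such that the family $\{\nabla f(y,\xi)\}_{y\in U}$ is uniformly integrable. 3. There is a constant $C_1$ such that for all $n\ge1$, almost surely, $\|\mathbb E_{n-1}\epsilon_n\epsilon_n^T-S\|\le C_1(\|\delta_{n-1}\|+\|\delta_{n-1}\|^2)$. 4. $\mathbb E\|\epsilon_n\|^4<\infty$ for all $n\ge1$, and there is a constant $C_2$ such that for all $n\ge 1$, almost surely, $\mathbb E_{n-1}\|\epsilon_n\|^4\le C_2(1+\|\delta_{n-1}\|^4)$. Let $C>0$, $\beta>\frac1{1-\alpha}$, and let $1=a_1<a_2<\cdots$ be integers with $a_k=\lfloor Ck^\beta\rfloor$ for all large $k$. For $a_m\le i<a_{m+1}$ put $t_i=a_m$ and $l_i=i-t_i+1$, and let $$\hat\Sigma_n=\frac{\sum_{i=1}^n\big(\sum_{k=t_i}^i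 x_k-l_i\bar x_n\big)\big(\sum_{k=t_i}^i x_k-l_i\bar x_n\big)^T}{\sum_{i=1}^n l_i},$$ with diagonal entries $\hat\sigma_{ii}$. Let $0<q<1$, let $z_{1-q/2}$ be the $(1-q/2)$-quantile of $N(0,1)$, and let $\chi^2_{d,1-q}$ be the $(1-q)$-quantile of the chi-square distribution with $d$ degrees of freedom. Then, as $n\to\infty$: (a) for every coordinate $i$ with $\Sigma_{ii}>0$ (hence for every $i$ if $S$ is positive definite), $$\Pr\Big(x^*_i\in\Big[\bar x_{n,i}-z_{1-q/2}\sqrt{\hat\sigma_{ii}/n},\ \bar x_{n,i}+z_{1-q/2}\sqrt{\hat\sigma_{ii}/n}\Big]\Big)\to1-q;$$ (b) if $S$ is positive definite, then $\hat\Sigma_n$ is invertible with probability tending to $1$, and $$\Pr\Big(n(\bar x_n-x^*)^T\hat\Sigma_n^{-1}(\bar x_n-x^*)\le\chi^2_{d,1-q}\Big)\to1-q .$$ -/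

import Mathlib

open MeasureTheory ProbabilityTheory Filter Topology

noncomputable section

/-- The `p`-quantile `inf {t : p ≤ ν((-∞, t])}` of a probability measure on the line. -/
def quantile (ν : Measure ℝ) (p : ℝ) : ℝ :=
  sInf {t : ℝ | p ≤ cdf ν t}

/-- The chi-square distribution with `d` degrees of freedom: the law of the sum of the squares of
`d` independent standard normal variables. -/
def chiSquare (d : ℕ) : Measure ℝ :=
  (Measure.pi fun _ : Fin d => gaussianReal 0 1).map fun v => ∑ i, v i ^ 2

/-- The gradient `∇f(x, z)` of the loss in its first argument. -/
def lossGrad {d : ℕ} {Ξ : Type*} (f : EuclideanSpace ℝ (Fin d) → Ξ → ℝ)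
    (x : EuclideanSpace ℝ (Fin d)) (z : Ξ) : EuclideanSpace ℝ (Fin d) :=
  gradient (fun y => f y z) x

/-- The objective function `F(x) = E f(x, ξ)`, `ξ ∼ P`. -/
def objective {d : ℕ} {Ξ : Type*} [MeasurableSpace Ξ] (f : EuclideanSpace ℝ (Fin d) → Ξ → ℝ)
    (P : Measure Ξ) (x : EuclideanSpace ℝ (Fin d)) : ℝ :=
  ∫ z, f x z ∂P

/-- The Hessian matrix of `F` at `x`: the Jacobian matrix of the gradient. -/
def hessianMatrix {d : ℕ} (F : EuclideanSpace ℝ (Fin d) → ℝ) (x : EuclideanSpace ℝ (Fin d)) :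
    Matrix (Fin d) (Fin d) ℝ :=
  Matrix.of fun i j => (fderiv ℝ (gradient F) x (EuclideanSpace.single j 1)) i

/-- `S = E [∇f(x, ξ) ∇f(x, ξ)ᵀ]`, `ξ ∼ P`. -/
def gradSecondMoment {d : ℕ} {Ξ : Type*} [MeasurableSpace Ξ]
    (f : EuclideanSpace ℝ (Fin d) → Ξ → ℝ) (P : Measure Ξ) (x : EuclideanSpace ℝ (Fin d)) :
    Matrix (Fin d) (Fin d) ℝ :=
  Matrix.of fun i j => ∫ z, lossGrad f x z i * lossGrad f x z j ∂P

/-- The sandwich matrix `A⁻¹ S A⁻¹`, with `A` the Hessian matrix of the objective. -/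
def sandwich {d : ℕ} {Ξ : Type*} [MeasurableSpace Ξ]
    (f : EuclideanSpace ℝ (Fin d) → Ξ → ℝ) (P : Measure Ξ) (x : EuclideanSpace ℝ (Fin d)) :
    Matrix (Fin d) (Fin d) ℝ :=
  (hessianMatrix (objective f P) x)⁻¹ * gradSecondMoment f P x *
    (hessianMatrix (objective f P) x)⁻¹

/-- The SGD iterates `x_{n+1} = x_n - η (n+1)^{-α} ∇f(x_n, ξ_{n+1})` along one data path.
The data are numbered from `0`: `z n` is the sample used in the `(n+1)`-st step. -/
def sgd {d : ℕ} {Ξ : Type*} (f : EuclideanSpace ℝ (Fin d) → Ξ → ℝ) (η α : ℝ)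
    (x₀ : EuclideanSpace ℝ (Fin d)) (z : ℕ → Ξ) : ℕ → EuclideanSpace ℝ (Fin d)
  | 0 => x₀
  | n + 1 => sgd f η α x₀ z n -
      (η * ((n : ℝ) + 1) ^ (-α)) • lossGrad f (sgd f η α x₀ z n) (z n)

/-- The average `x̄_n = n⁻¹ ∑_{i=1}^n x_i`. -/
def iterateAverage {d : ℕ} (x : ℕ → EuclideanSpace ℝ (Fin d)) (n : ℕ) : EuclideanSpace ℝ (Fin d) :=
  (n : ℝ)⁻¹ • ∑ i ∈ Finset.Icc 1 n, x i

/-- `t_i`: the largest of `a 1, a 2, …` that is at most `i`, that is, `a m` for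
`a m ≤ i < a (m + 1)`. -/
def batchStart (a : ℕ → ℕ) (i : ℕ) : ℕ :=
  sSup {s : ℕ | s ≤ i ∧ ∃ m, 1 ≤ m ∧ a m = s}

/-- `l_i = i - t_i + 1`, the length of the batch `{t_i, …, i}`. -/
def batchLength (a : ℕ → ℕ) (i : ℕ) : ℕ :=
  i + 1 - batchStart a i

/-- `∑_{k = t_i}^i x_k - l_i x̄_n`. -/
def centredBatchSum {d : ℕ} (a : ℕ → ℕ) (x : ℕ → EuclideanSpace ℝ (Fin d)) (n i : ℕ) :
    EuclideanSpace ℝ (Fin d) :=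
  ∑ k ∈ Finset.Icc (batchStart a i) i, x k - (batchLength a i : ℝ) • iterateAverage x n

/-- The recursive batch-means estimator `Σ̂_n` computed from the iterates `x_1, …, x_n`. -/
def covEstimator {d : ℕ} (a : ℕ → ℕ) (x : ℕ → EuclideanSpace ℝ (Fin d)) (n : ℕ) :
    Matrix (Fin d) (Fin d) ℝ :=
  (∑ i ∈ Finset.Icc 1 n, (batchLength a i : ℝ))⁻¹ •
    ∑ i ∈ Finset.Icc 1 n, Matrix.of fun j k =>
      centredBatchSum a x n i j * centredBatchSum a x n i k

/-- The σ-algebra generated by the first `n` samples. -/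
abbrev pastSigma {Ω Ξ : Type*} [MeasurableSpace Ξ] (ξ : ℕ → Ω → Ξ) (n : ℕ) : MeasurableSpace Ω :=
  ⨆ i, ⨆ _ : i < n, MeasurableSpace.comap (ξ i) inferInstance

/-- The gradient difference `ε_{n+1} = ∇F(x_n) - ∇f(x_n, ξ_{n+1})`
(the sample `ξ_{n+1}` is `ξ n`). -/
def gradNoise {d : ℕ} {Ω Ξ : Type*} [MeasurableSpace Ξ]
    (f : EuclideanSpace ℝ (Fin d) → Ξ → ℝ) (P : Measure Ξ) (η α : ℝ)
    (x₀ : EuclideanSpace ℝ (Fin d)) (ξ : ℕ → Ω → Ξ) (n : ℕ) (ω : Ω) :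
    EuclideanSpace ℝ (Fin d) :=
  gradient (objective f P) (sgd f η α x₀ (fun k => ξ k ω) n) -
    lossGrad f (sgd f η α x₀ (fun k => ξ k ω) n) (ξ n ω)

/-- The conditional second moment matrix `E [ε_{n+1} ε_{n+1}ᵀ | ξ_1, …, ξ_n]`. -/
def condNoiseCov {d : ℕ} {Ω Ξ : Type*} [MeasurableSpace Ω] [MeasurableSpace Ξ] (μ : Measure Ω)
    (f : EuclideanSpace ℝ (Fin d) → Ξ → ℝ) (P : Measure Ξ) (η α : ℝ)
    (x₀ : EuclideanSpace ℝ (Fin d)) (ξ : ℕ → Ω → Ξ) (n : ℕ) (ω : Ω) :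
    Matrix (Fin d) (Fin d) ℝ :=
  Matrix.of fun i j =>
    (μ[fun ω' => gradNoise f P η α x₀ ξ n ω' i * gradNoise f P η α x₀ ξ n ω' j |
      pastSigma ξ n]) ω

/-- The assumptions on the objective function `F` and its minimizer `xs`. -/
structure RegularObjective {d : ℕ} (F : EuclideanSpace ℝ (Fin d) → ℝ)
    (xs : EuclideanSpace ℝ (Fin d)) : Prop where
  minimizer : ∀ x, F xs ≤ F x
  contDiff : ContDiff ℝ 1 F
  strongConvex : ∃ c : ℝ, 0 < c ∧ ∀ x₁ x₂,
    F x₁ + inner ℝ (gradient F x₁) (x₂ - x₁) + c / 2 * ‖x₁ - x₂‖ ^ 2 ≤ F x₂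
  lipschitz : ∃ L : ℝ, 0 < L ∧ ∀ x₁ x₂, ‖gradient F x₁ - gradient F x₂‖ ≤ L * ‖x₁ - x₂‖
  /-- The Hessian at the minimizer exists. -/
  hessian : DifferentiableAt ℝ (gradient F) xs
  /-- The Taylor expansion of the gradient at the minimizer has a quadratic remainder. -/
  taylor : (fun x => gradient F x - gradient F xs - fderiv ℝ (gradient F) xs (x - xs))
    =O[𝓝 xs] fun x => ‖x - xs‖ ^ 2

/-- The assumptions on the loss function and on the gradient noise along the iterates. -/
structure RegularNoise {d : ℕ} {Ω Ξ : Type*} [MeasurableSpace Ω] [MeasurableSpace Ξ]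
    (μ : Measure Ω) (f : EuclideanSpace ℝ (Fin d) → Ξ → ℝ) (P : Measure Ξ) (η α : ℝ)
    (x₀ xs : EuclideanSpace ℝ (Fin d)) (ξ : ℕ → Ω → Ξ) : Prop where
  contDiff : ∀ z, ContDiff ℝ 1 fun x => f x z
  uniformIntegrable : ∀ x, ∃ U : Set (EuclideanSpace ℝ (Fin d)), U ∈ 𝓝 x ∧
    UniformIntegrable (fun (y : U) z => lossGrad f (y : EuclideanSpace ℝ (Fin d)) z) 1 P
  /-- The second moment matrix `S` is well defined. -/
  memLp_two : MemLp (lossGrad f xs) 2 P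
  /-- The norm is the operator norm on Euclidean space. -/
  covariance : ∃ C : ℝ, ∀ n, ∀ᵐ ω ∂μ,
    ‖Matrix.toEuclideanCLM (𝕜 := ℝ)
        (condNoiseCov μ f P η α x₀ ξ n ω - gradSecondMoment f P xs)‖ ≤
      C * (‖sgd f η α x₀ (fun k => ξ k ω) n - xs‖ +
        ‖sgd f η α x₀ (fun k => ξ k ω) n - xs‖ ^ 2)
  integrable_four : ∀ n, Integrable (fun ω => ‖gradNoise f P η α x₀ ξ n ω‖ ^ 4) μ
  fourthMoment : ∃ C : ℝ, ∀ n, ∀ᵐ ω ∂μ,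
    (μ[fun ω' => ‖gradNoise f P η α x₀ ξ n ω'‖ ^ 4 | pastSigma ξ n]) ω ≤
      C * (1 + ‖sgd f η α x₀ (fun k => ξ k ω) n - xs‖ ^ 4)

end

/-!
With `δ_n = x_n - x*` and `A = ∇²F(x*)`, the recursion reads
`δ_n = δ_{n-1} - η_n (A δ_{n-1} + r_n - ε_n)`, where `r_n = O(‖δ_{n-1}‖²)` and `ε_n` is a martingale
difference. Solving for `A δ_{n-1}` and summing gives, over any window of indices,

  `A ∑ δ_k = ∑ ε_k + (telescoping terms (δ_{k-1} - δ_k) / η_k) - ∑ r_k`.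

Strong convexity gives `E ‖δ_n‖⁴ = O(n ^ (-2α))`
(`eventually_integral_norm_pow_four_le` with the deterministic `exists_le_mul_sq_of_recursion`), so
after summation by parts everything except `∑ ε_k` is negligible in mean square. Hence all statements
about the iterates reduce to statements about the sums `∑ ε_k`, tested against a fixed vector.

* The central limit theorem for `√n (x̄_n - x*)` follows from a martingale central limit theorem for
  characteristic functions (`tendsto_integral_exp_martingale_sum`,
  `IsRobbinsMonro.tendsto_integral_exp_average`).
* For the batch means, the squares `(∑_{k = t_i}^i ε_k)²`, weighted by `1 / ∑ l_i`, concentrate: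
  in the expansion of the square, subtracting the conditional variances of the individual `ε_k`
  leaves martingale increments, which are orthogonal to each other, so that the variance is of the
  order `(max batch length)² / ∑ l_i`. This gives consistency in `L¹`
  (`IsMartingaleDifference.tendsto_integral_abs_batchMeans_sub`,
  `IsRobbinsMonro.tendsto_integral_abs_batchMeans_sub`). The two conditions on the batches,
  `(max l_i)² = o(∑ l_i)` and `∑_{i ≤ n} i ^ α = o(∑ l_i)`, hold for `a_k = ⌊C k ^ β⌋` because
  `β > 1 / (1 - α)` (`exists_batchLength_bounds`).

Stochastic gradient descent is an instance (`isRobbinsMonro_sgd`). What has to be proved for this is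
that the noise is centred, that is, that `∇F` is the mean of `∇f(·, ξ)`; it follows from Vitali's
theorem applied to difference quotients (`gradient_objective`). Slutsky's theorem and the
portmanteau theorem turn the two limits into coverage probabilities
(`tendsto_measureReal_abs_le_quantile_mul_sqrt`, `tendsto_measureReal_dotProduct_inv_mulVec_le`);
in the multivariate case the inverse of the estimator is replaced by its adjugate, which depends
continuously on it.
-/

/-! ### Moments of sums with conditionally centred increments -/

section Moments

variable {Ω : Type*} {m mΩ : MeasurableSpace Ω} {μ : Measure Ω}
  {E : Type*} [NormedAddCommGroup E]
  {E' : Type*} [NormedAddCommGroup E']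

lemma integrable_norm_pow_mul_norm_pow_of_memLp_four [IsProbabilityMeasure μ]
    {f : Ω → E} {g : Ω → E'} (hf : MemLp f 4 μ) (hg : MemLp g 4 μ) {a b : ℕ} (hab : a + b ≤ 4) :
    Integrable (fun ω => ‖f ω‖ ^ a * ‖g ω‖ ^ b) μ := by
  have hf4 : Integrable (fun ω => ‖f ω‖ ^ 4) μ := MemLp.integrable_norm_pow' (p := 4) hf
  have hg4 : Integrable (fun ω => ‖g ω‖ ^ 4) μ := MemLp.integrable_norm_pow' (p := 4) hg
  refine ((integrable_const (1 : ℝ)).add (hf4.add hg4)).mono'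
    ((hf.1.norm.pow a).mul (hg.1.norm.pow b)) (ae_of_all _ fun ω => ?_)
  rw [Real.norm_of_nonneg (by positivity)]
  change _ ≤ 1 + (‖f ω‖ ^ 4 + ‖g ω‖ ^ 4)
  have hx : 0 ≤ ‖f ω‖ := norm_nonneg _
  have hy : 0 ≤ ‖g ω‖ := norm_nonneg _
  generalize ‖f ω‖ = x at hx
  generalize ‖g ω‖ = y at hy
  have h1 : x ≤ max 1 (max x y) := by simp
  have h2 : y ≤ max 1 (max x y) := by simp
  have h3 : 1 ≤ max 1 (max x y) := by simp
  calc x ^ a * y ^ b ≤ max 1 (max x y) ^ a * max 1 (max x y) ^ b := by gcongr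
    _ = max 1 (max x y) ^ (a + b) := (pow_add _ _ _).symm
    _ ≤ max 1 (max x y) ^ 4 := pow_le_pow_right₀ h3 hab
    _ ≤ 1 + (x ^ 4 + y ^ 4) := by
      rcases max_choice 1 (max x y) with h | h <;> rw [h]
      · have := pow_nonneg hx 4
        have := pow_nonneg hy 4
        linarith
      · rcases max_choice x y with h' | h' <;> rw [h']
        · have := pow_nonneg hy 4
          linarith
        · have := pow_nonneg hx 4
          linarith

lemma integrable_norm_pow_of_memLp_four [IsProbabilityMeasure μ]
    {f : Ω → E} (hf : MemLp f 4 μ) {a : ℕ} (ha : a ≤ 4) :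
    Integrable (fun ω => ‖f ω‖ ^ a) μ := by
  simpa using integrable_norm_pow_mul_norm_pow_of_memLp_four hf hf (a := a) (b := 0) (by simpa)

lemma integral_bilin_eq_zero_of_condExp_eq_zero [IsProbabilityMeasure μ]
    [NormedSpace ℝ E] [NormedSpace ℝ E'] [CompleteSpace E']
    {G : Type*} [NormedAddCommGroup G] [NormedSpace ℝ G] [CompleteSpace G]
    (B : E →L[ℝ] E' →L[ℝ] G) (hm : m ≤ mΩ) {f : Ω → E} {g : Ω → E'}
    (hf : StronglyMeasurable[m] f) (hfg : Integrable (fun ω => B (f ω) (g ω)) μ)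
    (hg : Integrable g μ) (h0 : μ[g | m] =ᵐ[μ] 0) : ∫ ω, B (f ω) (g ω) ∂μ = 0 := by
  rw [← integral_condExp hm]
  rw [integral_congr_ae (g := fun _ => (0 : G))]
  · simp
  · filter_upwards [condExp_bilin_of_stronglyMeasurable_left B hf hfg hg, h0] with ω h1 h2
    rw [h1, h2]
    simp

lemma integral_mul_eq_zero_of_condExp_eq_zero [IsProbabilityMeasure μ] (hm : m ≤ mΩ)
    {f g : Ω → ℝ} (hf : StronglyMeasurable[m] f) (hfg : Integrable (fun ω => f ω * g ω) μ)
    (hg : Integrable g μ) (h0 : μ[g | m] =ᵐ[μ] 0) : ∫ ω, f ω * g ω ∂μ = 0 :=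
  integral_bilin_eq_zero_of_condExp_eq_zero (ContinuousLinearMap.mul ℝ ℝ) hm hf hfg hg h0

/-- The triangle inequality in `L²` for finite sums, in terms of bounds on the second moments. -/
lemma integral_norm_sum_sq_le {ι : Type*} (s : Finset ι) {Y : ι → Ω → E} {b : ι → ℝ}
    (hY : ∀ i ∈ s, Integrable (fun ω => ‖Y i ω‖ ^ 2) μ) (hb : ∀ i ∈ s, 0 < b i)
    (hYb : ∀ i ∈ s, ∫ ω, ‖Y i ω‖ ^ 2 ∂μ ≤ b i ^ 2) :
    ∫ ω, ‖∑ i ∈ s, Y i ω‖ ^ 2 ∂μ ≤ (∑ i ∈ s, b i) ^ 2 := by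
  rcases s.eq_empty_or_nonempty with rfl | hs
  · simp
  have hpos : 0 < ∑ i ∈ s, b i := Finset.sum_pos hb hs
  have hint : Integrable (fun ω => (∑ i ∈ s, b i) * ∑ i ∈ s, ‖Y i ω‖ ^ 2 / b i) μ :=
    (integrable_finsetSum _ fun i hi => (hY i hi).div_const _).const_mul _
  calc ∫ ω, ‖∑ i ∈ s, Y i ω‖ ^ 2 ∂μ
      ≤ ∫ ω, (∑ i ∈ s, b i) * ∑ i ∈ s, ‖Y i ω‖ ^ 2 / b i ∂μ := by
        refine integral_mono_of_nonneg (ae_of_all _ fun ω => by positivity) hint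
          (ae_of_all _ fun ω => ?_)
        have h1 := Finset.sq_sum_div_le_sum_sq_div s (fun i => ‖Y i ω‖) hb
        rw [div_le_iff₀ hpos] at h1
        have h2 : ‖∑ i ∈ s, Y i ω‖ ^ 2 ≤ (∑ i ∈ s, ‖Y i ω‖) ^ 2 := by
          gcongr
          exact norm_sum_le _ _
        simpa [mul_comm] using h2.trans h1
    _ = (∑ i ∈ s, b i) * ∑ i ∈ s, (∫ ω, ‖Y i ω‖ ^ 2 ∂μ) / b i := by
        rw [integral_const_mul, integral_finsetSum _ fun i hi => (hY i hi).div_const _]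
        simp_rw [integral_div]
    _ ≤ (∑ i ∈ s, b i) * ∑ i ∈ s, b i := by
        refine mul_le_mul_of_nonneg_left (Finset.sum_le_sum fun i hi => ?_) hpos.le
        rw [div_le_iff₀ (hb i hi), ← sq]
        exact hYb i hi
    _ = _ := (sq _).symm

lemma integral_abs_le_sqrt_integral_sq [IsProbabilityMeasure μ] {Y : Ω → ℝ} (hY : MemLp Y 2 μ) :
    ∫ ω, |Y ω| ∂μ ≤ √(∫ ω, Y ω ^ 2 ∂μ) := by
  have h1 : Integrable (fun ω => |Y ω|) μ := (hY.integrable (by norm_num)).abs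
  have h2 : Integrable (fun ω => Y ω ^ 2) μ := hY.integrable_sq
  set c := ∫ ω, |Y ω| ∂μ
  have h : 0 ≤ ∫ ω, (|Y ω| - c) ^ 2 ∂μ := integral_nonneg fun ω => sq_nonneg _
  have h' : ∫ ω, (|Y ω| - c) ^ 2 ∂μ = ∫ ω, Y ω ^ 2 ∂μ - c ^ 2 := by
    have : ∀ ω, (|Y ω| - c) ^ 2 = Y ω ^ 2 - 2 * c * |Y ω| + c ^ 2 := fun ω => by
      rw [sub_sq, sq_abs]
      ring
    simp_rw [this]
    rw [integral_add (f := fun ω => Y ω ^ 2 - 2 * c * |Y ω|) (h2.sub (h1.const_mul _))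
        (integrable_const _),
      integral_sub h2 (h1.const_mul _), integral_const_mul]
    simp only [integral_const, probReal_univ, smul_eq_mul, one_mul]
    change _ - 2 * c * c + c ^ 2 = _
    ring
  exact Real.le_sqrt_of_sq_le (by linarith)

variable [InnerProductSpace ℝ E]

/-- The fourth moment of a sum whose second term is conditionally centred given the first one. The
only term of the expansion of `‖D + e‖ ^ 4` that is odd and of first order in `e` has mean zero. -/
lemma integral_norm_add_pow_four_le [IsProbabilityMeasure μ] [CompleteSpace E] (hm : m ≤ mΩ)
    {D e : Ω → E} (hD : StronglyMeasurable[m] D) (hD4 : MemLp D 4 μ) (he4 : MemLp e 4 μ)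
    (h0 : μ[e | m] =ᵐ[μ] 0) :
    ∫ ω, ‖D ω + e ω‖ ^ 4 ∂μ ≤
      ∫ ω, ‖D ω‖ ^ 4 ∂μ + 8 * ∫ ω, ‖D ω‖ ^ 2 * ‖e ω‖ ^ 2 ∂μ + 3 * ∫ ω, ‖e ω‖ ^ 4 ∂μ := by
  have hDi := integrable_norm_pow_of_memLp_four hD4 (a := 4) le_rfl
  have hei := integrable_norm_pow_of_memLp_four he4 (a := 4) le_rfl
  have hDe := integrable_norm_pow_mul_norm_pow_of_memLp_four hD4 he4 (a := 2) (b := 2) le_rfl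
  have hcross : Integrable (fun ω => innerSL ℝ ((4 * ‖D ω‖ ^ 2) • D ω) (e ω)) μ := by
    refine ((integrable_norm_pow_mul_norm_pow_of_memLp_four hD4 he4 (a := 3) (b := 1)
      le_rfl).const_mul 4).mono' ?_ (ae_of_all _ fun ω => ?_)
    · simp only [innerSL_apply_apply]
      exact ((((hD4.1.norm.pow 2).const_mul 4).smul hD4.1)).inner he4.1
    · simp only [innerSL_apply_apply]
      refine (norm_inner_le_norm _ _).trans (le_of_eq ?_)
      rw [norm_smul, Real.norm_of_nonneg (by positivity)]
      ring
  have hzero := integral_bilin_eq_zero_of_condExp_eq_zero (innerSL ℝ) hm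
    (f := fun ω => (4 * ‖D ω‖ ^ 2) • D ω) (g := e)
    (((hD.norm.pow 2).const_mul 4).smul hD) hcross (he4.integrable (by norm_num)) h0
  calc ∫ ω, ‖D ω + e ω‖ ^ 4 ∂μ
      ≤ ∫ ω, (‖D ω‖ ^ 4 + 8 * (‖D ω‖ ^ 2 * ‖e ω‖ ^ 2) + 3 * ‖e ω‖ ^ 4
          + innerSL ℝ ((4 * ‖D ω‖ ^ 2) • D ω) (e ω)) ∂μ := by
        refine integral_mono (integrable_norm_pow_of_memLp_four (hD4.add he4) le_rfl)
          (((hDi.add (hDe.const_mul 8)).add (hei.const_mul 3)).add hcross) fun ω => ?_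
        simp only [innerSL_apply_apply, inner_smul_left]
        have hsq : ‖D ω + e ω‖ ^ 4 = (‖D ω‖ ^ 2 + 2 * inner ℝ (D ω) (e ω) + ‖e ω‖ ^ 2) ^ 2 := by
          rw [← norm_add_sq_real]
          ring
        have hcs := abs_real_inner_le_norm (D ω) (e ω)
        have hcs2 := sq_le_sq' (abs_le.1 hcs).1 (abs_le.1 hcs).2
        have hle := le_of_abs_le hcs
        rw [hsq]
        simp only [map_mul, map_ofNat, map_pow, conj_trivial]
        have h1 := mul_le_mul_of_nonneg_right hle (sq_nonneg ‖e ω‖)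
        have h2 := mul_nonneg (sq_nonneg (‖D ω‖ - ‖e ω‖)) (sq_nonneg ‖e ω‖)
        nlinarith
    _ = _ := by
        rw [integral_add ((hDi.fun_add (hDe.const_mul 8)).fun_add (hei.const_mul 3)) hcross, hzero,
          integral_add (hDi.fun_add (hDe.const_mul 8)) (hei.const_mul 3),
          integral_add hDi (hDe.const_mul 8), integral_const_mul, integral_const_mul, add_zero]

end Moments

/-! ### A central limit theorem for martingale differences -/

section MartingaleCLT

open Complex in
lemma norm_exp_mul_I_sub_taylor_two_le (x : ℝ) :
    ‖exp (x * I) - 1 - x * I + x ^ 2 / 2‖ ≤ 4 * |x| ^ 3 := by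
  rcases le_total |x| 1 with h | h
  · have h1 := norm_exp_sub_sum_le_norm_mul_exp ((x : ℂ) * I) 3
    have hn : ‖(x : ℂ) * I‖ = |x| := by simp
    rw [hn] at h1
    have h2 : exp ((x : ℂ) * I) - ∑ m ∈ Finset.range 3, ((x : ℂ) * I) ^ m / (m.factorial : ℂ)
        = exp (x * I) - 1 - x * I + x ^ 2 / 2 := by
      simp [Finset.sum_range_succ, Nat.factorial, mul_pow]
      ring
    rw [h2] at h1
    have h3 : Real.exp |x| ≤ 4 := by
      calc Real.exp |x| ≤ Real.exp 1 := Real.exp_le_exp.2 h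
        _ ≤ 4 := by linarith [Real.exp_one_lt_d9]
    have h4 : 0 ≤ |x| ^ 3 := by positivity
    nlinarith
  · have h1 : ‖exp (x * I) - 1 - x * I + x ^ 2 / 2‖ ≤ 1 + 1 + |x| + |x| ^ 2 / 2 := by
      calc _ ≤ ‖exp (x * I)‖ + ‖(1 : ℂ)‖ + ‖(x : ℂ) * I‖ + ‖(x : ℂ) ^ 2 / 2‖ :=
            (norm_add_le _ _).trans (by
              gcongr
              exact (norm_sub_le _ _).trans (by gcongr; exact norm_sub_le _ _))
        _ = _ := by simp [norm_exp_ofReal_mul_I]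
    nlinarith [mul_nonneg (sub_nonneg.2 h) (sub_nonneg.2 h), pow_nonneg (abs_nonneg x) 3,
      mul_nonneg (mul_nonneg (sub_nonneg.2 h) (sub_nonneg.2 h)) (sub_nonneg.2 h)]

variable {Ω : Type*} {m mΩ : MeasurableSpace Ω} {μ : Measure Ω}

open Complex in
/-- One step of the telescoping argument for the martingale central limit theorem. -/
lemma norm_integral_mul_exp_sub_le [IsProbabilityMeasure μ] (hm : m ≤ mΩ)
    {Z : Ω → ℂ} (hZ : StronglyMeasurable[m] Z) (hZ1 : ∀ ω, ‖Z ω‖ ≤ 1)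
    {X : Ω → ℝ} (hX : MemLp X 4 μ) (hX0 : μ[X | m] =ᵐ[μ] 0) {σ2 θ : ℝ}
    (hσ : 0 ≤ σ2) (hθ : 0 ≤ θ) (hsmall : θ ^ 2 * σ2 / 2 ≤ 1) :
    ‖∫ ω, Z ω * (exp ((θ * X ω : ℝ) * I) - (Real.exp (-(θ ^ 2 * σ2 / 2)) : ℝ)) ∂μ‖ ≤
      4 * θ ^ 3 * ∫ ω, |X ω| ^ 3 ∂μ
        + θ ^ 2 / 2 * ∫ ω, |(μ[fun ω' => X ω' ^ 2 | m]) ω - σ2| ∂μ + (θ ^ 2 * σ2 / 2) ^ 2 := by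
  set v := μ[fun ω' => X ω' ^ 2 | m] with hv
  set y := θ ^ 2 * σ2 / 2 with hy
  have hy0 : 0 ≤ y := by positivity
  have hXm : AEStronglyMeasurable X μ := hX.1
  have hX1 : Integrable X μ := hX.integrable (by norm_num)
  have hX2 : Integrable (fun ω => X ω ^ 2) μ := by
    simpa using integrable_norm_pow_of_memLp_four hX (a := 2) (by norm_num)
  have hX3 : Integrable (fun ω => |X ω| ^ 3) μ := by
    simpa using integrable_norm_pow_of_memLp_four hX (a := 3) (by norm_num)
  have hvi : Integrable v μ := integrable_condExp
  have hZm : AEStronglyMeasurable Z μ := (hZ.mono hm).aestronglyMeasurable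
  have hint : ∀ {g : Ω → ℂ}, Integrable g μ → Integrable (fun ω => Z ω * g ω) μ := fun hg =>
    hg.bdd_mul hZm (ae_of_all _ hZ1)
  have hofReal : ∀ {g : Ω → ℝ}, Integrable g μ → Integrable (fun ω => (g ω : ℂ)) μ :=
    fun hg => hg.ofReal
  -- the conditionally centred first order terms
  have hB : ∀ g : Ω → ℝ, Integrable g μ → μ[g | m] =ᵐ[μ] 0 → ∫ ω, Z ω * (g ω : ℂ) ∂μ = 0 := by
    intro g hg h0
    have := integral_bilin_eq_zero_of_condExp_eq_zero (μ := μ)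
      (ContinuousLinearMap.lsmul ℝ ℝ (E := ℂ)).flip hm hZ (g := g) ?_ hg h0
    · simpa [mul_comm] using this
    · simpa [mul_comm] using hint hg.ofReal
  have h1 := hB X hX1 hX0
  have h2 : ∫ ω, Z ω * ((X ω ^ 2 - v ω : ℝ) : ℂ) ∂μ = 0 := by
    refine hB _ (hX2.sub hvi) ?_
    filter_upwards [condExp_sub hX2 hvi m] with ω h3
    change (μ[(fun ω => X ω ^ 2) - v | m]) ω = 0
    rw [h3, Pi.sub_apply, condExp_of_stronglyMeasurable hm stronglyMeasurable_condExp hvi]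
    exact sub_self _
  have hexp : Integrable (fun ω => exp ((θ * X ω : ℝ) * I) - 1 - (θ * X ω : ℝ) * I
      + ((θ * X ω : ℝ) : ℂ) ^ 2 / 2) μ := by
    have hm1 : AEStronglyMeasurable (fun ω => exp ((θ * X ω : ℝ) * I) - 1 - (θ * X ω : ℝ) * I
      + ((θ * X ω : ℝ) : ℂ) ^ 2 / 2) μ := by
      have hc : Continuous fun x : ℝ => exp ((θ * x : ℝ) * I) - 1 - (θ * x : ℝ) * I
          + ((θ * x : ℝ) : ℂ) ^ 2 / 2 := by fun_prop
      exact hc.comp_aestronglyMeasurable hXm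
    refine (hX3.const_mul (4 * θ ^ 3)).mono' hm1 (ae_of_all _ fun ω => ?_)
    refine (norm_exp_mul_I_sub_taylor_two_le _).trans (le_of_eq ?_)
    rw [abs_mul, abs_of_nonneg hθ]
    ring
  have hXv : Integrable (fun ω => X ω ^ 2 - v ω) μ := hX2.sub hvi
  have hvσ : Integrable (fun ω => v ω - σ2) μ := hvi.sub (integrable_const σ2)
  have i1 := hint hexp
  have i2 := (hint (hofReal hX1)).const_mul (θ * I : ℂ)
  have i3 := (hint (hofReal hXv)).const_mul (-(θ ^ 2 / 2) : ℂ)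
  have i4 := (hint (hofReal hvσ)).const_mul (-(θ ^ 2 / 2) : ℂ)
  have i5 := (hint (integrable_const (1 : ℂ))).mul_const ((1 - y - Real.exp (-y) : ℝ) : ℂ)
  have hsplit : ∫ ω, Z ω * (exp ((θ * X ω : ℝ) * I) - (Real.exp (-y) : ℝ)) ∂μ =
      ∫ ω, Z ω * (exp ((θ * X ω : ℝ) * I) - 1 - (θ * X ω : ℝ) * I
        + ((θ * X ω : ℝ) : ℂ) ^ 2 / 2) ∂μ
      + -(θ ^ 2 / 2) * ∫ ω, Z ω * ((v ω - σ2 : ℝ) : ℂ) ∂μ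
      + (∫ ω, Z ω * 1 ∂μ) * ((1 - y - Real.exp (-y) : ℝ) : ℂ) := by
    have e : ∀ ω, Z ω * (exp ((θ * X ω : ℝ) * I) - (Real.exp (-y) : ℝ)) =
        (((Z ω * (exp ((θ * X ω : ℝ) * I) - 1 - (θ * X ω : ℝ) * I
        + ((θ * X ω : ℝ) : ℂ) ^ 2 / 2)
        + (θ * I : ℂ) * (Z ω * (X ω : ℂ)))
        + (-(θ ^ 2 / 2) : ℂ) * (Z ω * ((X ω ^ 2 - v ω : ℝ) : ℂ)))
        + (-(θ ^ 2 / 2) : ℂ) * (Z ω * ((v ω - σ2 : ℝ) : ℂ)))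
        + (Z ω * 1) * ((1 - y - Real.exp (-y) : ℝ) : ℂ) := fun ω => by
      rw [hy]
      push_cast
      ring
    simp_rw [e]
    rw [integral_add (((i1.fun_add i2).fun_add i3).fun_add i4) i5,
      integral_add ((i1.fun_add i2).fun_add i3) i4, integral_add (i1.fun_add i2) i3,
      integral_add i1 i2, integral_const_mul, integral_const_mul,
      integral_const_mul, integral_mul_const, h1, h2]
    ring
  rw [hsplit]
  have b1 : ‖∫ ω, Z ω * (exp ((θ * X ω : ℝ) * I) - 1 - (θ * X ω : ℝ) * I
        + ((θ * X ω : ℝ) : ℂ) ^ 2 / 2) ∂μ‖ ≤ 4 * θ ^ 3 * ∫ ω, |X ω| ^ 3 ∂μ := by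
    rw [← integral_const_mul]
    refine norm_integral_le_of_norm_le (hX3.const_mul _) (ae_of_all _ fun ω => ?_)
    rw [norm_mul]
    calc _ ≤ 1 * (4 * |θ * X ω| ^ 3) := by
          gcongr
          · exact hZ1 ω
          · exact norm_exp_mul_I_sub_taylor_two_le _
      _ = _ := by
          rw [abs_mul, abs_of_nonneg hθ]
          ring
  have b2 : ‖-((θ : ℂ) ^ 2 / 2) * ∫ ω, Z ω * ((v ω - σ2 : ℝ) : ℂ) ∂μ‖ ≤
      θ ^ 2 / 2 * ∫ ω, |v ω - σ2| ∂μ := by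
    rw [norm_mul]
    have : ‖-((θ : ℂ) ^ 2 / 2)‖ = θ ^ 2 / 2 := by
      rw [norm_neg, norm_div, norm_pow, norm_real, Real.norm_of_nonneg hθ]
      simp
    rw [this]
    gcongr
    refine norm_integral_le_of_norm_le (hvi.sub (integrable_const σ2)).abs
      (ae_of_all _ fun ω => ?_)
    rw [norm_mul, norm_real, Real.norm_eq_abs]
    exact mul_le_of_le_one_left (abs_nonneg _) (hZ1 ω)
  have b3 : ‖(∫ ω, Z ω * 1 ∂μ) * ((1 - y - Real.exp (-y) : ℝ) : ℂ)‖ ≤ y ^ 2 := by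
    rw [norm_mul, norm_real, Real.norm_eq_abs]
    have c1 : ‖∫ ω, Z ω * 1 ∂μ‖ ≤ 1 := by
      refine (norm_integral_le_of_norm_le (integrable_const (1 : ℝ))
        (ae_of_all _ fun ω => ?_)).trans (by simp)
      simpa using hZ1 ω
    have c2 : |1 - y - Real.exp (-y)| ≤ y ^ 2 := by
      have := Real.abs_exp_sub_one_sub_id_le (x := -y) (by rwa [abs_neg, abs_of_nonneg hy0])
      rw [abs_sub_comm, neg_sq] at this
      rw [abs_sub_comm]
      rw [abs_sub_comm] at this
      convert this using 2
      ring
    calc _ ≤ 1 * y ^ 2 := by gcongr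
      _ = _ := one_mul _
  exact (norm_add₃_le).trans (by gcongr)

open Complex in
/-- The martingale central limit theorem, at the level of the characteristic function at `1`: the
increments have bounded third moments and conditional variances that converge in mean. Multiplying
the increments by a scalar gives the characteristic function at every other point. -/
theorem tendsto_integral_exp_martingale_sum [IsProbabilityMeasure μ] (ℱ : Filtration ℕ mΩ)
    {X : ℕ → Ω → ℝ} (hXm : ∀ n, StronglyMeasurable[ℱ (n + 1)] (X n))
    (hX : ∀ n, MemLp (X n) 4 μ) (hX0 : ∀ n, μ[X n | ℱ n] =ᵐ[μ] 0) {σ2 M : ℝ} (hσ : 0 ≤ σ2)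
    (hM : ∀ n, ∫ ω, |X n ω| ^ 3 ∂μ ≤ M)
    (hv : Tendsto (fun n => ∫ ω, |(μ[fun ω' => X n ω' ^ 2 | ℱ n]) ω - σ2| ∂μ) atTop (𝓝 0)) :
    Tendsto (fun n : ℕ => ∫ ω, exp (((√n)⁻¹ * ∑ k ∈ Finset.range n, X k ω : ℝ) * I) ∂μ) atTop
      (𝓝 (exp (-(σ2 / 2 : ℝ)))) := by
  set V : ℕ → ℝ := fun n => ∫ ω, |(μ[fun ω' => X n ω' ^ 2 | ℱ n]) ω - σ2| ∂μ with hV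
  -- The error is the sum of the errors made in replacing, one summand at a time, the factor
  -- contributed by `X k` by the corresponding Gaussian factor.
  have hbound : ∀ᶠ n : ℕ in atTop,
      ‖∫ ω, exp (((√n)⁻¹ * ∑ k ∈ Finset.range n, X k ω : ℝ) * I) ∂μ - exp (-(σ2 / 2 : ℝ))‖ ≤
      4 * M * (√n)⁻¹ + 1 / 2 * ((n : ℝ)⁻¹ * ∑ k ∈ Finset.range n, V k)
        + σ2 ^ 2 / 4 * (n : ℝ)⁻¹ := by
    filter_upwards [eventually_ge_atTop 1, eventually_ge_atTop ⌈σ2⌉₊] with n hn1 hnσ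
    have hn0 : (0 : ℝ) < n := by exact_mod_cast hn1
    set θ : ℝ := (√n)⁻¹ with hθ
    have hθ0 : 0 ≤ θ := by positivity
    have hθ2 : θ ^ 2 = (n : ℝ)⁻¹ := by rw [hθ, inv_pow, Real.sq_sqrt hn0.le]
    set y : ℝ := θ ^ 2 * σ2 / 2 with hy
    have hsmall : y ≤ 1 := by
      have : σ2 ≤ n := (Nat.le_ceil _).trans (by exact_mod_cast hnσ)
      have h2 : (n : ℝ)⁻¹ * σ2 ≤ 1 := by
        rw [inv_mul_le_iff₀ hn0]
        linarith
      rw [hy, hθ2]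
      linarith
    have hy0 : 0 ≤ y := by positivity
    let S : ℕ → Ω → ℝ := fun j ω => ∑ k ∈ Finset.range j, X k ω
    have hSm : ∀ j, StronglyMeasurable[ℱ j] (S j) := fun j => by
      refine Finset.stronglyMeasurable_fun_sum _ fun k hk => ?_
      exact (hXm k).mono (ℱ.mono (Finset.mem_range.1 hk))
    let Z : ℕ → Ω → ℂ := fun j ω => exp ((θ * S j ω : ℝ) * I)
    have hZm : ∀ j, StronglyMeasurable[ℱ j] (Z j) := fun j => by
      have hc : Continuous fun x : ℝ => exp ((θ * x : ℝ) * I) := by fun_prop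
      exact hc.comp_stronglyMeasurable (hSm j)
    have hZ1 : ∀ j ω, ‖Z j ω‖ ≤ 1 := fun j ω => (norm_exp_ofReal_mul_I _).le
    have hZi : ∀ j, Integrable (Z j) μ := fun j =>
      Integrable.of_bound ((hZm j).mono (ℱ.le j)).aestronglyMeasurable 1 (ae_of_all _ (hZ1 j))
    let φ : ℕ → ℂ := fun j => (Real.exp (-y) : ℂ) ^ (n - j) * ∫ ω, Z j ω ∂μ
    have hstep : ∀ j ∈ Finset.range n, ‖φ (j + 1) - φ j‖ ≤
        4 * θ ^ 3 * M + θ ^ 2 / 2 * V j + y ^ 2 := by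
      intro j hj
      have hjn : j < n := Finset.mem_range.1 hj
      have e1 : φ (j + 1) - φ j = (Real.exp (-y) : ℂ) ^ (n - (j + 1)) *
          ∫ ω, Z j ω * (exp ((θ * X j ω : ℝ) * I) - (Real.exp (-y) : ℝ)) ∂μ := by
        have e2 : ∀ ω, Z j ω * (exp ((θ * X j ω : ℝ) * I) - (Real.exp (-y) : ℝ)) =
            Z (j + 1) ω - (Real.exp (-y) : ℂ) * Z j ω := fun ω => by
          have : Z (j + 1) ω = Z j ω * exp ((θ * X j ω : ℝ) * I) := by
            simp only [Z, S, Finset.sum_range_succ]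
            rw [← Complex.exp_add]
            congr 1
            push_cast
            ring
          rw [this]
          push_cast
          ring
        simp_rw [e2]
        rw [integral_sub (hZi _) ((hZi _).const_mul _), integral_const_mul]
        simp only [φ]
        rw [show n - j = (n - (j + 1)) + 1 by omega, pow_succ]
        ring
      rw [e1, norm_mul, norm_pow, norm_real, Real.norm_of_nonneg (Real.exp_pos _).le]
      have h1 : Real.exp (-y) ^ (n - (j + 1)) ≤ 1 :=
        pow_le_one₀ (Real.exp_pos _).le (Real.exp_le_one_iff.2 (by linarith))
      refine (mul_le_of_le_one_left (norm_nonneg _) h1).trans ?_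
      refine (norm_integral_mul_exp_sub_le (ℱ.le j) (hZm j) (hZ1 j) (hX j) (hX0 j) hσ hθ0
        hsmall).trans ?_
      gcongr
      exact hM j
    have hφn : φ n = ∫ ω, exp ((θ * ∑ k ∈ Finset.range n, X k ω : ℝ) * I) ∂μ := by
      simp [φ, Z, S]
    have hφ0 : φ 0 = exp (-(σ2 / 2 : ℝ)) := by
      simp only [φ, Z, S, Finset.range_zero, Finset.sum_empty, mul_zero, ofReal_zero, zero_mul,
        Complex.exp_zero, integral_const, probReal_univ, one_smul, mul_one, Nat.sub_zero]
      rw [← ofReal_pow, ← Real.exp_nat_mul, ofReal_exp, hy, hθ2]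
      congr 1
      have hn0' : (n : ℂ) ≠ 0 := by exact_mod_cast hn0.ne'
      push_cast
      field_simp
    rw [← hφn, ← hφ0, ← Finset.sum_range_sub φ n]
    refine (norm_sum_le_of_le _ hstep).trans (le_of_eq ?_)
    rw [Finset.sum_add_distrib, Finset.sum_add_distrib,
      ← Finset.mul_sum (s := Finset.range n) (f := V)]
    rw [Finset.sum_const, Finset.sum_const, Finset.card_range, nsmul_eq_mul, nsmul_eq_mul]
    have hθ3 : (n : ℝ) * θ ^ 3 = θ := by
      rw [pow_succ, hθ2, ← mul_assoc, mul_inv_cancel₀ hn0.ne', one_mul]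
    have e3 : (n : ℝ) * (4 * θ ^ 3 * M) = 4 * M * (n * θ ^ 3) := by ring
    rw [e3, hθ3, hy, hθ2]
    field_simp
    ring
  rw [tendsto_iff_norm_sub_tendsto_zero]
  refine squeeze_zero' (.of_forall fun n => norm_nonneg _) hbound ?_
  have h1 : Tendsto (fun n : ℕ => (n : ℝ)⁻¹) atTop (𝓝 0) := tendsto_inv_atTop_nhds_zero_nat
  have h2 : Tendsto (fun n : ℕ => (√n)⁻¹) atTop (𝓝 0) :=
    (Real.tendsto_sqrt_atTop.comp tendsto_natCast_atTop_atTop).inv_tendsto_atTop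
  simpa only [mul_zero, add_zero] using ((h2.const_mul (4 * M)).add (hv.cesaro.const_mul (1 / 2))).add
    (h1.const_mul (σ2 ^ 2 / 4))

end MartingaleCLT

/-! ### Weighted averages and sums over batches -/

section Batches

lemma Finset.sum_Icc_one_eq_sum_range {M : Type*} [AddCommMonoid M] (f : ℕ → M) (n : ℕ) :
    ∑ i ∈ Finset.Icc 1 n, f i = ∑ i ∈ Finset.range n, f (i + 1) := by
  induction n with
  | zero => simp
  | succ n ih => rw [Finset.sum_Icc_succ_top (by omega), ih, Finset.sum_range_succ]

/-- Toeplitz's lemma: weighted averages of a null sequence tend to zero. -/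
lemma tendsto_sum_div_sum_of_isLittleO {f w : ℕ → ℝ} (h : f =o[atTop] w) (hw : ∀ i, 0 ≤ w i)
    (hsum : Tendsto (fun n => ∑ i ∈ Finset.Icc 1 n, w i) atTop atTop) :
    Tendsto (fun n => (∑ i ∈ Finset.Icc 1 n, f i) / ∑ i ∈ Finset.Icc 1 n, w i) atTop (𝓝 0) := by
  simp_rw [Finset.sum_Icc_one_eq_sum_range] at hsum ⊢
  exact ((h.comp_tendsto (tendsto_add_atTop_nat 1)).sum_range (fun i => hw _)
    hsum).tendsto_div_nhds_zero

lemma sum_Icc_isLittleO_card {t : ℕ → ℕ} (ht : Tendsto t atTop atTop) {V : ℕ → ℝ}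
    (hV : Tendsto V atTop (𝓝 0)) (hV0 : ∀ k, 0 ≤ V k) :
    (fun i => ∑ k ∈ Finset.Icc (t i) i, V k) =o[atTop] fun i => ((i + 1 - t i : ℕ) : ℝ) := by
  rw [Asymptotics.isLittleO_iff]
  intro c hc
  obtain ⟨N, hN⟩ := eventually_atTop.1 (hV.eventually_le_const hc)
  filter_upwards [ht.eventually_ge_atTop N] with i hi
  rw [Real.norm_of_nonneg (Finset.sum_nonneg fun k _ => hV0 k), Real.norm_of_nonneg (by positivity)]
  calc ∑ k ∈ Finset.Icc (t i) i, V k ≤ ∑ _k ∈ Finset.Icc (t i) i, c :=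
        Finset.sum_le_sum fun k hk => hN k (hi.trans (Finset.mem_Icc.1 hk).1)
    _ = c * ((i + 1 - t i : ℕ) : ℝ) := by
        rw [Finset.sum_const, Nat.card_Icc, nsmul_eq_mul, mul_comm]

lemma Finset.sq_sum_Ico_eq (x : ℕ → ℝ) {a b : ℕ} (hab : a ≤ b) :
    (∑ k ∈ Finset.Ico a b, x k) ^ 2 =
      ∑ k ∈ Finset.Ico a b, (x k ^ 2 + 2 * (∑ j ∈ Finset.Ico a k, x j) * x k) := by
  induction b, hab using Nat.le_induction with
  | base => simp
  | succ b hab ih =>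
    rw [Finset.sum_Ico_succ_top hab, Finset.sum_Ico_succ_top hab, ← ih]
    ring

/-- The number of the batches `{t i, …, i}`, `1 ≤ i ≤ n`, that contain `k`. -/
def batchMultiplicity (t : ℕ → ℕ) (n k : ℕ) : ℕ :=
  ((Finset.Icc 1 n).filter fun i => t i ≤ k ∧ k ≤ i).card

lemma sum_sum_Icc_eq_sum_batchMultiplicity (t : ℕ → ℕ) (n : ℕ) (g : ℕ → ℝ) :
    ∑ i ∈ Finset.Icc 1 n, ∑ k ∈ Finset.Icc (t i) i, g k =
      ∑ k ∈ Finset.range (n + 1), (batchMultiplicity t n k : ℝ) * g k := by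
  have h1 : ∀ i ∈ Finset.Icc 1 n, ∑ k ∈ Finset.Icc (t i) i, g k =
      ∑ k ∈ Finset.range (n + 1), if t i ≤ k ∧ k ≤ i then g k else 0 := by
    intro i hi
    rw [← Finset.sum_filter]
    refine Finset.sum_congr ?_ fun _ _ => rfl
    ext k
    have := (Finset.mem_Icc.1 hi).2
    simp only [Finset.mem_Icc, Finset.mem_filter, Finset.mem_range]
    omega
  rw [Finset.sum_congr rfl h1, Finset.sum_comm]
  refine Finset.sum_congr rfl fun k _ => ?_
  rw [← Finset.sum_filter, Finset.sum_const, nsmul_eq_mul, batchMultiplicity]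

lemma sum_batchMultiplicity (t : ℕ → ℕ) (n : ℕ) :
    ∑ k ∈ Finset.range (n + 1), (batchMultiplicity t n k : ℝ) =
      ∑ i ∈ Finset.Icc 1 n, ((i + 1 - t i : ℕ) : ℝ) := by
  have := sum_sum_Icc_eq_sum_batchMultiplicity t n fun _ => 1
  simpa using this.symm

/-- A family of batches `{t i, …, i}` that grow inside consecutive disjoint blocks of indices. -/
structure IsBatching (t : ℕ → ℕ) : Prop where
  le : ∀ i, t i ≤ i
  eq_of_mem : ∀ i k, t i ≤ k → k ≤ i → t k = t i
  tendsto : Tendsto t atTop atTop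

variable {t : ℕ → ℕ}

lemma IsBatching.batchMultiplicity_le (ht : IsBatching t) {n k : ℕ} {L : ℝ}
    (hL : ∀ i ∈ Finset.Icc 1 n, ((i + 1 - t i : ℕ) : ℝ) ≤ L) (hL0 : 0 ≤ L) :
    (batchMultiplicity t n k : ℝ) ≤ L := by
  have hsub : ((Finset.Icc 1 n).filter fun i => t i ≤ k ∧ k ≤ i) ⊆
      Finset.Ico (t k) (t k + ⌊L⌋₊) := by
    intro i hi
    rw [Finset.mem_filter] at hi
    have h1 := Nat.le_floor (hL i hi.1)
    have h2 := ht.eq_of_mem i k hi.2.1 hi.2.2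
    have h3 := ht.le i
    rw [Finset.mem_Ico]
    omega
  have h := Finset.card_le_card hsub
  rw [Nat.card_Ico, Nat.add_sub_cancel_left] at h
  exact (Nat.cast_le.2 h).trans (Nat.floor_le hL0)

lemma IsBatching.le_of_batchMultiplicity_ne_zero (ht : IsBatching t) {n k : ℕ} {L : ℝ}
    (hL : ∀ i ∈ Finset.Icc 1 n, ((i + 1 - t i : ℕ) : ℝ) ≤ L) (h : batchMultiplicity t n k ≠ 0) :
    ((k + 1 - t k : ℕ) : ℝ) ≤ L := by
  obtain ⟨i, hi⟩ := Finset.card_ne_zero.1 h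
  rw [Finset.mem_filter] at hi
  refine le_trans ?_ (hL i hi.1)
  have h2 := ht.eq_of_mem i k hi.2.1 hi.2.2
  exact_mod_cast (by omega : k + 1 - t k ≤ i + 1 - t i)

lemma IsBatching.natCast_le_sum (ht : IsBatching t) (n : ℕ) :
    (n : ℝ) ≤ ∑ i ∈ Finset.Icc 1 n, ((i + 1 - t i : ℕ) : ℝ) := by
  calc (n : ℝ) = ∑ _i ∈ Finset.Icc 1 n, (1 : ℝ) := by simp
    _ ≤ _ := Finset.sum_le_sum fun i _ => by
        have := ht.le i
        exact_mod_cast (by omega : 1 ≤ i + 1 - t i)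

lemma IsBatching.tendsto_sum (ht : IsBatching t) :
    Tendsto (fun n => ∑ i ∈ Finset.Icc 1 n, ((i + 1 - t i : ℕ) : ℝ)) atTop atTop :=
  tendsto_atTop_mono ht.natCast_le_sum tendsto_natCast_atTop_atTop

end Batches

/-! ### Batch means of martingale differences -/

section BatchMeans

variable {Ω : Type*} {mΩ : MeasurableSpace Ω} {μ : Measure Ω}

/-- Real martingale differences with bounded fourth moments: `X n` is revealed at time `n + 1` and
centred given the past up to time `n`. -/
structure IsMartingaleDifference (μ : Measure Ω) (ℱ : Filtration ℕ mΩ) (X : ℕ → Ω → ℝ)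
    (M : ℝ) : Prop where
  stronglyMeasurable : ∀ n, StronglyMeasurable[ℱ (n + 1)] (X n)
  memLp : ∀ n, MemLp (X n) 4 μ
  condExp : ∀ n, μ[X n | ℱ n] =ᵐ[μ] 0
  integral_le : ∀ n, ∫ ω, X n ω ^ 4 ∂μ ≤ M

variable {ℱ : Filtration ℕ mΩ} {X : ℕ → Ω → ℝ} {M : ℝ}

lemma IsMartingaleDifference.stronglyMeasurable_sum (hX : IsMartingaleDifference μ ℱ X M)
    (a b : ℕ) : StronglyMeasurable[ℱ b] fun ω => ∑ k ∈ Finset.Ico a b, X k ω :=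
  Finset.stronglyMeasurable_fun_sum _ fun k hk =>
    (hX.stronglyMeasurable k).mono (ℱ.mono (Finset.mem_Ico.1 hk).2)

lemma IsMartingaleDifference.memLp_sum (hX : IsMartingaleDifference μ ℱ X M)
    (s : Finset ℕ) : MemLp (fun ω => ∑ k ∈ s, X k ω) 4 μ :=
  memLp_finsetSum _ fun k _ => hX.memLp k

lemma IsMartingaleDifference.nonneg (hX : IsMartingaleDifference μ ℱ X M) : 0 ≤ M :=
  (integral_nonneg fun ω => by positivity).trans (hX.integral_le 0)

/-- Young's inequality for the mixed moment of order `2 + 2`. -/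
lemma integral_sq_mul_sq_le [IsProbabilityMeasure μ] {f g : Ω → ℝ} (hf : MemLp f 4 μ)
    (hg : MemLp g 4 μ) {c : ℝ} (hc : 0 < c) :
    ∫ ω, f ω ^ 2 * g ω ^ 2 ∂μ ≤ (c * ∫ ω, f ω ^ 4 ∂μ + c⁻¹ * ∫ ω, g ω ^ 4 ∂μ) / 2 := by
  have hf4 : Integrable (fun ω => f ω ^ 4) μ := by
    simpa [Even.pow_abs (by decide : Even 4)] using
      integrable_norm_pow_of_memLp_four hf (a := 4) le_rfl
  have hg4 : Integrable (fun ω => g ω ^ 4) μ := by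
    simpa [Even.pow_abs (by decide : Even 4)] using
      integrable_norm_pow_of_memLp_four hg (a := 4) le_rfl
  have hfg : Integrable (fun ω => f ω ^ 2 * g ω ^ 2) μ := by
    simpa using integrable_norm_pow_mul_norm_pow_of_memLp_four hf hg (a := 2) (b := 2) le_rfl
  calc ∫ ω, f ω ^ 2 * g ω ^ 2 ∂μ ≤ ∫ ω, (c * f ω ^ 4 + c⁻¹ * g ω ^ 4) / 2 ∂μ := by
        refine integral_mono hfg (((hf4.const_mul c).add (hg4.const_mul c⁻¹)).div_const 2)
          fun ω => ?_
        have h : c * f ω ^ 4 + c⁻¹ * g ω ^ 4 - 2 * (f ω ^ 2 * g ω ^ 2)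
            = c⁻¹ * (c * f ω ^ 2 - g ω ^ 2) ^ 2 := by
          field_simp
          ring
        have : 0 ≤ c⁻¹ * (c * f ω ^ 2 - g ω ^ 2) ^ 2 := by positivity
        change f ω ^ 2 * g ω ^ 2 ≤ (c * f ω ^ 4 + c⁻¹ * g ω ^ 4) / 2
        linarith
    _ = _ := by
        rw [integral_div, integral_add (hf4.const_mul c) (hg4.const_mul c⁻¹), integral_const_mul,
          integral_const_mul]

/-- The fourth moment of a sum of `j` martingale differences is of order `j ^ 2`. -/
lemma IsMartingaleDifference.integral_sum_pow_four_le [IsProbabilityMeasure μ]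
    (hX : IsMartingaleDifference μ ℱ X M) (a j : ℕ) :
    ∫ ω, (∑ k ∈ Finset.Ico a (a + j), X k ω) ^ 4 ∂μ ≤ 16 * M * (j : ℝ) ^ 2 := by
  induction j with
  | zero => simp
  | succ j ih =>
    have hM := hX.nonneg
    have h := integral_norm_add_pow_four_le (ℱ.le (a + j)) (hX.stronglyMeasurable_sum a (a + j))
      (hX.memLp_sum _) (hX.memLp (a + j)) (hX.condExp (a + j))
    simp only [Real.norm_eq_abs, Even.pow_abs (by decide : Even 4), sq_abs] at h
    have e : ∀ ω, ∑ k ∈ Finset.Ico a (a + (j + 1)), X k ω =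
        ∑ k ∈ Finset.Ico a (a + j), X k ω + X (a + j) ω := fun ω =>
      Finset.sum_Ico_succ_top (Nat.le_add_right a j) _
    simp_rw [e]
    refine h.trans ?_
    have hle := hX.integral_le (a + j)
    rcases Nat.eq_zero_or_pos j with rfl | hj
    · simp only [add_zero, Finset.Ico_self, Finset.sum_empty] at hle ⊢
      norm_num
      linarith
    · have hj' : (0 : ℝ) < j := by exact_mod_cast hj
      -- With weight `1 / (4 j)` both terms of the Young bound are `O(M j)`, the growth of `16 M j ^ 2`.
      have hy := integral_sq_mul_sq_le (hX.memLp_sum (Finset.Ico a (a + j))) (hX.memLp (a + j))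
        (c := (4 * (j : ℝ))⁻¹) (by positivity)
      rw [inv_inv] at hy
      set A := ∫ ω, (∑ k ∈ Finset.Ico a (a + j), X k ω) ^ 4 ∂μ
      have h1 : (4 * (j : ℝ))⁻¹ * A ≤ 4 * M * j := by
        rw [inv_mul_le_iff₀ (by positivity)]
        linarith
      have h2 : 4 * (j : ℝ) * ∫ ω, X (a + j) ω ^ 4 ∂μ ≤ 4 * j * M := by gcongr
      push_cast
      nlinarith

lemma integral_sum_mul_sq_of_condExp_eq_zero [IsProbabilityMeasure μ] {Z : ℕ → Ω → ℝ}
    (hZm : ∀ n, StronglyMeasurable[ℱ (n + 1)] (Z n)) (hZ : ∀ n, MemLp (Z n) 2 μ)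
    (hZ0 : ∀ n, μ[Z n | ℱ n] =ᵐ[μ] 0) (c : ℕ → ℝ) (n : ℕ) :
    ∫ ω, (∑ k ∈ Finset.range n, c k * Z k ω) ^ 2 ∂μ =
      ∑ k ∈ Finset.range n, c k ^ 2 * ∫ ω, Z k ω ^ 2 ∂μ := by
  induction n with
  | zero => simp
  | succ n ih =>
    have hS : MemLp (fun ω => ∑ k ∈ Finset.range n, c k * Z k ω) 2 μ :=
      memLp_finsetSum _ fun k _ => (hZ k).const_mul _
    have hSm : StronglyMeasurable[ℱ n] fun ω => ∑ k ∈ Finset.range n, c k * Z k ω :=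
      Finset.stronglyMeasurable_fun_sum _ fun k hk =>
        ((hZm k).mono (ℱ.mono (Finset.mem_range.1 hk))).const_mul _
    have hSZ : Integrable (fun ω => (∑ k ∈ Finset.range n, c k * Z k ω) * Z n ω) μ :=
      hS.integrable_mul (hZ n)
    have h0 := integral_mul_eq_zero_of_condExp_eq_zero (ℱ.le n) hSm hSZ
      ((hZ n).integrable (by norm_num)) (hZ0 n)
    have e : ∀ ω, (∑ k ∈ Finset.range (n + 1), c k * Z k ω) ^ 2 =
        (∑ k ∈ Finset.range n, c k * Z k ω) ^ 2
        + (2 * c n) * ((∑ k ∈ Finset.range n, c k * Z k ω) * Z n ω) + c n ^ 2 * Z n ω ^ 2 := by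
      intro ω
      rw [Finset.sum_range_succ]
      ring
    simp_rw [e]
    rw [integral_add (hS.integrable_sq.fun_add (hSZ.const_mul _))
      ((hZ n).integrable_sq.const_mul _), integral_add hS.integrable_sq (hSZ.const_mul _),
      integral_const_mul, integral_const_mul, h0, ih, Finset.sum_range_succ]
    ring

/-- The increment `X_k ^ 2 - E[X_k ^ 2 | ℱ_k] + 2 (X_{t k} + ⋯ + X_{k-1}) X_k` by which the square
of a batch sum grows beyond the conditional variance `E[X_k ^ 2 | ℱ_k]` when `X_k` joins the sum. The
square of a batch sum is the sum over the batch of these increments and conditional variances. -/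
noncomputable def batchSquareIncrement (μ : Measure Ω) (ℱ : Filtration ℕ mΩ) (X : ℕ → Ω → ℝ)
    (t : ℕ → ℕ) (k : ℕ) (ω : Ω) : ℝ :=
  X k ω ^ 2 - (μ[fun ω' => X k ω' ^ 2 | ℱ k]) ω + 2 * (∑ j ∈ Finset.Ico (t k) k, X j ω) * X k ω

variable {t : ℕ → ℕ}

lemma IsMartingaleDifference.integrable_sq [IsProbabilityMeasure μ]
    (hX : IsMartingaleDifference μ ℱ X M) (k : ℕ) : Integrable (fun ω => X k ω ^ 2) μ := by
  simpa using integrable_norm_pow_of_memLp_four (hX.memLp k) (a := 2) (by norm_num)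

lemma IsMartingaleDifference.memLp_sq [IsProbabilityMeasure μ]
    (hX : IsMartingaleDifference μ ℱ X M) (k : ℕ) : MemLp (fun ω => X k ω ^ 2) 2 μ := by
  refine (memLp_two_iff_integrable_sq ((hX.memLp k).1.pow 2)).2 ?_
  have := integrable_norm_pow_of_memLp_four (hX.memLp k) (a := 4) le_rfl
  simpa [← pow_mul, Even.pow_abs (by decide : Even 4)] using this

lemma IsMartingaleDifference.memLp_sum_mul [IsProbabilityMeasure μ]
    (hX : IsMartingaleDifference μ ℱ X M) (s : Finset ℕ) (k : ℕ) :
    MemLp (fun ω => (∑ j ∈ s, X j ω) * X k ω) 2 μ := by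
  refine (memLp_two_iff_integrable_sq ((hX.memLp_sum s).1.mul (hX.memLp k).1)).2 ?_
  have := integrable_norm_pow_mul_norm_pow_of_memLp_four (hX.memLp_sum s) (hX.memLp k) (a := 2)
    (b := 2) le_rfl
  simpa [mul_pow] using this

lemma IsMartingaleDifference.stronglyMeasurable_batchSquareIncrement
    (hX : IsMartingaleDifference μ ℱ X M) (k : ℕ) :
    StronglyMeasurable[ℱ (k + 1)] (batchSquareIncrement μ ℱ X t k) :=
  (((hX.stronglyMeasurable k).pow 2).sub (stronglyMeasurable_condExp.mono (ℱ.mono k.le_succ))).add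
    ((((hX.stronglyMeasurable_sum (t k) k).mono (ℱ.mono k.le_succ)).const_mul 2).mul
      (hX.stronglyMeasurable k))

lemma IsMartingaleDifference.memLp_batchSquareIncrement [IsProbabilityMeasure μ]
    (hX : IsMartingaleDifference μ ℱ X M) (k : ℕ) :
    MemLp (batchSquareIncrement μ ℱ X t k) 2 μ := by
  have h := (((hX.memLp_sq k).sub ((hX.memLp_sq k).condExp (m := ℱ k) (by norm_num))).add
    ((hX.memLp_sum_mul (Finset.Ico (t k) k) k).const_mul 2))
  refine h.ae_eq (ae_of_all _ fun ω => ?_)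
  simp only [batchSquareIncrement, Pi.add_apply, Pi.sub_apply]
  ring

lemma IsMartingaleDifference.condExp_batchSquareIncrement [IsProbabilityMeasure μ]
    (hX : IsMartingaleDifference μ ℱ X M) (k : ℕ) :
    μ[batchSquareIncrement μ ℱ X t k | ℱ k] =ᵐ[μ] 0 := by
  set v := μ[fun ω' => X k ω' ^ 2 | ℱ k] with hv
  have hvi : Integrable v μ := integrable_condExp
  set U : Ω → ℝ := fun ω => 2 * ∑ j ∈ Finset.Ico (t k) k, X j ω with hU
  have hUm : StronglyMeasurable[ℱ k] U := (hX.stronglyMeasurable_sum (t k) k).const_mul 2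
  have hUX : Integrable (U * X k) μ := by
    refine (((hX.memLp_sum_mul (Finset.Ico (t k) k) k).const_mul 2).integrable
      (by norm_num)).congr (ae_of_all _ fun ω => ?_)
    simp only [hU, Pi.mul_apply]
    ring
  have e : batchSquareIncrement μ ℱ X t k = (fun ω => X k ω ^ 2) - v + U * X k := rfl
  rw [e]
  have hXi : Integrable (X k) μ := (hX.memLp k).integrable (by norm_num)
  filter_upwards [condExp_add ((hX.integrable_sq k).sub hvi) hUX (ℱ k),
    condExp_sub (hX.integrable_sq k) hvi (ℱ k), condExp_mul_of_stronglyMeasurable_left hUm hUX hXi,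
    hX.condExp k] with ω h1 h2 h3 h4
  rw [h1, Pi.add_apply, h2, h3, Pi.sub_apply, Pi.mul_apply, h4,
    condExp_of_stronglyMeasurable (ℱ.le k) stronglyMeasurable_condExp hvi, Pi.zero_apply, mul_zero,
    add_zero]
  exact sub_self _

lemma IsMartingaleDifference.integral_condExp_sq_sq_le [IsProbabilityMeasure μ]
    (hX : IsMartingaleDifference μ ℱ X M) (k : ℕ) :
    ∫ ω, (μ[fun ω' => X k ω' ^ 2 | ℱ k]) ω ^ 2 ∂μ ≤ M := by
  set v := μ[fun ω' => X k ω' ^ 2 | ℱ k] with hv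
  have hv2 : MemLp v 2 μ := (hX.memLp_sq k).condExp (m := ℱ k) (by norm_num)
  have hXv : Integrable (v * fun ω => X k ω ^ 2) μ := hv2.integrable_mul (hX.memLp_sq k)
  have hXv' : Integrable (fun ω => v ω * X k ω ^ 2) μ := hXv
  have hX4 : Integrable (fun ω => (X k ω ^ 2) ^ 2) μ := (hX.memLp_sq k).integrable_sq
  have h1 : ∫ ω, v ω * X k ω ^ 2 ∂μ = ∫ ω, v ω ^ 2 ∂μ := by
    rw [← integral_condExp (ℱ.le k)]
    refine integral_congr_ae ?_
    filter_upwards [condExp_mul_of_stronglyMeasurable_left stronglyMeasurable_condExp hXv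
      (hX.integrable_sq k)] with ω h
    change (μ[v * (fun ω => X k ω ^ 2) | ℱ k]) ω = _
    rw [h, Pi.mul_apply, sq]
  have h2 : 0 ≤ ∫ ω, (X k ω ^ 2 - v ω) ^ 2 ∂μ := integral_nonneg fun ω => sq_nonneg _
  have h3 : ∫ ω, (X k ω ^ 2 - v ω) ^ 2 ∂μ =
      ∫ ω, (X k ω ^ 2) ^ 2 ∂μ - 2 * ∫ ω, v ω * X k ω ^ 2 ∂μ + ∫ ω, v ω ^ 2 ∂μ := by
    have e : ∀ ω, (X k ω ^ 2 - v ω) ^ 2 =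
        (X k ω ^ 2) ^ 2 - 2 * (v ω * X k ω ^ 2) + v ω ^ 2 := fun ω => by ring
    simp_rw [e]
    rw [integral_add (f := fun ω => (X k ω ^ 2) ^ 2 - 2 * (v ω * X k ω ^ 2))
      (hX4.sub (hXv'.const_mul 2)) hv2.integrable_sq, integral_sub hX4 (hXv'.const_mul 2),
      integral_const_mul]
  have h4 : ∫ ω, (X k ω ^ 2) ^ 2 ∂μ ≤ M := by
    simpa [← pow_mul] using hX.integral_le k
  linarith

lemma IsMartingaleDifference.integral_batchSquareIncrement_sq_le [IsProbabilityMeasure μ]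
    (hX : IsMartingaleDifference μ ℱ X M) {k : ℕ} (htk : t k ≤ k) :
    ∫ ω, batchSquareIncrement μ ℱ X t k ω ^ 2 ∂μ ≤ 108 * M * ((k + 1 - t k : ℕ) : ℝ) := by
  set v := μ[fun ω' => X k ω' ^ 2 | ℱ k] with hv
  have hv2 : MemLp v 2 μ := (hX.memLp_sq k).condExp (m := ℱ k) (by norm_num)
  have hX4 : Integrable (fun ω => (X k ω ^ 2) ^ 2) μ := (hX.memLp_sq k).integrable_sq
  set U : Ω → ℝ := fun ω => ∑ j ∈ Finset.Ico (t k) k, X j ω with hU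
  have hUX : Integrable (fun ω => (U ω * X k ω) ^ 2) μ :=
    (hX.memLp_sum_mul (Finset.Ico (t k) k) k).integrable_sq
  have hM := hX.nonneg
  set l : ℝ := ((k + 1 - t k : ℕ) : ℝ) with hl
  have hl1 : 1 ≤ l := by
    rw [hl]
    exact_mod_cast (by omega : 1 ≤ k + 1 - t k)
  have hl0 : 0 < l := by linarith
  have hUX' : ∫ ω, (U ω * X k ω) ^ 2 ∂μ ≤ 17 * M * l / 2 := by
    have h := integral_sq_mul_sq_le (hX.memLp_sum (Finset.Ico (t k) k)) (hX.memLp k)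
      (c := l⁻¹) (by positivity)
    have h1 := hX.integral_sum_pow_four_le (t k) (k - t k)
    rw [Nat.add_sub_cancel' htk] at h1
    have h2 : ((k - t k : ℕ) : ℝ) ≤ l := by
      rw [hl]
      exact_mod_cast (by omega : k - t k ≤ k + 1 - t k)
    have h3 : l⁻¹ * ∫ ω, (∑ j ∈ Finset.Ico (t k) k, X j ω) ^ 4 ∂μ ≤ 16 * M * l := by
      rw [inv_mul_le_iff₀ hl0]
      refine h1.trans ?_
      calc 16 * M * ((k - t k : ℕ) : ℝ) ^ 2 ≤ 16 * M * l ^ 2 := by gcongr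
        _ = _ := by ring
    have h4 : l⁻¹⁻¹ * ∫ ω, X k ω ^ 4 ∂μ ≤ l * M := by
      rw [inv_inv]
      exact mul_le_mul_of_nonneg_left (hX.integral_le k) hl0.le
    simp_rw [mul_pow]
    refine h.trans ?_
    linarith
  have hX4' : ∫ ω, (X k ω ^ 2) ^ 2 ∂μ ≤ M := by
    simpa [← pow_mul] using hX.integral_le k
  have hv' := hX.integral_condExp_sq_sq_le k
  calc ∫ ω, batchSquareIncrement μ ℱ X t k ω ^ 2 ∂μ
      ≤ ∫ ω, (3 * (X k ω ^ 2) ^ 2 + 3 * v ω ^ 2 + 12 * (U ω * X k ω) ^ 2) ∂μ := by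
        refine integral_mono (hX.memLp_batchSquareIncrement k).integrable_sq
          (((hX4.const_mul 3).add (hv2.integrable_sq.const_mul 3)).add (hUX.const_mul 12))
          fun ω => ?_
        change (X k ω ^ 2 - v ω + 2 * U ω * X k ω) ^ 2 ≤
          3 * (X k ω ^ 2) ^ 2 + 3 * v ω ^ 2 + 12 * (U ω * X k ω) ^ 2
        generalize X k ω ^ 2 = x
        rw [mul_assoc]
        generalize U ω * X k ω = y
        nlinarith [sq_nonneg (x + v ω), sq_nonneg (x - 2 * y), sq_nonneg (v ω + 2 * y)]
    _ = 3 * ∫ ω, (X k ω ^ 2) ^ 2 ∂μ + 3 * ∫ ω, v ω ^ 2 ∂μ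
          + 12 * ∫ ω, (U ω * X k ω) ^ 2 ∂μ := by
        rw [integral_add ((hX4.const_mul 3).fun_add (hv2.integrable_sq.const_mul 3))
          (hUX.const_mul 12), integral_add (hX4.const_mul 3) (hv2.integrable_sq.const_mul 3),
          integral_const_mul, integral_const_mul, integral_const_mul]
    _ ≤ 3 * M + 3 * M + 12 * (17 * M * l / 2) := by gcongr
    _ ≤ 108 * M * l := by nlinarith

/-- The squares of the batch sums of martingale differences, summed over all batches and divided by
the total batch length, estimate the limit of the conditional variances consistently. -/
theorem IsMartingaleDifference.tendsto_integral_abs_batchMeans_sub [IsProbabilityMeasure μ]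
    (hX : IsMartingaleDifference μ ℱ X M) (ht : IsBatching t) {L : ℕ → ℝ} (hL0 : ∀ n, 0 ≤ L n)
    (hL : ∀ n, ∀ i ∈ Finset.Icc 1 n, ((i + 1 - t i : ℕ) : ℝ) ≤ L n)
    (hLT : Tendsto (fun n => L n ^ 2 / ∑ i ∈ Finset.Icc 1 n, ((i + 1 - t i : ℕ) : ℝ)) atTop (𝓝 0))
    {σ2 : ℝ}
    (hv : Tendsto (fun n => ∫ ω, |(μ[fun ω' => X n ω' ^ 2 | ℱ n]) ω - σ2| ∂μ) atTop (𝓝 0)) :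
    Tendsto (fun n => ∫ ω, |(∑ i ∈ Finset.Icc 1 n, ((i + 1 - t i : ℕ) : ℝ))⁻¹ *
      ∑ i ∈ Finset.Icc 1 n, (∑ k ∈ Finset.Icc (t i) i, X k ω) ^ 2 - σ2| ∂μ) atTop (𝓝 0) := by
  set T : ℕ → ℝ := fun n => ∑ i ∈ Finset.Icc 1 n, ((i + 1 - t i : ℕ) : ℝ) with hT
  set v : ℕ → Ω → ℝ := fun k => μ[fun ω' => X k ω' ^ 2 | ℱ k] with hvdef
  set V : ℕ → ℝ := fun n => ∫ ω, |v n ω - σ2| ∂μ with hV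
  set Z : ℕ → Ω → ℝ := fun k => batchSquareIncrement μ ℱ X t k with hZdef
  have hM := hX.nonneg
  have hZ2 : ∀ k, MemLp (Z k) 2 μ := fun k => hX.memLp_batchSquareIncrement k
  have hvi : ∀ k, Integrable (fun ω => v k ω - σ2) μ := fun k =>
    integrable_condExp.sub (integrable_const _)
  have hV0 : ∀ k, 0 ≤ V k := fun k => integral_nonneg fun ω => abs_nonneg _
  have hW : ∀ i ω, (∑ k ∈ Finset.Icc (t i) i, X k ω) ^ 2 =
      ∑ k ∈ Finset.Icc (t i) i, (Z k ω + v k ω) := by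
    intro i ω
    rw [← Finset.Ico_add_one_right_eq_Icc, Finset.sq_sum_Ico_eq (fun k => X k ω)
      ((ht.le i).trans (Nat.le_add_right i 1))]
    refine Finset.sum_congr rfl fun k hk => ?_
    rw [Finset.mem_Ico] at hk
    simp only [hZdef, hvdef, batchSquareIncrement]
    rw [ht.eq_of_mem i k hk.1 (by omega)]
    ring
  -- Exchanging sums: `X k` enters the batch sums of `batchMultiplicity t n k` indices `i ≤ n`.
  have hkey : ∀ n ω, ∑ i ∈ Finset.Icc 1 n, (∑ k ∈ Finset.Icc (t i) i, X k ω) ^ 2 - T n * σ2 =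
      ∑ k ∈ Finset.range (n + 1), (batchMultiplicity t n k : ℝ) * Z k ω
      + ∑ k ∈ Finset.range (n + 1), (batchMultiplicity t n k : ℝ) * (v k ω - σ2) := by
    intro n ω
    simp_rw [hW]
    rw [sum_sum_Icc_eq_sum_batchMultiplicity t n fun k => Z k ω + v k ω]
    simp only [hT]
    rw [← sum_batchMultiplicity, Finset.sum_mul, ← Finset.sum_sub_distrib,
      ← Finset.sum_add_distrib]
    exact Finset.sum_congr rfl fun k _ => by ring
  have hbound : ∀ᶠ n in atTop, ∫ ω, |(T n)⁻¹ *
      ∑ i ∈ Finset.Icc 1 n, (∑ k ∈ Finset.Icc (t i) i, X k ω) ^ 2 - σ2| ∂μ ≤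
      √(108 * M * (L n ^ 2 / T n))
        + (∑ i ∈ Finset.Icc 1 n, ∑ k ∈ Finset.Icc (t i) i, V k) / T n := by
    filter_upwards [ht.tendsto_sum.eventually_gt_atTop 0] with n hTn
    have hTn : 0 < T n := hTn
    have hS2 : MemLp (fun ω => ∑ k ∈ Finset.range (n + 1),
        (batchMultiplicity t n k : ℝ) * Z k ω) 2 μ :=
      memLp_finsetSum _ fun k _ => (hZ2 k).const_mul _
    have i1 := (hS2.integrable (by norm_num)).abs
    have i2 : Integrable (fun ω => ∑ k ∈ Finset.range (n + 1),
        (batchMultiplicity t n k : ℝ) * |v k ω - σ2|) μ :=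
      integrable_finsetSum _ fun k _ => ((hvi k).abs).const_mul _
    have b1 : ∫ ω, |∑ k ∈ Finset.range (n + 1), (batchMultiplicity t n k : ℝ) * Z k ω| ∂μ ≤
        T n * √(108 * M * (L n ^ 2 / T n)) := by
      refine (integral_abs_le_sqrt_integral_sq hS2).trans ?_
      rw [integral_sum_mul_sq_of_condExp_eq_zero (ℱ := ℱ)
        (fun k => hX.stronglyMeasurable_batchSquareIncrement k) hZ2
        (fun k => hX.condExp_batchSquareIncrement k)]
      have e : T n * √(108 * M * (L n ^ 2 / T n)) = √(108 * M * L n ^ 2 * T n) := by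
        rw [← Real.sqrt_sq hTn.le, ← Real.sqrt_mul (sq_nonneg _), Real.sqrt_sq hTn.le]
        congr 1
        field_simp
      rw [e]
      refine Real.sqrt_le_sqrt ?_
      simp only [hT]
      rw [← sum_batchMultiplicity, Finset.mul_sum]
      refine Finset.sum_le_sum fun k _ => ?_
      rcases eq_or_ne (batchMultiplicity t n k) 0 with h0 | h0
      · simp [h0]
      have c1 := ht.batchMultiplicity_le (k := k) (hL n) (hL0 n)
      have c2 := ht.le_of_batchMultiplicity_ne_zero (hL n) h0
      calc (batchMultiplicity t n k : ℝ) ^ 2 * ∫ ω, Z k ω ^ 2 ∂μ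
          ≤ (L n * batchMultiplicity t n k) * (108 * M * L n) := by
            rw [sq]
            gcongr
            · exact mul_nonneg (hL0 n) (Nat.cast_nonneg _)
            · exact (hX.integral_batchSquareIncrement_sq_le (ht.le k)).trans (by gcongr)
        _ = _ := by ring
    have b2 : ∫ ω, ∑ k ∈ Finset.range (n + 1),
        (batchMultiplicity t n k : ℝ) * |v k ω - σ2| ∂μ =
        ∑ i ∈ Finset.Icc 1 n, ∑ k ∈ Finset.Icc (t i) i, V k := by
      rw [sum_sum_Icc_eq_sum_batchMultiplicity,
        integral_finsetSum _ fun k _ => ((hvi k).abs).const_mul _]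
      simp_rw [integral_const_mul]
      rfl
    calc ∫ ω, |(T n)⁻¹ *
          ∑ i ∈ Finset.Icc 1 n, (∑ k ∈ Finset.Icc (t i) i, X k ω) ^ 2 - σ2| ∂μ
        ≤ ∫ ω, (T n)⁻¹ * (|∑ k ∈ Finset.range (n + 1), (batchMultiplicity t n k : ℝ) * Z k ω|
          + ∑ k ∈ Finset.range (n + 1), (batchMultiplicity t n k : ℝ) * |v k ω - σ2|) ∂μ := by
          refine integral_mono_of_nonneg (ae_of_all _ fun ω => abs_nonneg _)
            ((i1.add i2).const_mul _) (ae_of_all _ fun ω => ?_)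
          have e : (T n)⁻¹ * ∑ i ∈ Finset.Icc 1 n, (∑ k ∈ Finset.Icc (t i) i, X k ω) ^ 2 - σ2 =
              (T n)⁻¹ * (∑ i ∈ Finset.Icc 1 n, (∑ k ∈ Finset.Icc (t i) i, X k ω) ^ 2
                - T n * σ2) := by
            field_simp
          beta_reduce
          rw [e, hkey, abs_mul, abs_of_pos (inv_pos.2 hTn)]
          gcongr
          refine (abs_add_le _ _).trans ?_
          gcongr
          refine (Finset.abs_sum_le_sum_abs _ _).trans (le_of_eq ?_)
          exact Finset.sum_congr rfl fun k _ => by rw [abs_mul, Nat.abs_cast]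
      _ = (T n)⁻¹ * (∫ ω, |∑ k ∈ Finset.range (n + 1), (batchMultiplicity t n k : ℝ) * Z k ω| ∂μ
          + ∑ i ∈ Finset.Icc 1 n, ∑ k ∈ Finset.Icc (t i) i, V k) := by
          rw [integral_const_mul, integral_add i1 i2, b2]
      _ ≤ (T n)⁻¹ * (T n * √(108 * M * (L n ^ 2 / T n))
          + ∑ i ∈ Finset.Icc 1 n, ∑ k ∈ Finset.Icc (t i) i, V k) := by gcongr
      _ = _ := by
          rw [mul_add, inv_mul_cancel_left₀ hTn.ne']
          ring
  refine squeeze_zero' (.of_forall fun n => integral_nonneg fun ω => abs_nonneg _) hbound ?_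
  have l1 : Tendsto (fun n => √(108 * M * (L n ^ 2 / T n))) atTop (𝓝 0) := by
    have := (hLT.const_mul (108 * M)).sqrt
    simpa using this
  have l2 := tendsto_sum_div_sum_of_isLittleO (sum_Icc_isLittleO_card ht.tendsto hv hV0)
    (fun i => Nat.cast_nonneg _) ht.tendsto_sum
  simpa using l1.add l2

end BatchMeans

/-! ### Rates for the recursion with polynomially decaying steps -/

section Rates

/-- The recursion `b_{n+1} ≤ (1 - c s_n) b_n + B s_n ^ 3` with `s_n = η (n + 1) ^ (-α)` forces
`b_n = O(s_n ^ 2)`: for `α < 1` the relative decrease `s_n ^ 2 / s_{n+1} ^ 2 - 1 = O(1 / n)` of the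
target is negligible against `s_n`. -/
lemma exists_le_mul_sq_of_recursion {b : ℕ → ℝ} {c B η α : ℝ} (hb : ∀ n, 0 ≤ b n) (hc : 0 < c)
    (hB : 0 ≤ B) (hη : 0 < η) (hα : 0 < α) (hα' : α < 1)
    (h : ∀ᶠ n : ℕ in atTop, b (n + 1) ≤ (1 - c * (η * ((n : ℝ) + 1) ^ (-α))) * b n
      + B * (η * ((n : ℝ) + 1) ^ (-α)) ^ 3) :
    ∃ K, 0 < K ∧ ∀ n : ℕ, b n ≤ K * (((n : ℝ) + 1) ^ (-α)) ^ 2 := by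
  have hgrow : ∀ᶠ n : ℕ in atTop, 3 / ((n : ℝ) + 1) ≤ c * η / 2 * ((n : ℝ) + 1) ^ (-α) := by
    have h1 : Tendsto (fun n : ℕ => ((n : ℝ) + 1) ^ (-(1 - α))) atTop (𝓝 0) :=
      (tendsto_rpow_neg_atTop (by linarith)).comp
        (tendsto_atTop_add_const_right _ _ tendsto_natCast_atTop_atTop)
    filter_upwards [h1.eventually_le_const (u := c * η / 6) (by positivity)] with n hn
    have hn0 : (0 : ℝ) < (n : ℝ) + 1 := by positivity
    have e : 3 / ((n : ℝ) + 1) = 3 * ((n : ℝ) + 1) ^ (-(1 - α)) * ((n : ℝ) + 1) ^ (-α) := by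
      rw [mul_assoc, ← Real.rpow_add hn0, show -(1 - α) + -α = -1 by ring, Real.rpow_neg_one]
      rfl
    rw [e]
    have : 0 ≤ ((n : ℝ) + 1) ^ (-α) := by positivity
    nlinarith
  have hxs : ∀ᶠ n : ℕ in atTop, c * η * ((n : ℝ) + 1) ^ (-α) ≤ 1 := by
    have h1 : Tendsto (fun n : ℕ => c * η * ((n : ℝ) + 1) ^ (-α)) atTop (𝓝 (c * η * 0)) :=
      ((tendsto_rpow_neg_atTop hα).comp
        (tendsto_atTop_add_const_right _ _ tendsto_natCast_atTop_atTop)).const_mul _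
    exact h1.eventually_le_const (by simp)
  obtain ⟨N, hN⟩ := eventually_atTop.1 (h.and (hgrow.and hxs))
  -- The second summand makes the bound true for `n ≤ N`; the first absorbs the term with `B` after.
  set K : ℝ := 4 * B * η ^ 2 / c + ∑ n ∈ Finset.range (N + 1), b n / (((n : ℝ) + 1) ^ (-α)) ^ 2
    + 1 with hK
  have hsum : ∀ n ∈ Finset.range (N + 1), 0 ≤ b n / (((n : ℝ) + 1) ^ (-α)) ^ 2 := fun n _ =>
    div_nonneg (hb n) (by positivity)
  have hS := Finset.sum_nonneg hsum
  have hBK0 : 0 ≤ 4 * B * η ^ 2 / c := by positivity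
  have hK0 : 0 < K := by linarith
  have hBK : 4 * B * η ^ 2 / c ≤ K := by linarith
  refine ⟨K, hK0, fun n => ?_⟩
  have hsmall : ∀ n ≤ N, b n ≤ K * (((n : ℝ) + 1) ^ (-α)) ^ 2 := fun n hn => by
    have h1 : b n / (((n : ℝ) + 1) ^ (-α)) ^ 2 ≤ K := by
      have := Finset.single_le_sum hsum (Finset.mem_range.2 (Nat.lt_succ_of_le hn))
      linarith
    rwa [div_le_iff₀ (by positivity)] at h1
  rcases le_total n N with hn | hn
  · exact hsmall n hn
  induction n, hn using Nat.le_induction with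
  | base => exact hsmall N le_rfl
  | succ n hn ih =>
    obtain ⟨h1, h2, hx1⟩ := hN n hn
    set u := ((n : ℝ) + 1) ^ (-α) with hu
    set u' := (((n + 1 : ℕ) : ℝ) + 1) ^ (-α) with hu'
    have hn0 : (0 : ℝ) < (n : ℝ) + 1 := by positivity
    have hu0 : 0 < u := by positivity
    have hu0' : 0 < u' := by positivity
    set x := c * η * u with hx
    have hx0 : 0 < x := by positivity
    have huu : u ≤ u' * (1 + 1 / ((n : ℝ) + 1)) := by
      have h3 : (((n + 1 : ℕ) : ℝ) + 1) = ((n : ℝ) + 1) * (1 + 1 / ((n : ℝ) + 1)) := by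
        push_cast
        field_simp
      have h4 : (1 + 1 / ((n : ℝ) + 1)) ^ α ≤ 1 + 1 / ((n : ℝ) + 1) := by
        have : 1 ≤ 1 + 1 / ((n : ℝ) + 1) := by
          have : 0 ≤ 1 / ((n : ℝ) + 1) := by positivity
          linarith
        simpa using Real.rpow_le_rpow_of_exponent_le this hα'.le
      have h5 : u' = u * ((1 + 1 / ((n : ℝ) + 1)) ^ α)⁻¹ := by
        rw [hu', h3, Real.mul_rpow (by positivity) (by positivity),
          Real.rpow_neg (by positivity : (0 : ℝ) ≤ 1 + 1 / ((n : ℝ) + 1))]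
      have h6 : 0 < (1 + 1 / ((n : ℝ) + 1)) ^ α := by positivity
      rw [h5, mul_assoc]
      refine le_mul_of_one_le_right hu0.le ?_
      rw [inv_mul_eq_div, one_le_div h6]
      exact h4
    have hsq : u ^ 2 ≤ u' ^ 2 * (1 + x / 2) := by
      have hz : 0 ≤ 1 / ((n : ℝ) + 1) := by positivity
      have hz1 : 1 / ((n : ℝ) + 1) ≤ 1 := by
        rw [div_le_one hn0]
        linarith [Nat.cast_nonneg (α := ℝ) n]
      have h3 : (1 + 1 / ((n : ℝ) + 1)) ^ 2 ≤ 1 + x / 2 := by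
        have h2' : 3 * (1 / ((n : ℝ) + 1)) ≤ x / 2 := by
          rw [hx, mul_one_div]
          linarith
        nlinarith
      calc u ^ 2 ≤ (u' * (1 + 1 / ((n : ℝ) + 1))) ^ 2 := by gcongr
        _ = u' ^ 2 * (1 + 1 / ((n : ℝ) + 1)) ^ 2 := mul_pow _ _ _
        _ ≤ _ := by gcongr
    have hBx : B * (η * u) ^ 3 ≤ K * u ^ 2 * (x / 4) := by
      have : B * (η * u) ^ 3 = (4 * B * η ^ 2 / c) * u ^ 2 * (x / 4) := by
        rw [hx]
        field_simp
      rw [this]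
      gcongr
    have hmain : b (n + 1) ≤ K * u ^ 2 * (1 - 3 * x / 4) := by
      have h3 : (1 - c * (η * u)) * b n ≤ (1 - x) * (K * u ^ 2) := by
        rw [show c * (η * u) = x by rw [hx]; ring]
        exact mul_le_mul_of_nonneg_left ih (by linarith)
      linarith
    have hK2 : 0 ≤ K * u' ^ 2 := by positivity
    have h0 : 0 ≤ 1 - 3 * x / 4 := by linarith
    calc b (n + 1) ≤ K * u ^ 2 * (1 - 3 * x / 4) := hmain
      _ ≤ K * (u' ^ 2 * (1 + x / 2)) * (1 - 3 * x / 4) := by gcongr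
      _ = K * u' ^ 2 * ((1 + x / 2) * (1 - 3 * x / 4)) := by ring
      _ ≤ K * u' ^ 2 * 1 := by
          gcongr
          nlinarith
      _ = _ := mul_one _

end Rates

/-! ### Stochastic approximation: moments of the iterates -/

section StochasticApproximation

variable {Ω : Type*} {mΩ : MeasurableSpace Ω} {E : Type*} [NormedAddCommGroup E]
  [InnerProductSpace ℝ E]

/-- A Robbins–Monro recursion `δ_{n+1} = δ_n - s_n (G(δ_n) - e_n)` for the error `δ`, with steps
`s_n = η (n + 1) ^ (-α)`, a coercive field `G` of linear growth that agrees with its linearization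
`H` up to a quadratic error, and conditionally centred noise `e`. The conditional covariance of the
noise, as a quadratic form, is `Q` up to an error controlled by `δ`. -/
structure IsRobbinsMonro (μ : Measure Ω) (ℱ : Filtration ℕ mΩ) (G : E → E) (H : E →L[ℝ] E)
    (Q : E → ℝ) (η α : ℝ) (δ e : ℕ → Ω → E) : Prop where
  step_pos : 0 < η
  half_lt : 1 / 2 < α
  lt_one : α < 1
  step : ∀ n ω, δ (n + 1) ω = δ n ω - (η * ((n : ℝ) + 1) ^ (-α)) • (G (δ n ω) - e n ω)
  adapted : ∀ n, StronglyMeasurable[ℱ n] (δ n)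
  adapted_noise : ∀ n, StronglyMeasurable[ℱ (n + 1)] (e n)
  memLp_zero : MemLp (δ 0) 4 μ
  memLp_noise : ∀ n, MemLp (e n) 4 μ
  condExp_noise : ∀ n, μ[e n | ℱ n] =ᵐ[μ] 0
  exists_noise_le : ∃ C, ∀ n, ∫ ω, ‖e n ω‖ ^ 4 ∂μ ≤ C * (1 + ∫ ω, ‖δ n ω‖ ^ 4 ∂μ)
  exists_condExp_le : ∀ p, ∃ C, ∀ n, ∀ᵐ ω ∂μ,
    |(μ[fun ω' => inner ℝ p (e n ω') ^ 2 | ℱ n]) ω - Q p| ≤ C * (‖δ n ω‖ + ‖δ n ω‖ ^ 2)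
  continuous : Continuous G
  coercive : ∃ c, 0 < c ∧ ∀ v, c * ‖v‖ ^ 2 ≤ inner ℝ (G v) v
  exists_norm_le : ∃ L, 0 < L ∧ ∀ v, ‖G v‖ ≤ L * ‖v‖
  exists_sub_le : ∃ K, ∀ v, ‖G v - H v‖ ≤ K * ‖v‖ ^ 2

variable {μ : Measure Ω} {ℱ : Filtration ℕ mΩ} {G : E → E} {H : E →L[ℝ] E}
  {Q : E → ℝ} {η α : ℝ} {δ e : ℕ → Ω → E}

lemma tendsto_add_one_rpow_neg {a : ℝ} (ha : 0 < a) :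
    Tendsto (fun n : ℕ => ((n : ℝ) + 1) ^ (-a)) atTop (𝓝 0) :=
  (tendsto_rpow_neg_atTop ha).comp
    (tendsto_atTop_add_const_right _ _ tendsto_natCast_atTop_atTop)

lemma add_one_rpow_neg_le_one {a : ℝ} (ha : 0 < a) (n : ℕ) : ((n : ℝ) + 1) ^ (-a) ≤ 1 :=
  Real.rpow_le_one_of_one_le_of_nonpos (by linarith [Nat.cast_nonneg (α := ℝ) n]) (by linarith)

namespace IsRobbinsMonro

lemma memLp_drift (h : IsRobbinsMonro μ ℱ G H Q η α δ e) {n : ℕ} (hδ : MemLp (δ n) 4 μ) :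
    MemLp (fun ω => G (δ n ω)) 4 μ := by
  obtain ⟨L, _, hL⟩ := h.exists_norm_le
  exact hδ.of_le_mul (h.continuous.comp_aestronglyMeasurable hδ.1) (ae_of_all _ fun ω => hL _)

lemma memLp (h : IsRobbinsMonro μ ℱ G H Q η α δ e) (n : ℕ) : MemLp (δ n) 4 μ := by
  induction n with
  | zero => exact h.memLp_zero
  | succ n ih =>
    have e1 : δ (n + 1) = fun ω => δ n ω - (η * ((n : ℝ) + 1) ^ (-α)) • (G (δ n ω) - e n ω) :=
      funext fun ω => h.step n ω
    rw [e1]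
    exact ih.sub (((h.memLp_drift ih).sub (h.memLp_noise n)).const_smul _)

/-- One step of the recursion contracts the fourth moment up to a term of third order in the step
size. -/
lemma eventually_integral_norm_pow_four_le [IsProbabilityMeasure μ] [CompleteSpace E]
    (h : IsRobbinsMonro μ ℱ G H Q η α δ e) :
    ∃ c B, 0 < c ∧ 0 ≤ B ∧ ∀ᶠ n : ℕ in atTop, ∫ ω, ‖δ (n + 1) ω‖ ^ 4 ∂μ ≤
      (1 - c * (η * ((n : ℝ) + 1) ^ (-α))) * ∫ ω, ‖δ n ω‖ ^ 4 ∂μ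
        + B * (η * ((n : ℝ) + 1) ^ (-α)) ^ 3 := by
  obtain ⟨c, hc, hcoer⟩ := h.coercive
  obtain ⟨L, hL, hLG⟩ := h.exists_norm_le
  obtain ⟨C, hC⟩ := h.exists_noise_le
  have hη := h.step_pos
  have hC0 : 0 ≤ |C| := abs_nonneg C
  set B : ℝ := |C| * (32 / c + 3) with hB
  have hB0 : 0 ≤ B := by positivity
  refine ⟨c / 2, B, by positivity, hB0, ?_⟩
  have hs : Tendsto (fun n : ℕ => η * ((n : ℝ) + 1) ^ (-α)) atTop (𝓝 (η * 0)) :=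
    (tendsto_add_one_rpow_neg (by linarith [h.half_lt])).const_mul η
  rw [mul_zero] at hs
  filter_upwards [hs.eventually_le_const (u := 1) one_pos,
    hs.eventually_le_const (u := c / L ^ 2) (by positivity),
    hs.eventually_le_const (u := 1 / c) (by positivity),
    hs.eventually_le_const (u := c / (2 * (B + 1))) (by positivity)] with n hs1 hs2 hs3 hs4
  set s : ℝ := η * ((n : ℝ) + 1) ^ (-α) with hsdef
  have hs0 : 0 < s := by positivity
  rw [le_div_iff₀ (by positivity)] at hs2 hs3 hs4
  set D : Ω → E := fun ω => δ n ω - s • G (δ n ω) with hD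
  have hDm : StronglyMeasurable[ℱ n] D :=
    (h.adapted n).sub ((h.continuous.comp_stronglyMeasurable (h.adapted n)).const_smul s)
  have hD4 : MemLp D 4 μ := (h.memLp n).sub ((h.memLp_drift (h.memLp n)).const_smul s)
  have he4 : MemLp (fun ω => s • e n ω) 4 μ := (h.memLp_noise n).const_smul s
  have he0 : μ[fun ω => s • e n ω | ℱ n] =ᵐ[μ] 0 := by
    filter_upwards [condExp_smul (μ := μ) s (e n) (ℱ n), h.condExp_noise n] with ω h1 h2
    change (μ[s • e n | ℱ n]) ω = 0
    rw [h1, Pi.smul_apply, h2, Pi.zero_apply, smul_zero]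
  have hstep : ∀ ω, δ (n + 1) ω = D ω + s • e n ω := fun ω => by
    rw [h.step, ← hsdef]
    simp only [hD, smul_sub]
    abel
  have hDle : ∀ ω, ‖D ω‖ ^ 2 ≤ (1 - c * s) * ‖δ n ω‖ ^ 2 := fun ω => by
    have h1 : ‖D ω‖ ^ 2 = ‖δ n ω‖ ^ 2 - 2 * (s * inner ℝ (G (δ n ω)) (δ n ω))
        + s ^ 2 * ‖G (δ n ω)‖ ^ 2 := by
      rw [hD]
      simp only
      rw [norm_sub_sq_real, inner_smul_right, norm_smul, Real.norm_of_nonneg hs0.le, mul_pow,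
        real_inner_comm]
    have h2 := mul_le_mul_of_nonneg_left (hcoer (δ n ω)) hs0.le
    have h3 : ‖G (δ n ω)‖ ^ 2 ≤ (L * ‖δ n ω‖) ^ 2 := by
      gcongr
      exact hLG _
    have h4 : s ^ 2 * ‖G (δ n ω)‖ ^ 2 ≤ s * c * ‖δ n ω‖ ^ 2 := by
      calc s ^ 2 * ‖G (δ n ω)‖ ^ 2 ≤ s ^ 2 * (L * ‖δ n ω‖) ^ 2 := by gcongr
        _ = s * (s * L ^ 2) * ‖δ n ω‖ ^ 2 := by ring
        _ ≤ _ := by gcongr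
    rw [h1]
    linarith
  have hcs : 0 ≤ 1 - c * s := by linarith
  have i4 := integrable_norm_pow_of_memLp_four (h.memLp n) (a := 4) le_rfl
  have hD4le : ∫ ω, ‖D ω‖ ^ 4 ∂μ ≤ (1 - c * s) ^ 2 * ∫ ω, ‖δ n ω‖ ^ 4 ∂μ := by
    rw [← integral_const_mul]
    refine integral_mono (integrable_norm_pow_of_memLp_four hD4 le_rfl) (i4.const_mul _)
      fun ω => ?_
    calc ‖D ω‖ ^ 4 = (‖D ω‖ ^ 2) ^ 2 := by ring
      _ ≤ ((1 - c * s) * ‖δ n ω‖ ^ 2) ^ 2 := by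
          gcongr
          exact hDle ω
      _ = _ := by ring
  have hy := integral_sq_mul_sq_le hD4.norm he4.norm (c := c * s / 8) (by positivity)
  have hmain := integral_norm_add_pow_four_le (ℱ.le n) hDm hD4 he4 he0
  simp_rw [hstep]
  set b := ∫ ω, ‖δ n ω‖ ^ 4 ∂μ with hb
  have hb0 : 0 ≤ b := integral_nonneg fun ω => by positivity
  have hse : ∫ ω, ‖s • e n ω‖ ^ 4 ∂μ = s ^ 4 * ∫ ω, ‖e n ω‖ ^ 4 ∂μ := by
    simp_rw [norm_smul, mul_pow, Real.norm_of_nonneg hs0.le]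
    rw [integral_const_mul]
  rw [hse] at hmain hy
  set m := ∫ ω, ‖e n ω‖ ^ 4 ∂μ with hm
  have hmC : m ≤ |C| * (1 + b) := (hC n).trans (by
    gcongr
    exact le_abs_self C)
  set A := ∫ ω, ‖D ω‖ ^ 4 ∂μ with hA
  have hm0 : 0 ≤ m := integral_nonneg fun ω => by positivity
  have hA0 : 0 ≤ A := integral_nonneg fun ω => by positivity
  -- the weight `c s / 8` in Young's inequality leaves half of the contraction
  have h8 : 8 * ((c * s / 8 * A + (c * s / 8)⁻¹ * (s ^ 4 * m)) / 2) =
      c * s / 2 * A + 32 / c * s ^ 3 * m := by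
    field_simp
    ring
  have k1 : ∫ ω, ‖D ω + s • e n ω‖ ^ 4 ∂μ ≤
      (1 + c * s / 2) * A + (32 / c + 3) * s ^ 3 * m := by
    have : s ^ 4 * m ≤ s ^ 3 * m := by
      gcongr ?_ * m
      exact pow_le_pow_of_le_one hs0.le hs1 (by norm_num)
    linarith
  have k2 : (1 + c * s / 2) * A ≤ (1 - c * s) * b := by
    calc (1 + c * s / 2) * A ≤ (1 + c * s / 2) * ((1 - c * s) ^ 2 * b) := by gcongr
      _ = (1 - c * s) * b * ((1 + c * s / 2) * (1 - c * s)) := by ring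
      _ ≤ (1 - c * s) * b * 1 := by
          gcongr
          nlinarith [mul_pos hc hs0]
      _ = _ := mul_one _
  have k3 : (32 / c + 3) * s ^ 3 * m ≤ B * s ^ 3 + c / 2 * s * b := by
    calc (32 / c + 3) * s ^ 3 * m ≤ (32 / c + 3) * s ^ 3 * (|C| * (1 + b)) := by gcongr
      _ = B * s ^ 3 + s * s * (s * B) * b := by rw [hB]; ring
      _ ≤ B * s ^ 3 + s * 1 * (c / 2) * b := by
          gcongr
          linarith
      _ = _ := by ring
  linarith

lemma exists_integral_norm_pow_four_le [IsProbabilityMeasure μ] [CompleteSpace E]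
    (h : IsRobbinsMonro μ ℱ G H Q η α δ e) :
    ∃ K, 0 < K ∧ ∀ n : ℕ, ∫ ω, ‖δ n ω‖ ^ 4 ∂μ ≤ K * (((n : ℝ) + 1) ^ (-α)) ^ 2 := by
  obtain ⟨c, B, hc, hB, hrec⟩ := h.eventually_integral_norm_pow_four_le
  exact exists_le_mul_sq_of_recursion (fun n => integral_nonneg fun ω => by positivity) hc hB
    h.step_pos (by linarith [h.half_lt]) h.lt_one hrec

lemma exists_integral_noise_le [IsProbabilityMeasure μ] [CompleteSpace E]
    (h : IsRobbinsMonro μ ℱ G H Q η α δ e) :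
    ∃ M, ∀ n : ℕ, ∫ ω, ‖e n ω‖ ^ 4 ∂μ ≤ M := by
  obtain ⟨C, hC⟩ := h.exists_noise_le
  obtain ⟨K, hK, hδ⟩ := h.exists_integral_norm_pow_four_le
  refine ⟨|C| * (1 + K), fun n => (hC n).trans ?_⟩
  have h1 : ∫ ω, ‖δ n ω‖ ^ 4 ∂μ ≤ K := (hδ n).trans (mul_le_of_le_one_right hK.le
    (pow_le_one₀ (by positivity) (add_one_rpow_neg_le_one (by linarith [h.half_lt]) n)))
  have h0 : 0 ≤ ∫ ω, ‖δ n ω‖ ^ 4 ∂μ := integral_nonneg fun ω => by positivity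
  calc C * (1 + ∫ ω, ‖δ n ω‖ ^ 4 ∂μ) ≤ |C| * (1 + ∫ ω, ‖δ n ω‖ ^ 4 ∂μ) := by
        gcongr
        exact le_abs_self C
    _ ≤ _ := by gcongr

lemma integrable_norm_sq [IsProbabilityMeasure μ] (h : IsRobbinsMonro μ ℱ G H Q η α δ e) (n : ℕ) :
    Integrable (fun ω => ‖δ n ω‖ ^ 2) μ :=
  integrable_norm_pow_of_memLp_four (h.memLp n) (by norm_num)

lemma exists_integral_norm_sq_le [IsProbabilityMeasure μ] [CompleteSpace E]
    (h : IsRobbinsMonro μ ℱ G H Q η α δ e) :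
    ∃ K, 0 < K ∧ ∀ n : ℕ, ∫ ω, ‖δ n ω‖ ^ 2 ∂μ ≤ K * ((n : ℝ) + 1) ^ (-α) := by
  obtain ⟨K, hK, hδ⟩ := h.exists_integral_norm_pow_four_le
  refine ⟨(K + 1) / 2, by positivity, fun n => ?_⟩
  set u := ((n : ℝ) + 1) ^ (-α) with hu
  have hu0 : 0 < u := by positivity
  have hy := integral_sq_mul_sq_le (μ := μ) (h.memLp n).norm
    (memLp_const (1 : ℝ) : MemLp (fun _ => (1 : ℝ)) 4 μ) (c := u⁻¹) (by positivity)
  simp only [one_pow, mul_one, inv_inv, integral_const, probReal_univ, smul_eq_mul] at hy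
  have h1 : u⁻¹ * ∫ ω, ‖δ n ω‖ ^ 4 ∂μ ≤ K * u := by
    rw [inv_mul_le_iff₀ hu0]
    calc _ ≤ K * u ^ 2 := hδ n
      _ = _ := by ring
  linarith

/-- The conditional variances of the noise in a fixed direction converge in mean. -/
lemma tendsto_integral_abs_condExp_sub [IsProbabilityMeasure μ] [CompleteSpace E]
    (h : IsRobbinsMonro μ ℱ G H Q η α δ e) (p : E) :
    Tendsto (fun n => ∫ ω, |(μ[fun ω' => inner ℝ p (e n ω') ^ 2 | ℱ n]) ω - Q p| ∂μ) atTop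
      (𝓝 0) := by
  obtain ⟨C, hC⟩ := h.exists_condExp_le p
  obtain ⟨K, hK, hδ⟩ := h.exists_integral_norm_sq_le
  have hu := tendsto_add_one_rpow_neg (a := α) (by linarith [h.half_lt])
  have hbound : ∀ n, ∫ ω, |(μ[fun ω' => inner ℝ p (e n ω') ^ 2 | ℱ n]) ω - Q p| ∂μ ≤
      |C| * (√(K * ((n : ℝ) + 1) ^ (-α)) + K * ((n : ℝ) + 1) ^ (-α)) := by
    intro n
    have i1 : Integrable (fun ω => ‖δ n ω‖) μ := ((h.memLp n).integrable (by norm_num)).norm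
    have i2 := h.integrable_norm_sq n
    calc _ ≤ ∫ ω, |C| * (‖δ n ω‖ + ‖δ n ω‖ ^ 2) ∂μ := by
          refine integral_mono_of_nonneg (ae_of_all _ fun ω => abs_nonneg _)
            ((i1.add i2).const_mul _) ?_
          filter_upwards [hC n] with ω hω
          refine hω.trans ?_
          gcongr
          exact le_abs_self C
      _ = |C| * (∫ ω, ‖δ n ω‖ ∂μ + ∫ ω, ‖δ n ω‖ ^ 2 ∂μ) := by
          rw [integral_const_mul, integral_add i1 i2]
      _ ≤ _ := by
          gcongr
          · have h1 := integral_abs_le_sqrt_integral_sq (μ := μ) (Y := fun ω => ‖δ n ω‖)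
              ((h.memLp n).norm.mono_exponent (by norm_num))
            simp only [abs_norm] at h1
            exact h1.trans (Real.sqrt_le_sqrt (hδ n))
          · exact hδ n
  refine squeeze_zero (fun n => integral_nonneg fun ω => abs_nonneg _) hbound ?_
  have h1 := hu.const_mul K
  simpa using (h1.sqrt.add h1).const_mul |C|

/-- The noise in a fixed direction is a martingale difference. -/
lemma exists_isMartingaleDifference [IsProbabilityMeasure μ] [CompleteSpace E]
    (h : IsRobbinsMonro μ ℱ G H Q η α δ e) (p : E) :
    ∃ M, IsMartingaleDifference μ ℱ (fun n ω => inner ℝ p (e n ω)) M := by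
  obtain ⟨M, hM⟩ := h.exists_integral_noise_le
  have hmem : ∀ n, MemLp (fun ω => inner ℝ p (e n ω)) 4 μ := fun n =>
    (h.memLp_noise n).const_inner p
  refine ⟨‖p‖ ^ 4 * M, fun n => stronglyMeasurable_const.inner (h.adapted_noise n), hmem,
    fun n => ?_, fun n => ?_⟩
  · have h1 := condExp_bilin_of_stronglyMeasurable_left (μ := μ) (m := ℱ n) (innerSL ℝ)
      (f := fun _ : Ω => p) (g := e n) stronglyMeasurable_const
      ((hmem n).integrable (by norm_num)) ((h.memLp_noise n).integrable (by norm_num))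
    filter_upwards [h1, h.condExp_noise n] with ω h2 h3
    refine h2.trans ?_
    rw [h3]
    simp
  · have i4 := integrable_norm_pow_of_memLp_four (h.memLp_noise n) (a := 4) le_rfl
    calc ∫ ω, inner ℝ p (e n ω) ^ 4 ∂μ ≤ ∫ ω, ‖p‖ ^ 4 * ‖e n ω‖ ^ 4 ∂μ := by
          refine integral_mono_of_nonneg (ae_of_all _ fun ω => by positivity) (i4.const_mul _)
            (ae_of_all _ fun ω => ?_)
          beta_reduce
          rw [← Even.pow_abs (by decide : Even 4), ← mul_pow]
          gcongr
          exact abs_real_inner_le_norm _ _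
      _ ≤ _ := by
          rw [integral_const_mul]
          gcongr
          exact hM n

end IsRobbinsMonro

end StochasticApproximation

/-! ### Stochastic approximation: sums of the iterates -/

section SummationByParts

lemma Finset.sum_Icc_smul_sub_succ_eq {E : Type*} [AddCommGroup E] [Module ℝ E] (w : ℕ → ℝ)
    (x : ℕ → E) {a i : ℕ} (hai : a ≤ i) :
    ∑ k ∈ Finset.Icc a i, w k • (x k - x (k + 1)) =
      w a • x a - w i • x (i + 1) + ∑ k ∈ Finset.Ico a i, (w (k + 1) - w k) • x (k + 1) := by
  induction i, hai using Nat.le_induction with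
  | base => simp [smul_sub]
  | succ i hai ih =>
    rw [Finset.sum_Icc_succ_top (by omega), ih, Finset.sum_Ico_succ_top hai]
    module

lemma norm_add_add_sq_le {E : Type*} [SeminormedAddCommGroup E] (x y z : E) :
    ‖x + y + z‖ ^ 2 ≤ 3 * (‖x‖ ^ 2 + ‖y‖ ^ 2 + ‖z‖ ^ 2) := by
  have h : ‖x + y + z‖ ≤ ‖x‖ + ‖y‖ + ‖z‖ := norm_add₃_le
  have h2 : ‖x + y + z‖ ^ 2 ≤ (‖x‖ + ‖y‖ + ‖z‖) ^ 2 := by gcongr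
  nlinarith [sq_nonneg (‖x‖ - ‖y‖), sq_nonneg (‖x‖ - ‖z‖), sq_nonneg (‖y‖ - ‖z‖)]

/-- If `E‖x_k‖ ^ 2 ≤ K / w_k` for increasing weights `w`, then `∑ w_k (x_k - x_{k+1})` has second
moment of the order of the last weight, however long the sum: summation by parts leaves the
increments of `w`, which are compared with those of `√w`. -/
lemma integral_norm_sum_smul_sub_succ_sq_le {Ω E : Type*} {mΩ : MeasurableSpace Ω} {μ : Measure Ω}
    [NormedAddCommGroup E] [NormedSpace ℝ E] {w : ℕ → ℝ} (hw : StrictMono w)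
    (hw0 : ∀ k, 0 < w k) {x : ℕ → Ω → E} {K : ℝ} (hK : 0 < K)
    (hx : ∀ k, Integrable (fun ω => ‖x k ω‖ ^ 2) μ) (hxm : ∀ k, AEStronglyMeasurable (x k) μ)
    (hxK : ∀ k, ∫ ω, ‖x k ω‖ ^ 2 ∂μ ≤ K / w k) {a i : ℕ} (hai : a ≤ i) :
    ∫ ω, ‖∑ k ∈ Finset.Icc a i, w k • (x k ω - x (k + 1) ω)‖ ^ 2 ∂μ ≤ 18 * K * w i := by
  have hsm : ∀ (c : ℝ) (k : ℕ), Integrable (fun ω => ‖c • x k ω‖ ^ 2) μ := fun c k => by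
    simp_rw [norm_smul, mul_pow]
    exact (hx k).const_mul _
  have hsmK : ∀ (c : ℝ) (k : ℕ), ∫ ω, ‖c • x k ω‖ ^ 2 ∂μ ≤ c ^ 2 * (K / w k) := fun c k => by
    simp_rw [norm_smul, mul_pow, integral_const_mul, Real.norm_eq_abs, sq_abs]
    gcongr
    exact hxK k
  -- `(w_{k+1} - w_k) / √w_{k+1} ≤ 2 (√w_{k+1} - √w_k)`, and the right-hand side telescopes.
  set s : ℕ → ℝ := fun k => √(w k) with hs
  have hs0 : ∀ k, 0 < s k := fun k => Real.sqrt_pos.2 (hw0 k)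
  have hs2 : ∀ k, s k ^ 2 = w k := fun k => Real.sq_sqrt (hw0 k).le
  have hslt : ∀ k, s k < s (k + 1) := fun k => Real.sqrt_lt_sqrt (hw0 k).le (hw k.lt_succ_self)
  set S : Ω → E := fun ω => ∑ k ∈ Finset.Ico a i, (w (k + 1) - w k) • x (k + 1) ω with hS
  have hSK : ∫ ω, ‖S ω‖ ^ 2 ∂μ ≤ 4 * K * w i := by
    have h1 := integral_norm_sum_sq_le (μ := μ) (Finset.Ico a i)
      (Y := fun k ω => (w (k + 1) - w k) • x (k + 1) ω)
      (b := fun k => 2 * √K * (s (k + 1) - s k)) (fun k _ => hsm _ _)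
      (fun k _ => mul_pos (by positivity) (sub_pos.2 (hslt k))) (fun k _ => ?_)
    · refine h1.trans ?_
      rw [← Finset.mul_sum, Finset.sum_Ico_sub _ hai, mul_pow, mul_pow, Real.sq_sqrt hK.le]
      have h2 : (s i - s a) ^ 2 ≤ w i := by
        rw [← hs2 i]
        have h3 : s a ≤ s i := Real.sqrt_le_sqrt (hw.monotone hai)
        have := hs0 a
        exact pow_le_pow_left₀ (by linarith) (by linarith) 2
      nlinarith
    · refine (hsmK _ _).trans ?_
      have h2 : 0 ≤ s (k + 1) - s k := (sub_pos.2 (hslt k)).le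
      rw [← hs2, ← hs2 k, mul_pow, mul_pow, Real.sq_sqrt hK.le]
      have h3 : s (k + 1) ^ 2 - s k ^ 2 = (s (k + 1) - s k) * (s (k + 1) + s k) := by ring
      have h4 := hs0 (k + 1)
      have h5 := hs0 k
      rw [h3, mul_div_assoc', div_le_iff₀ (by positivity), mul_pow]
      have h6 : (s (k + 1) + s k) ^ 2 ≤ (2 * s (k + 1)) ^ 2 := by
        gcongr
        linarith [hslt k]
      have h7 := mul_le_mul_of_nonneg_left h6 (mul_nonneg (sq_nonneg (s (k + 1) - s k)) hK.le)
      nlinarith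
  have hSi : Integrable (fun ω => ‖S ω‖ ^ 2) μ := by
    have h1 : MemLp S 2 μ := memLp_finsetSum _ fun k _ =>
      ((memLp_two_iff_integrable_sq_norm (hxm (k + 1))).2 (hx (k + 1))).const_smul _
    exact (memLp_two_iff_integrable_sq_norm h1.1).1 h1
  have hwai : w a ≤ w i := hw.monotone hai
  have h1 : ∫ ω, ‖w a • x a ω‖ ^ 2 ∂μ ≤ K * w i := by
    refine (hsmK _ _).trans ?_
    have : w a ^ 2 * (K / w a) = K * w a := by
      have := (hw0 a).ne'
      field_simp
    rw [this]
    gcongr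
  have h2 : ∫ ω, ‖(-w i) • x (i + 1) ω‖ ^ 2 ∂μ ≤ K * w i := by
    refine (hsmK _ _).trans ?_
    have h3 := hw0 i
    have h4 := hw i.lt_succ_self
    calc (-w i) ^ 2 * (K / w (i + 1)) ≤ (-w i) ^ 2 * (K / w i) := by
          gcongr
      _ = K * w i := by
          field_simp
  calc _ ≤ ∫ ω, 3 * (‖w a • x a ω‖ ^ 2 + ‖(-w i) • x (i + 1) ω‖ ^ 2 + ‖S ω‖ ^ 2) ∂μ := by
        refine integral_mono_of_nonneg (ae_of_all _ fun ω => by positivity)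
          ((((hsm _ _).add (hsm _ _)).add hSi).const_mul 3) (ae_of_all _ fun ω => ?_)
        beta_reduce
        rw [Finset.sum_Icc_smul_sub_succ_eq w (fun k => x k ω) hai, sub_eq_add_neg, ← neg_smul]
        exact norm_add_add_sq_le _ _ _
    _ = 3 * (∫ ω, ‖w a • x a ω‖ ^ 2 ∂μ + ∫ ω, ‖(-w i) • x (i + 1) ω‖ ^ 2 ∂μ
          + ∫ ω, ‖S ω‖ ^ 2 ∂μ) := by
        rw [integral_const_mul, integral_add ((hsm _ _).fun_add (hsm _ _)) hSi,
          integral_add (hsm _ _) (hsm _ _)]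
    _ ≤ 3 * (K * w i + K * w i + 4 * K * w i) := by gcongr
    _ = _ := by ring

/-- `∑_{k ≤ n} (k + 1) ^ (-α)` is of order `(n + 1) ^ (1 - α)`. -/
lemma sum_add_one_rpow_neg_le {α : ℝ} (hα : 0 < α) (hα' : α < 1) (n : ℕ) :
    ∑ k ∈ Finset.range n, ((k : ℝ) + 1) ^ (-α) ≤ (n : ℝ) ^ (1 - α) / (1 - α) := by
  have h1α : 0 < 1 - α := by linarith
  induction n with
  | zero => simp [h1α.ne']
  | succ n ih =>
    rw [Finset.sum_range_succ]
    have hn : (0 : ℝ) < (n : ℝ) + 1 := by positivity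
    have h1 : (n : ℝ) ^ (1 - α) ≤ ((n : ℝ) + 1) ^ (1 - α) - (1 - α) * ((n : ℝ) + 1) ^ (-α) := by
      have hle : (1 : ℝ) / ((n : ℝ) + 1) ≤ 1 := by
        rw [div_le_one hn]
        linarith [Nat.cast_nonneg (α := ℝ) n]
      have h2 := rpow_one_add_le_one_add_mul_self (s := -(1 / ((n : ℝ) + 1))) (p := 1 - α)
        (by linarith) h1α.le (by linarith)
      have h3 : (n : ℝ) = ((n : ℝ) + 1) * (1 + -(1 / ((n : ℝ) + 1))) := by
        field_simp
        ring
      have h4 : (n : ℝ) ^ (1 - α) =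
          ((n : ℝ) + 1) ^ (1 - α) * (1 + -(1 / ((n : ℝ) + 1))) ^ (1 - α) := by
        rw [← Real.mul_rpow hn.le (by linarith), ← h3]
      have h5 : ((n : ℝ) + 1) ^ (-α) = ((n : ℝ) + 1) ^ (1 - α) * (1 / ((n : ℝ) + 1)) := by
        rw [mul_one_div, ← Real.rpow_sub_one hn.ne']
        congr 1
        ring
      rw [h4, h5]
      have h6 := mul_le_mul_of_nonneg_left h2 (by positivity : 0 ≤ ((n : ℝ) + 1) ^ (1 - α))
      linarith
    push_cast
    rw [le_div_iff₀ h1α] at ih ⊢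
    linarith

end SummationByParts

/-! ### Stochastic approximation: the averaged iterates -/

section AveragedIterates

variable {Ω : Type*} {mΩ : MeasurableSpace Ω} {E : Type*} [NormedAddCommGroup E]
  [InnerProductSpace ℝ E]

/-- The difference between `H (∑ δ_k)` and the sum of the noise over `a ≤ k ≤ i`: a sum that
telescopes up to the variation of the step sizes, and the accumulated linearization error. -/
noncomputable def robbinsMonroRemainder (G : E → E) (H : E →L[ℝ] E) (η α : ℝ) (δ : ℕ → Ω → E)
    (a i : ℕ) (ω : Ω) : E :=
  ∑ k ∈ Finset.Icc a i, (((k : ℝ) + 1) ^ α / η) • (δ k ω - δ (k + 1) ω)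
    - ∑ k ∈ Finset.Icc a i, (G (δ k ω) - H (δ k ω))

variable {μ : Measure Ω} {ℱ : Filtration ℕ mΩ} {G : E → E} {H : E →L[ℝ] E}
  {Q : E → ℝ} {η α : ℝ} {δ e : ℕ → Ω → E}

namespace IsRobbinsMonro

lemma map_sum_eq (h : IsRobbinsMonro μ ℱ G H Q η α δ e) (a i : ℕ) (ω : Ω) :
    H (∑ k ∈ Finset.Icc a i, δ k ω) =
      ∑ k ∈ Finset.Icc a i, e k ω + robbinsMonroRemainder G H η α δ a i ω := by
  rw [robbinsMonroRemainder, ← Finset.sum_sub_distrib, ← Finset.sum_add_distrib, map_sum]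
  refine Finset.sum_congr rfl fun k _ => ?_
  have hk : (0 : ℝ) < (k : ℝ) + 1 := by positivity
  have h1 : (((k : ℝ) + 1) ^ α / η) * (η * ((k : ℝ) + 1) ^ (-α)) = 1 := by
    have := h.step_pos.ne'
    rw [Real.rpow_neg hk.le]
    field_simp
  rw [h.step k ω, sub_sub_cancel, smul_smul, h1, one_smul]
  abel

lemma memLp_linearizationError (h : IsRobbinsMonro μ ℱ G H Q η α δ e) (k : ℕ) :
    MemLp (fun ω => G (δ k ω) - H (δ k ω)) 4 μ :=
  (h.memLp_drift (h.memLp k)).sub (H.comp_memLp' (h.memLp k))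

lemma memLp_telescopingSum (h : IsRobbinsMonro μ ℱ G H Q η α δ e) (a i : ℕ) :
    MemLp (fun ω => ∑ k ∈ Finset.Icc a i, (((k : ℝ) + 1) ^ α / η) • (δ k ω - δ (k + 1) ω)) 4 μ :=
  memLp_finsetSum _ fun k _ => ((h.memLp k).sub (h.memLp (k + 1))).const_smul _

lemma memLp_remainder (h : IsRobbinsMonro μ ℱ G H Q η α δ e) (a i : ℕ) :
    MemLp (robbinsMonroRemainder G H η α δ a i) 4 μ :=
  (h.memLp_telescopingSum a i).sub (memLp_finsetSum _ fun k _ => h.memLp_linearizationError k)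

lemma exists_integral_telescopingSum_le [IsProbabilityMeasure μ] [CompleteSpace E]
    (h : IsRobbinsMonro μ ℱ G H Q η α δ e) :
    ∃ C, 0 < C ∧ ∀ a i : ℕ, a ≤ i →
      ∫ ω, ‖∑ k ∈ Finset.Icc a i, (((k : ℝ) + 1) ^ α / η) • (δ k ω - δ (k + 1) ω)‖ ^ 2 ∂μ ≤
        C * ((i : ℝ) + 1) ^ α := by
  obtain ⟨K, hK, hδ⟩ := h.exists_integral_norm_sq_le
  have hη := h.step_pos
  have hα : 0 < α := by linarith [h.half_lt]
  refine ⟨18 * (K / η) / η, by positivity, fun a i hai => ?_⟩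
  have hmono : StrictMono fun k : ℕ => ((k : ℝ) + 1) ^ α / η := by
    intro k l hkl
    have : (k : ℝ) < l := by exact_mod_cast hkl
    beta_reduce
    gcongr
  refine (integral_norm_sum_smul_sub_succ_sq_le hmono (fun k => by positivity)
    (K := K / η) (by positivity) (fun k => h.integrable_norm_sq k) (fun k => (h.memLp k).1)
    (fun k => (hδ k).trans (le_of_eq ?_)) hai).trans (le_of_eq (by ring))
  have hk : (0 : ℝ) ≤ (k : ℝ) + 1 := by positivity
  rw [Real.rpow_neg hk]
  field_simp

lemma exists_integral_remainder_sq_le [IsProbabilityMeasure μ] [CompleteSpace E]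
    (h : IsRobbinsMonro μ ℱ G H Q η α δ e) :
    ∃ C, 0 < C ∧ ∀ a i : ℕ, a ≤ i →
      ∫ ω, ‖robbinsMonroRemainder G H η α δ a i ω‖ ^ 2 ∂μ ≤
        C * (((i : ℝ) + 1) ^ α + ((i + 1 - a : ℕ) : ℝ) *
          ∑ k ∈ Finset.Icc a i, (((k : ℝ) + 1) ^ (-α)) ^ 2) := by
  obtain ⟨C, hC, hT⟩ := h.exists_integral_telescopingSum_le
  obtain ⟨K, hK, hδ⟩ := h.exists_integral_norm_pow_four_le
  obtain ⟨K', hGH⟩ := h.exists_sub_le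
  refine ⟨2 * C + 2 * (K' ^ 2 * K), by positivity, fun a i hai => ?_⟩
  have i4 := fun k => integrable_norm_pow_of_memLp_four (h.memLp k) (a := 4) le_rfl
  have iT := integrable_norm_pow_of_memLp_four (h.memLp_telescopingSum a i) (a := 2) (by norm_num)
  have iS : Integrable (fun ω => ((i + 1 - a : ℕ) : ℝ) *
      ∑ k ∈ Finset.Icc a i, K' ^ 2 * ‖δ k ω‖ ^ 4) μ :=
    (integrable_finsetSum _ fun k _ => (i4 k).const_mul _).const_mul _
  have hS0 : 0 ≤ ((i + 1 - a : ℕ) : ℝ) * ∑ k ∈ Finset.Icc a i, (((k : ℝ) + 1) ^ (-α)) ^ 2 := by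
    positivity
  have hi0 : 0 ≤ ((i : ℝ) + 1) ^ α := by positivity
  calc ∫ ω, ‖robbinsMonroRemainder G H η α δ a i ω‖ ^ 2 ∂μ
      ≤ ∫ ω, (2 * ‖∑ k ∈ Finset.Icc a i, (((k : ℝ) + 1) ^ α / η) • (δ k ω - δ (k + 1) ω)‖ ^ 2
          + 2 * (((i + 1 - a : ℕ) : ℝ) * ∑ k ∈ Finset.Icc a i, K' ^ 2 * ‖δ k ω‖ ^ 4)) ∂μ := by
        refine integral_mono_of_nonneg (ae_of_all _ fun ω => by positivity)
          ((iT.const_mul 2).add (iS.const_mul 2)) (ae_of_all _ fun ω => ?_)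
        beta_reduce
        have h1 : ‖∑ k ∈ Finset.Icc a i, (G (δ k ω) - H (δ k ω))‖ ^ 2 ≤
            ((i + 1 - a : ℕ) : ℝ) * ∑ k ∈ Finset.Icc a i, K' ^ 2 * ‖δ k ω‖ ^ 4 := by
          calc _ ≤ (∑ k ∈ Finset.Icc a i, ‖G (δ k ω) - H (δ k ω)‖) ^ 2 := by
                gcongr
                exact norm_sum_le _ _
            _ ≤ ((Finset.Icc a i).card : ℝ) *
                  ∑ k ∈ Finset.Icc a i, ‖G (δ k ω) - H (δ k ω)‖ ^ 2 := sq_sum_le_card_mul_sum_sq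
            _ ≤ _ := by
                rw [Nat.card_Icc]
                gcongr with k
                calc ‖G (δ k ω) - H (δ k ω)‖ ^ 2 ≤ (K' * ‖δ k ω‖ ^ 2) ^ 2 := by
                      gcongr
                      exact hGH _
                  _ = _ := by ring
        rw [robbinsMonroRemainder]
        have h2 := norm_sub_le
          (∑ k ∈ Finset.Icc a i, (((k : ℝ) + 1) ^ α / η) • (δ k ω - δ (k + 1) ω))
          (∑ k ∈ Finset.Icc a i, (G (δ k ω) - H (δ k ω)))
        have h3 := pow_le_pow_left₀ (norm_nonneg _) h2 2
        have h4 := add_sq_le (a :=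
          ‖∑ k ∈ Finset.Icc a i, (((k : ℝ) + 1) ^ α / η) • (δ k ω - δ (k + 1) ω)‖)
          (b := ‖∑ k ∈ Finset.Icc a i, (G (δ k ω) - H (δ k ω))‖)
        linarith
    _ = 2 * ∫ ω, ‖∑ k ∈ Finset.Icc a i, (((k : ℝ) + 1) ^ α / η) • (δ k ω - δ (k + 1) ω)‖ ^ 2 ∂μ
          + 2 * (((i + 1 - a : ℕ) : ℝ) *
            ∑ k ∈ Finset.Icc a i, K' ^ 2 * ∫ ω, ‖δ k ω‖ ^ 4 ∂μ) := by
        rw [integral_add (iT.const_mul 2) (iS.const_mul 2), integral_const_mul,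
          integral_const_mul, integral_const_mul,
          integral_finsetSum _ fun k _ => (i4 k).const_mul _]
        simp_rw [integral_const_mul]
    _ ≤ 2 * (C * ((i : ℝ) + 1) ^ α) + 2 * (((i + 1 - a : ℕ) : ℝ) *
            ∑ k ∈ Finset.Icc a i, K' ^ 2 * (K * (((k : ℝ) + 1) ^ (-α)) ^ 2)) := by
        gcongr with k
        · exact hT a i hai
        · exact hδ k
    _ = 2 * C * ((i : ℝ) + 1) ^ α + 2 * (K' ^ 2 * K) * (((i + 1 - a : ℕ) : ℝ) *
            ∑ k ∈ Finset.Icc a i, (((k : ℝ) + 1) ^ (-α)) ^ 2) := by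
        simp_rw [← mul_assoc, ← Finset.mul_sum]
        ring
    _ ≤ _ := by
        have h1 : 0 ≤ K' ^ 2 * K := by positivity
        nlinarith [mul_nonneg hC.le hS0, mul_nonneg h1 hi0]

/-- The remainder of the sum up to `n` is `o(√n)` in mean; this is where `α > 1 / 2` enters. -/
lemma tendsto_integral_remainder_div_sqrt [IsProbabilityMeasure μ] [CompleteSpace E]
    (h : IsRobbinsMonro μ ℱ G H Q η α δ e) :
    Tendsto (fun n : ℕ => (√n)⁻¹ * ∫ ω, ‖robbinsMonroRemainder G H η α δ 1 n ω‖ ∂μ) atTop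
      (𝓝 0) := by
  obtain ⟨C, hC, hT⟩ := h.exists_integral_telescopingSum_le
  obtain ⟨K, hK, hδ⟩ := h.exists_integral_norm_sq_le
  obtain ⟨K', hGH⟩ := h.exists_sub_le
  have hα : 0 < α := by linarith [h.half_lt]
  have hα1 := h.lt_one
  have h1α : 0 < 1 - α := by linarith
  have hbound : ∀ᶠ n : ℕ in atTop,
      (√n)⁻¹ * ∫ ω, ‖robbinsMonroRemainder G H η α δ 1 n ω‖ ∂μ ≤
      √2 * (√(C * ((n : ℝ) + 1) ^ (-(1 - α)))
        + |K'| * K * (1 / (1 - α)) * ((n : ℝ) + 1) ^ (-(α - 1 / 2))) := by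
    filter_upwards [eventually_ge_atTop 1] with n hn
    have hn1 : (1 : ℝ) ≤ n := by exact_mod_cast hn
    have hn0 : (0 : ℝ) < (n : ℝ) + 1 := by positivity
    have iT := (h.memLp_telescopingSum 1 n)
    have i2 := fun k => h.integrable_norm_sq k
    have iS : Integrable (fun ω => ∑ k ∈ Finset.Icc 1 n, |K'| * ‖δ k ω‖ ^ 2) μ :=
      integrable_finsetSum _ fun k _ => (i2 k).const_mul _
    have b1 : ∫ ω, ‖robbinsMonroRemainder G H η α δ 1 n ω‖ ∂μ ≤
        √(C * ((n : ℝ) + 1) ^ α) + |K'| * K * (((n : ℝ) + 1) ^ (1 - α) / (1 - α)) := by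
      calc _ ≤ ∫ ω, (‖∑ k ∈ Finset.Icc 1 n, (((k : ℝ) + 1) ^ α / η) • (δ k ω - δ (k + 1) ω)‖
            + ∑ k ∈ Finset.Icc 1 n, |K'| * ‖δ k ω‖ ^ 2) ∂μ := by
            refine integral_mono_of_nonneg (ae_of_all _ fun ω => by positivity)
              ((iT.integrable (by norm_num)).norm.add iS) (ae_of_all _ fun ω => ?_)
            beta_reduce
            rw [robbinsMonroRemainder]
            refine (norm_sub_le _ _).trans ?_
            gcongr
            refine norm_sum_le_of_le _ fun k _ => (hGH _).trans ?_
            gcongr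
            exact le_abs_self K'
        _ = ∫ ω, ‖∑ k ∈ Finset.Icc 1 n, (((k : ℝ) + 1) ^ α / η) • (δ k ω - δ (k + 1) ω)‖ ∂μ
            + ∑ k ∈ Finset.Icc 1 n, |K'| * ∫ ω, ‖δ k ω‖ ^ 2 ∂μ := by
            rw [integral_add (iT.integrable (by norm_num)).norm iS,
              integral_finsetSum _ fun k _ => (i2 k).const_mul _]
            simp_rw [integral_const_mul]
        _ ≤ _ := by
            gcongr
            · have h1 := integral_abs_le_sqrt_integral_sq (iT.norm.mono_exponent (p := 2)
                (by norm_num))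
              simp only [abs_norm] at h1
              exact h1.trans (Real.sqrt_le_sqrt (hT 1 n hn))
            · calc ∑ k ∈ Finset.Icc 1 n, |K'| * ∫ ω, ‖δ k ω‖ ^ 2 ∂μ
                  ≤ ∑ k ∈ Finset.Icc 1 n, |K'| * (K * ((k : ℝ) + 1) ^ (-α)) := by
                    gcongr with k
                    exact hδ k
                _ ≤ ∑ k ∈ Finset.range (n + 1), |K'| * (K * ((k : ℝ) + 1) ^ (-α)) := by
                    refine Finset.sum_le_sum_of_subset_of_nonneg (fun k hk => ?_)
                      fun k _ _ => by positivity
                    rw [Finset.mem_Icc] at hk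
                    rw [Finset.mem_range]
                    omega
                _ = |K'| * K * ∑ k ∈ Finset.range (n + 1), ((k : ℝ) + 1) ^ (-α) := by
                    simp_rw [← mul_assoc, ← Finset.mul_sum]
                _ ≤ _ := by
                    have := sum_add_one_rpow_neg_le hα hα1 (n + 1)
                    push_cast at this
                    gcongr
    have b2 : (√n)⁻¹ ≤ √2 * (√((n : ℝ) + 1))⁻¹ := by
      rw [← div_eq_mul_inv, inv_eq_one_div, div_le_div_iff₀ (by positivity) (by positivity),
        one_mul, ← Real.sqrt_mul (by norm_num)]
      exact Real.sqrt_le_sqrt (by linarith)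
    calc _ ≤ (√2 * (√((n : ℝ) + 1))⁻¹) *
          (√(C * ((n : ℝ) + 1) ^ α) + |K'| * K * (((n : ℝ) + 1) ^ (1 - α) / (1 - α))) := by
          gcongr
      _ = √2 * ((√((n : ℝ) + 1))⁻¹ * √(C * ((n : ℝ) + 1) ^ α)
          + |K'| * K * (1 / (1 - α)) * ((√((n : ℝ) + 1))⁻¹ * ((n : ℝ) + 1) ^ (1 - α))) := by ring
      _ = _ := by
          congr 3
          · rw [← Real.sqrt_inv, ← Real.sqrt_mul (by positivity), mul_left_comm,
              ← Real.rpow_neg_one, ← Real.rpow_add hn0]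
            congr 3
            ring
          · rw [Real.sqrt_eq_rpow, ← Real.rpow_neg hn0.le, ← Real.rpow_add hn0]
            congr 1
            ring
  refine squeeze_zero' (.of_forall fun n => mul_nonneg (by positivity)
    (integral_nonneg fun ω => norm_nonneg _)) hbound ?_
  have l1 := ((tendsto_add_one_rpow_neg h1α).const_mul C).sqrt
  have l2 := (tendsto_add_one_rpow_neg (a := α - 1 / 2) (by linarith [h.half_lt])).const_mul
    (|K'| * K * (1 / (1 - α)))
  simpa using (l1.add l2).const_mul √2

open Complex in
/-- The central limit theorem for the averaged iterates, in terms of characteristic functions. -/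
theorem tendsto_integral_exp_average [IsProbabilityMeasure μ] [CompleteSpace E]
    (h : IsRobbinsMonro μ ℱ G H Q η α δ e) {p : E} (hQ : 0 ≤ Q p) :
    Tendsto (fun n : ℕ => ∫ ω, exp (((√n)⁻¹ * inner ℝ p (H (∑ k ∈ Finset.Icc 1 n, δ k ω)) : ℝ) * I)
      ∂μ) atTop (𝓝 (exp (-(Q p / 2 : ℝ)))) := by
  obtain ⟨M, hM⟩ := h.exists_isMartingaleDifference p
  have hM3 : ∀ n, ∫ ω, |inner ℝ p (e (n + 1) ω)| ^ 3 ∂μ ≤ 1 + M := fun n => by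
    have i4 := integrable_norm_pow_of_memLp_four (hM.memLp (n + 1)) (a := 4) le_rfl
    calc _ ≤ ∫ ω, (1 + ‖inner ℝ p (e (n + 1) ω)‖ ^ 4) ∂μ := by
          refine integral_mono (integrable_norm_pow_of_memLp_four (hM.memLp (n + 1)) (a := 3)
            (by norm_num)) ((integrable_const 1).add i4) fun ω => ?_
          change |inner ℝ p (e (n + 1) ω)| ^ 3 ≤ 1 + |inner ℝ p (e (n + 1) ω)| ^ 4
          nlinarith [sq_nonneg (|inner ℝ p (e (n + 1) ω)| ^ 2 - |inner ℝ p (e (n + 1) ω)| / 2),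
            sq_nonneg (|inner ℝ p (e (n + 1) ω)| / 2 - 1),
            sq_nonneg (|inner ℝ p (e (n + 1) ω)| ^ 2 - 1)]
      _ = 1 + ∫ ω, inner ℝ p (e (n + 1) ω) ^ 4 ∂μ := by
          rw [integral_add (integrable_const 1) i4]
          simp [Even.pow_abs (by decide : Even 4)]
      _ ≤ _ := by
          gcongr
          exact hM.integral_le (n + 1)
  -- the noise that enters `∑_{1 ≤ k ≤ n} δ_k` starts with `e 1`, so time is shifted by one
  let ℱ' : Filtration ℕ mΩ :=
    ⟨fun n => ℱ (n + 1), fun _ _ hij => ℱ.mono (Nat.succ_le_succ hij), fun n => ℱ.le _⟩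
  have hclt := tendsto_integral_exp_martingale_sum ℱ'
    (X := fun n ω => inner ℝ p (e (n + 1) ω)) (fun n => hM.stronglyMeasurable (n + 1))
    (fun n => hM.memLp (n + 1)) (fun n => hM.condExp (n + 1)) hQ hM3
    ((h.tendsto_integral_abs_condExp_sub p).comp (tendsto_add_atTop_nat 1))
  have hdiff : Tendsto (fun n : ℕ =>
      ∫ ω, exp (((√n)⁻¹ * inner ℝ p (H (∑ k ∈ Finset.Icc 1 n, δ k ω)) : ℝ) * I) ∂μ
      - ∫ ω, exp (((√n)⁻¹ * ∑ k ∈ Finset.range n, inner ℝ p (e (k + 1) ω) : ℝ) * I) ∂μ) atTop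
      (𝓝 0) := by
    refine squeeze_zero_norm (a := fun n : ℕ => ‖p‖ *
      ((√n)⁻¹ * ∫ ω, ‖robbinsMonroRemainder G H η α δ 1 n ω‖ ∂μ)) (fun n => ?_)
      (by simpa using h.tendsto_integral_remainder_div_sqrt.const_mul ‖p‖)
    have hm1 : AEStronglyMeasurable (fun ω => (√n)⁻¹ *
        (inner ℝ p (H (∑ k ∈ Finset.Icc 1 n, δ k ω)) : ℝ)) μ := by
      have h1 : AEStronglyMeasurable (fun ω => ∑ k ∈ Finset.Icc 1 n, δ k ω) μ :=
        Finset.aestronglyMeasurable_fun_sum _ fun k _ => (h.memLp k).1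
      exact ((H.continuous.comp_aestronglyMeasurable h1).const_inner).const_mul _
    have hm2 : AEStronglyMeasurable (fun ω => (√n)⁻¹ *
        ∑ k ∈ Finset.range n, (inner ℝ p (e (k + 1) ω) : ℝ)) μ :=
      (Finset.aestronglyMeasurable_fun_sum _ fun k _ => (hM.memLp (k + 1)).1).const_mul _
    have hi : ∀ {Y : Ω → ℝ}, AEStronglyMeasurable Y μ →
        Integrable (fun ω => exp ((Y ω : ℝ) * I)) μ := fun {Y} hY => by
      have hc : Continuous fun x : ℝ => exp ((x : ℝ) * I) := by fun_prop
      exact Integrable.of_bound (hc.comp_aestronglyMeasurable hY) 1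
        (ae_of_all _ fun ω => (norm_exp_ofReal_mul_I _).le)
    rw [← integral_sub (hi hm1) (hi hm2), ← mul_assoc, ← integral_const_mul]
    refine norm_integral_le_of_norm_le
      (((h.memLp_remainder 1 n).integrable (by norm_num)).norm.const_mul _)
      (ae_of_all _ fun ω => ?_)
    rw [h.map_sum_eq, inner_add_right, inner_sum, Finset.sum_Icc_one_eq_sum_range
      (fun k => (inner ℝ p (e k ω) : ℝ)), mul_add]
    set x := (√n)⁻¹ * ∑ k ∈ Finset.range n, (inner ℝ p (e (k + 1) ω) : ℝ)
    set y : ℝ := (√n)⁻¹ * inner ℝ p (robbinsMonroRemainder G H η α δ 1 n ω) with hy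
    have e1 : exp ((x + y : ℝ) * I) - exp ((x : ℝ) * I) =
        exp ((x : ℝ) * I) * (exp (I * (y : ℝ)) - 1) := by
      rw [mul_sub, ← Complex.exp_add, mul_one]
      congr 2
      push_cast
      ring
    rw [e1, norm_mul, norm_exp_ofReal_mul_I, one_mul]
    refine Real.norm_exp_I_mul_ofReal_sub_one_le.trans ?_
    rw [hy, norm_mul, Real.norm_of_nonneg (by positivity), mul_comm ‖p‖, mul_assoc]
    gcongr
    exact norm_inner_le_norm _ _
  simpa using hdiff.add hclt

end IsRobbinsMonro

end AveragedIterates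

/-! ### Stochastic approximation: the batch-means estimator -/

section BatchMeansEstimator

variable {Ω : Type*} {mΩ : MeasurableSpace Ω} {E : Type*} [NormedAddCommGroup E]
  [InnerProductSpace ℝ E]

/-- Convergence in mean is inherited by a perturbation `Z` of `F` whose error is controlled, up to
an arbitrarily small multiple of `F`, by a null sequence. -/
lemma tendsto_integral_abs_sub_of_perturbation {μ : Measure Ω} [IsProbabilityMeasure μ]
    {F P Z : ℕ → Ω → ℝ} {c : ℝ} (hF : ∀ n, Integrable (F n) μ) (hP : ∀ n, Integrable (P n) μ)
    (hZ : ∀ ε : ℝ, 0 < ε → ∀ᶠ n in atTop, ∀ ω, |Z n ω - F n ω| ≤ ε * F n ω + (1 + ε⁻¹) * P n ω)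
    (hFc : Tendsto (fun n => ∫ ω, |F n ω - c| ∂μ) atTop (𝓝 0))
    (hP0 : Tendsto (fun n => ∫ ω, P n ω ∂μ) atTop (𝓝 0)) :
    Tendsto (fun n => ∫ ω, |Z n ω - c| ∂μ) atTop (𝓝 0) := by
  have hnn : ∀ n, 0 ≤ ∫ ω, |Z n ω - c| ∂μ := fun n => integral_nonneg fun ω => abs_nonneg _
  rw [Metric.tendsto_nhds]
  intro κ hκ
  set ε : ℝ := κ / (2 * (|c| + 1)) with hε
  have hε0 : 0 < ε := by positivity
  have hεc : ε * |c| < κ := by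
    rw [hε, div_mul_eq_mul_div, div_lt_iff₀ (by positivity)]
    nlinarith [abs_nonneg c]
  have hlim : Tendsto (fun n => (1 + ε) * ∫ ω, |F n ω - c| ∂μ + ε * |c|
      + (1 + ε⁻¹) * ∫ ω, P n ω ∂μ) atTop (𝓝 ((1 + ε) * 0 + ε * |c| + (1 + ε⁻¹) * 0)) :=
    ((hFc.const_mul _).add_const _).add (hP0.const_mul _)
  filter_upwards [hZ ε hε0, hlim.eventually_lt_const (u := κ) (by simpa using hεc)] with n h1 h2
  rw [Real.dist_eq, sub_zero, abs_of_nonneg (hnn n)]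
  refine lt_of_le_of_lt ?_ h2
  have iF : Integrable (fun ω => |F n ω - c|) μ := ((hF n).sub (integrable_const c)).abs
  calc ∫ ω, |Z n ω - c| ∂μ
      ≤ ∫ ω, ((1 + ε) * |F n ω - c| + ε * |c| + (1 + ε⁻¹) * P n ω) ∂μ := by
        refine integral_mono_of_nonneg (ae_of_all _ fun ω => abs_nonneg _)
          (((iF.const_mul _).add (integrable_const _)).add ((hP n).const_mul _))
          (ae_of_all _ fun ω => ?_)
        change |Z n ω - c| ≤ (1 + ε) * |F n ω - c| + ε * |c| + (1 + ε⁻¹) * P n ω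
        have h3 := abs_sub_le (Z n ω) (F n ω) c
        have h4 : F n ω ≤ |F n ω - c| + |c| := by
          have := le_abs_self (F n ω - c)
          have := le_abs_self c
          linarith
        have h5 := mul_le_mul_of_nonneg_left h4 hε0.le
        linarith [h1 ω]
    _ = _ := by
        rw [integral_add ((iF.const_mul _).fun_add (integrable_const _)) ((hP n).const_mul _),
          integral_add (iF.const_mul _) (integrable_const _), integral_const_mul,
          integral_const_mul (1 + ε⁻¹)]
        simp

lemma abs_add_sq_sub_sq_le (x y : ℝ) {ε : ℝ} (hε : 0 < ε) :
    |(x + y) ^ 2 - x ^ 2| ≤ ε * x ^ 2 + (1 + ε⁻¹) * y ^ 2 := by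
  have h1 : 0 ≤ ε⁻¹ * (ε * x - y) ^ 2 := by positivity
  have h2 : 0 ≤ ε⁻¹ * (ε * x + y) ^ 2 := by positivity
  have e1 : ε⁻¹ * (ε * x - y) ^ 2 = ε * x ^ 2 - 2 * x * y + ε⁻¹ * y ^ 2 := by
    field_simp
    ring
  have e2 : ε⁻¹ * (ε * x + y) ^ 2 = ε * x ^ 2 + 2 * x * y + ε⁻¹ * y ^ 2 := by
    field_simp
    ring
  rw [abs_le]
  constructor <;> nlinarith [sq_nonneg y]

variable {μ : Measure Ω} {ℱ : Filtration ℕ mΩ} {G : E → E} {H : E →L[ℝ] E}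
  {Q : E → ℝ} {η α : ℝ} {δ e : ℕ → Ω → E}

namespace IsRobbinsMonro

lemma summable_sq_rpow (h : IsRobbinsMonro μ ℱ G H Q η α δ e) :
    Summable fun k : ℕ => (((k : ℝ) + 1) ^ (-α)) ^ 2 := by
  have h1 : Summable fun k : ℕ => ((k : ℝ)) ^ (-(2 * α)) :=
    Real.summable_nat_rpow.2 (by linarith [h.half_lt])
  have h2 := (summable_nat_add_iff 1).2 h1
  refine h2.congr fun k => ?_
  rw [← Real.rpow_natCast, ← Real.rpow_mul (by positivity)]
  push_cast
  congr 1
  ring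

lemma memLp_map_sum (h : IsRobbinsMonro μ ℱ G H Q η α δ e) (p : E) (s : Finset ℕ) :
    MemLp (fun ω => inner ℝ p (H (∑ k ∈ s, δ k ω))) 4 μ :=
  (H.comp_memLp' (memLp_finsetSum s fun k _ => h.memLp k)).const_inner p

/-- `E⟪p, H (x̄_n - x*)⟫ ^ 2 = O(1 / n)`. -/
lemma exists_integral_map_sum_sq_le [IsProbabilityMeasure μ] [CompleteSpace E]
    (h : IsRobbinsMonro μ ℱ G H Q η α δ e) (p : E) :
    ∃ C, 0 < C ∧ ∀ n : ℕ, 1 ≤ n →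
      ∫ ω, inner ℝ p (H (∑ k ∈ Finset.Icc 1 n, δ k ω)) ^ 2 ∂μ ≤ C * n := by
  obtain ⟨M, hM⟩ := h.exists_isMartingaleDifference p
  obtain ⟨C, hC, hrem⟩ := h.exists_integral_remainder_sq_le
  have hM0 := hM.nonneg
  set S := ∑' k : ℕ, (((k : ℝ) + 1) ^ (-α)) ^ 2 with hS
  have hS0 : 0 ≤ S := tsum_nonneg fun k => by positivity
  refine ⟨(16 * M + 1) + 2 * (‖p‖ ^ 2 * (C * (2 + S))), by positivity, fun n hn => ?_⟩
  have hn1 : (1 : ℝ) ≤ n := by exact_mod_cast hn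
  have hn0 : (0 : ℝ) < n := by linarith
  have hWm := hM.memLp_sum (Finset.Icc 1 n)
  have iW : Integrable (fun ω => (∑ k ∈ Finset.Icc 1 n, (inner ℝ p (e k ω) : ℝ)) ^ 2) μ := by
    simpa using integrable_norm_pow_of_memLp_four hWm (a := 2) (by norm_num)
  have iR := integrable_norm_pow_of_memLp_four (h.memLp_remainder 1 n) (a := 2) (by norm_num)
  have b1 : ∫ ω, (∑ k ∈ Finset.Icc 1 n, (inner ℝ p (e k ω) : ℝ)) ^ 2 ∂μ ≤
      (16 * M + 1) / 2 * n := by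
    have h1 := hM.integral_sum_pow_four_le 1 n
    rw [add_comm 1 n, Finset.Ico_add_one_right_eq_Icc] at h1
    have h2 := integral_sq_mul_sq_le (μ := μ) hWm
      (memLp_const (1 : ℝ) : MemLp (fun _ => (1 : ℝ)) 4 μ) (c := (n : ℝ)⁻¹) (by positivity)
    simp only [one_pow, mul_one, inv_inv, integral_const, probReal_univ, smul_eq_mul] at h2
    have h3 : (n : ℝ)⁻¹ * ∫ ω, (∑ k ∈ Finset.Icc 1 n, (inner ℝ p (e k ω) : ℝ)) ^ 4 ∂μ ≤
        16 * M * n := by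
      rw [inv_mul_le_iff₀ hn0]
      calc _ ≤ 16 * M * (n : ℝ) ^ 2 := h1
        _ = _ := by ring
    linarith
  have b2 : ∫ ω, ‖robbinsMonroRemainder G H η α δ 1 n ω‖ ^ 2 ∂μ ≤ C * (2 + S) * n := by
    refine (hrem 1 n hn).trans ?_
    have h1 : ((n : ℝ) + 1) ^ α ≤ 2 * n := by
      calc ((n : ℝ) + 1) ^ α ≤ ((n : ℝ) + 1) ^ (1 : ℝ) :=
            Real.rpow_le_rpow_of_exponent_le (by linarith) h.lt_one.le
        _ ≤ _ := by
            rw [Real.rpow_one]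
            linarith
    have h2 : ∑ k ∈ Finset.Icc 1 n, (((k : ℝ) + 1) ^ (-α)) ^ 2 ≤ S :=
      h.summable_sq_rpow.sum_le_tsum _ fun k _ => by positivity
    rw [Nat.add_sub_cancel, mul_assoc]
    gcongr
    rw [add_mul, mul_comm S]
    gcongr
  calc _ ≤ ∫ ω, (2 * (∑ k ∈ Finset.Icc 1 n, (inner ℝ p (e k ω) : ℝ)) ^ 2
        + 2 * (‖p‖ ^ 2 * ‖robbinsMonroRemainder G H η α δ 1 n ω‖ ^ 2)) ∂μ := by
        refine integral_mono_of_nonneg (ae_of_all _ fun ω => sq_nonneg _)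
          ((iW.const_mul 2).add ((iR.const_mul _).const_mul 2)) (ae_of_all _ fun ω => ?_)
        beta_reduce
        rw [h.map_sum_eq, inner_add_right, inner_sum]
        have h1 := real_inner_mul_inner_self_le p (robbinsMonroRemainder G H η α δ 1 n ω)
        rw [real_inner_self_eq_norm_sq, real_inner_self_eq_norm_sq] at h1
        have h2 := add_sq_le (a := ∑ k ∈ Finset.Icc 1 n, (inner ℝ p (e k ω) : ℝ))
          (b := inner ℝ p (robbinsMonroRemainder G H η α δ 1 n ω))
        linarith
    _ = 2 * ∫ ω, (∑ k ∈ Finset.Icc 1 n, (inner ℝ p (e k ω) : ℝ)) ^ 2 ∂μ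
        + 2 * (‖p‖ ^ 2 * ∫ ω, ‖robbinsMonroRemainder G H η α δ 1 n ω‖ ^ 2 ∂μ) := by
        rw [integral_add (iW.const_mul 2) ((iR.const_mul _).const_mul 2), integral_const_mul,
          integral_const_mul, integral_const_mul]
    _ ≤ 2 * ((16 * M + 1) / 2 * n) + 2 * (‖p‖ ^ 2 * (C * (2 + S) * n)) := by gcongr
    _ = _ := by ring

variable {t : ℕ → ℕ} {L : ℕ → ℝ}

/-- The accumulated linearization errors within a batch are negligible, because
`∑ (k + 1) ^ (-2 α)` converges. -/
lemma batch_sum_isLittleO (h : IsRobbinsMonro μ ℱ G H Q η α δ e) (ht : IsBatching t) :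
    (fun i : ℕ => ((i + 1 - t i : ℕ) : ℝ) *
      ∑ k ∈ Finset.Icc (t i) i, (((k : ℝ) + 1) ^ (-α)) ^ 2) =o[atTop]
      fun i => ((i + 1 - t i : ℕ) : ℝ) := by
  have hg : Tendsto (fun i => ∑ k ∈ Finset.Icc (t i) i, (((k : ℝ) + 1) ^ (-α)) ^ 2) atTop
      (𝓝 0) := by
    refine squeeze_zero (fun i => Finset.sum_nonneg fun k _ => by positivity) (fun i => ?_)
      ((tendsto_sum_nat_add fun k : ℕ => (((k : ℝ) + 1) ^ (-α)) ^ 2).comp ht.tendsto)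
    have hsm := (summable_nat_add_iff (t i)).2 h.summable_sq_rpow
    have e1 : ∑ k ∈ Finset.Icc (t i) i, (((k : ℝ) + 1) ^ (-α)) ^ 2 =
        ∑ k ∈ Finset.range (i + 1 - t i), ((((k + t i : ℕ) : ℝ) + 1) ^ (-α)) ^ 2 := by
      rw [← Finset.Ico_add_one_right_eq_Icc, Finset.sum_Ico_eq_sum_range]
      exact Finset.sum_congr rfl fun k _ => by rw [add_comm (t i) k]
    rw [e1]
    exact hsm.sum_le_tsum _ fun k _ => by positivity
  have := (Asymptotics.isBigO_refl (fun i : ℕ => ((i + 1 - t i : ℕ) : ℝ))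
    atTop).mul_isLittleO ((Asymptotics.isLittleO_one_iff ℝ).2 hg)
  exact this.congr_right fun i => mul_one _

/-- The batch-means estimator, normalized by the linearization `H`, is consistent in mean in every
direction. -/
theorem tendsto_integral_abs_batchMeans_sub [IsProbabilityMeasure μ] [CompleteSpace E]
    (h : IsRobbinsMonro μ ℱ G H Q η α δ e) (p : E) (ht : IsBatching t) (hL0 : ∀ n, 0 ≤ L n)
    (hL : ∀ n, ∀ i ∈ Finset.Icc 1 n, ((i + 1 - t i : ℕ) : ℝ) ≤ L n)
    (hLT : Tendsto (fun n => L n ^ 2 / ∑ i ∈ Finset.Icc 1 n, ((i + 1 - t i : ℕ) : ℝ)) atTop (𝓝 0))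
    (hαT : Tendsto (fun n : ℕ => (∑ i ∈ Finset.Icc 1 n, ((i : ℝ) + 1) ^ α) /
      ∑ i ∈ Finset.Icc 1 n, ((i + 1 - t i : ℕ) : ℝ)) atTop (𝓝 0)) :
    Tendsto (fun n : ℕ => ∫ ω, |(∑ i ∈ Finset.Icc 1 n, ((i + 1 - t i : ℕ) : ℝ))⁻¹ *
      ∑ i ∈ Finset.Icc 1 n, inner ℝ p (H (∑ k ∈ Finset.Icc (t i) i, δ k ω
        - ((i + 1 - t i : ℕ) : ℝ) • ((n : ℝ)⁻¹ • ∑ k ∈ Finset.Icc 1 n, δ k ω))) ^ 2 - Q p| ∂μ)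
      atTop (𝓝 0) := by
  set T : ℕ → ℝ := fun n => ∑ i ∈ Finset.Icc 1 n, ((i + 1 - t i : ℕ) : ℝ) with hT
  obtain ⟨M, hM⟩ := h.exists_isMartingaleDifference p
  obtain ⟨C, hC, hrem⟩ := h.exists_integral_remainder_sq_le
  obtain ⟨C', hC', hsum⟩ := h.exists_integral_map_sum_sq_le p
  set W : ℕ → Ω → ℝ := fun i ω => ∑ k ∈ Finset.Icc (t i) i, inner ℝ p (e k ω) with hW
  -- The error made in replacing a centred batch sum of the iterates by the batch sum of the noise.
  set ρ : ℕ → ℕ → Ω → ℝ := fun n i ω => inner ℝ p (robbinsMonroRemainder G H η α δ (t i) i ω)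
    - ((i + 1 - t i : ℕ) : ℝ) * ((n : ℝ)⁻¹ * inner ℝ p (H (∑ k ∈ Finset.Icc 1 n, δ k ω)))
    with hρ
  have hT0 : ∀ n, 0 ≤ T n := fun n => Finset.sum_nonneg fun i _ => Nat.cast_nonneg _
  have hWm : ∀ i, MemLp (W i) 4 μ := fun i => hM.memLp_sum _
  have hρm : ∀ n i, MemLp (ρ n i) 4 μ := fun n i =>
    ((h.memLp_remainder (t i) i).const_inner p).sub (((h.memLp_map_sum p _).const_mul _).const_mul _)
  have isq : ∀ {f : Ω → ℝ}, MemLp f 4 μ → Integrable (fun ω => f ω ^ 2) μ := fun hf => by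
    simpa using integrable_norm_pow_of_memLp_four hf (a := 2) (by norm_num)
  have hsplit : ∀ (n i : ℕ) (ω : Ω), inner ℝ p (H (∑ k ∈ Finset.Icc (t i) i, δ k ω
        - ((i + 1 - t i : ℕ) : ℝ) • ((n : ℝ)⁻¹ • ∑ k ∈ Finset.Icc 1 n, δ k ω))) =
      W i ω + ρ n i ω := by
    intro n i ω
    simp only [hW, hρ]
    rw [map_sub, map_smul, map_smul, h.map_sum_eq (t i) i, inner_sub_right, inner_add_right,
      inner_smul_right, inner_smul_right, inner_sum, add_sub_assoc]
  simp_rw [hsplit]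
  -- the mean square of the perturbation
  have hρle : ∀ n i : ℕ, 1 ≤ n → ∫ ω, ρ n i ω ^ 2 ∂μ ≤ 2 * ‖p‖ ^ 2 * C * ((i : ℝ) + 1) ^ α
      + 2 * ‖p‖ ^ 2 * C * (((i + 1 - t i : ℕ) : ℝ) *
          ∑ k ∈ Finset.Icc (t i) i, (((k : ℝ) + 1) ^ (-α)) ^ 2)
      + 2 * C' * (((i + 1 - t i : ℕ) : ℝ) ^ 2 / n) := by
    intro n i hn
    have hn0 : (0 : ℝ) < n := by exact_mod_cast hn
    have iR := integrable_norm_pow_of_memLp_four (h.memLp_remainder (t i) i) (a := 2)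
      (by norm_num)
    have iA := isq (h.memLp_map_sum p (Finset.Icc 1 n))
    calc ∫ ω, ρ n i ω ^ 2 ∂μ
        ≤ ∫ ω, (2 * ‖p‖ ^ 2 * ‖robbinsMonroRemainder G H η α δ (t i) i ω‖ ^ 2
          + 2 * (((i + 1 - t i : ℕ) : ℝ) ^ 2 / (n : ℝ) ^ 2) *
            inner ℝ p (H (∑ k ∈ Finset.Icc 1 n, δ k ω)) ^ 2) ∂μ := by
          refine integral_mono (isq (hρm n i)) ((iR.const_mul _).add (iA.const_mul _)) fun ω => ?_
          simp only [hρ]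
          have h1 := real_inner_mul_inner_self_le p (robbinsMonroRemainder G H η α δ (t i) i ω)
          rw [real_inner_self_eq_norm_sq, real_inner_self_eq_norm_sq] at h1
          have h2 : ∀ x y l : ℝ, (x - l * ((n : ℝ)⁻¹ * y)) ^ 2 ≤
              2 * x ^ 2 + 2 * (l ^ 2 / (n : ℝ) ^ 2) * y ^ 2 := fun x y l => by
            have h3 := add_sq_le (a := x) (b := -(l * ((n : ℝ)⁻¹ * y)))
            calc _ = (x + -(l * ((n : ℝ)⁻¹ * y))) ^ 2 := by ring
              _ ≤ _ := h3
              _ = _ := by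
                field_simp
          refine (h2 _ _ _).trans ?_
          change _ ≤ 2 * ‖p‖ ^ 2 * ‖robbinsMonroRemainder G H η α δ (t i) i ω‖ ^ 2 + _
          gcongr ?_ + _
          linarith
      _ = 2 * ‖p‖ ^ 2 * ∫ ω, ‖robbinsMonroRemainder G H η α δ (t i) i ω‖ ^ 2 ∂μ
          + 2 * (((i + 1 - t i : ℕ) : ℝ) ^ 2 / (n : ℝ) ^ 2) *
            ∫ ω, inner ℝ p (H (∑ k ∈ Finset.Icc 1 n, δ k ω)) ^ 2 ∂μ := by
          rw [integral_add (iR.const_mul _) (iA.const_mul _), integral_const_mul,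
            integral_const_mul]
      _ ≤ 2 * ‖p‖ ^ 2 * (C * (((i : ℝ) + 1) ^ α + ((i + 1 - t i : ℕ) : ℝ) *
            ∑ k ∈ Finset.Icc (t i) i, (((k : ℝ) + 1) ^ (-α)) ^ 2))
          + 2 * (((i + 1 - t i : ℕ) : ℝ) ^ 2 / (n : ℝ) ^ 2) * (C' * n) := by
          gcongr
          · exact hrem _ _ (ht.le i)
          · exact hsum n hn
      _ = _ := by
          field_simp
  have hP0 : Tendsto (fun n => ∫ ω, (T n)⁻¹ * ∑ i ∈ Finset.Icc 1 n, ρ n i ω ^ 2 ∂μ) atTop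
      (𝓝 0) := by
    have hbound : ∀ᶠ n in atTop, ∫ ω, (T n)⁻¹ * ∑ i ∈ Finset.Icc 1 n, ρ n i ω ^ 2 ∂μ ≤
        2 * ‖p‖ ^ 2 * C * ((∑ i ∈ Finset.Icc 1 n, ((i : ℝ) + 1) ^ α) / T n)
        + 2 * ‖p‖ ^ 2 * C * ((∑ i ∈ Finset.Icc 1 n, ((i + 1 - t i : ℕ) : ℝ) *
          ∑ k ∈ Finset.Icc (t i) i, (((k : ℝ) + 1) ^ (-α)) ^ 2) / T n)
        + 2 * C' * (L n ^ 2 / T n) := by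
      filter_upwards [eventually_ge_atTop 1] with n hn
      have hn1 : (1 : ℝ) ≤ n := by exact_mod_cast hn
      have hTn : 0 < T n := lt_of_lt_of_le (by linarith) (ht.natCast_le_sum n)
      have hL1 : 1 ≤ L n := by
        have h1 := hL n 1 (Finset.mem_Icc.2 ⟨le_rfl, hn⟩)
        have h2 := ht.le 1
        have h3 : (1 : ℝ) ≤ ((1 + 1 - t 1 : ℕ) : ℝ) := by
          exact_mod_cast (by omega : 1 ≤ 1 + 1 - t 1)
        linarith
      have hTL : T n ≤ n * L n := by
        calc T n ≤ ∑ _i ∈ Finset.Icc 1 n, L n := Finset.sum_le_sum (hL n)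
          _ = _ := by simp
      rw [integral_const_mul, integral_finsetSum _ fun i _ => isq (hρm n i)]
      have h1 : ∑ i ∈ Finset.Icc 1 n, ∫ ω, ρ n i ω ^ 2 ∂μ ≤
          ∑ i ∈ Finset.Icc 1 n, (2 * ‖p‖ ^ 2 * C * ((i : ℝ) + 1) ^ α
      + 2 * ‖p‖ ^ 2 * C * (((i + 1 - t i : ℕ) : ℝ) *
          ∑ k ∈ Finset.Icc (t i) i, (((k : ℝ) + 1) ^ (-α)) ^ 2)
      + 2 * C' * (((i + 1 - t i : ℕ) : ℝ) ^ 2 / n)) := Finset.sum_le_sum fun i _ => hρle n i hn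
      rw [Finset.sum_add_distrib, Finset.sum_add_distrib, ← Finset.mul_sum, ← Finset.mul_sum,
        ← Finset.mul_sum, ← Finset.sum_div] at h1
      have h2 : (∑ i ∈ Finset.Icc 1 n, ((i + 1 - t i : ℕ) : ℝ) ^ 2) / n ≤ L n ^ 2 := by
        rw [div_le_iff₀ (by linarith)]
        calc ∑ i ∈ Finset.Icc 1 n, ((i + 1 - t i : ℕ) : ℝ) ^ 2
            ≤ ∑ _i ∈ Finset.Icc 1 n, L n ^ 2 := Finset.sum_le_sum fun i hi => by
              gcongr
              exact hL n i hi
          _ = _ := by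
              simp
              ring
      rw [inv_mul_le_iff₀ hTn]
      refine h1.trans ?_
      have e1 : T n * (2 * ‖p‖ ^ 2 * C * ((∑ i ∈ Finset.Icc 1 n, ((i : ℝ) + 1) ^ α) / T n)
        + 2 * ‖p‖ ^ 2 * C * ((∑ i ∈ Finset.Icc 1 n, ((i + 1 - t i : ℕ) : ℝ) *
          ∑ k ∈ Finset.Icc (t i) i, (((k : ℝ) + 1) ^ (-α)) ^ 2) / T n)
        + 2 * C' * (L n ^ 2 / T n)) =
          2 * ‖p‖ ^ 2 * C * (∑ i ∈ Finset.Icc 1 n, ((i : ℝ) + 1) ^ α)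
        + 2 * ‖p‖ ^ 2 * C * (∑ i ∈ Finset.Icc 1 n, ((i + 1 - t i : ℕ) : ℝ) *
          ∑ k ∈ Finset.Icc (t i) i, (((k : ℝ) + 1) ^ (-α)) ^ 2)
        + 2 * C' * L n ^ 2 := by
        have hcancel : ∀ a x : ℝ, T n * (a * (x / T n)) = a * x := fun a x => by
          rw [mul_left_comm, mul_div_cancel₀ _ hTn.ne']
        rw [mul_add, mul_add, hcancel, hcancel, hcancel]
      rw [e1]
      gcongr
    refine squeeze_zero' (.of_forall fun n => integral_nonneg fun ω => mul_nonneg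
      (inv_nonneg.2 (hT0 n)) (Finset.sum_nonneg fun i _ => sq_nonneg _)) hbound ?_
    have l2 := tendsto_sum_div_sum_of_isLittleO (h.batch_sum_isLittleO ht)
      (fun i => Nat.cast_nonneg _) ht.tendsto_sum
    simpa using ((hαT.const_mul (2 * ‖p‖ ^ 2 * C)).add (l2.const_mul (2 * ‖p‖ ^ 2 * C))).add
      (hLT.const_mul (2 * C'))
  refine tendsto_integral_abs_sub_of_perturbation
    (F := fun n ω => (T n)⁻¹ * ∑ i ∈ Finset.Icc 1 n, W i ω ^ 2)
    (fun n => (integrable_finsetSum _ fun i _ => isq (hWm i)).const_mul _)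
    (fun n => (integrable_finsetSum _ fun i _ => isq (hρm n i)).const_mul _)
    (fun ε hε => .of_forall fun n ω => ?_)
    (hM.tendsto_integral_abs_batchMeans_sub ht hL0 hL hLT (h.tendsto_integral_abs_condExp_sub p))
    hP0
  rw [← mul_sub, ← Finset.sum_sub_distrib, abs_mul, abs_of_nonneg (inv_nonneg.2 (hT0 n))]
  calc (T n)⁻¹ * |∑ i ∈ Finset.Icc 1 n, ((W i ω + ρ n i ω) ^ 2 - W i ω ^ 2)|
      ≤ (T n)⁻¹ * ∑ i ∈ Finset.Icc 1 n, (ε * W i ω ^ 2 + (1 + ε⁻¹) * ρ n i ω ^ 2) := by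
        have := hT0 n
        gcongr
        refine (Finset.abs_sum_le_sum_abs _ _).trans (Finset.sum_le_sum fun i _ => ?_)
        exact abs_add_sq_sub_sq_le _ _ hε
    _ = _ := by
        rw [Finset.sum_add_distrib, ← Finset.mul_sum, ← Finset.mul_sum]
        ring

end IsRobbinsMonro

end BatchMeansEstimator

/-! ### Batches with polynomially growing lengths -/

section PolynomialBatches

variable {a : ℕ → ℕ}

lemma le_of_strictMonoOn_of_one (ha_one : a 1 = 1) (ha : StrictMonoOn a (Set.Ici 1)) {m : ℕ}
    (hm : 1 ≤ m) : m ≤ a m := by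
  induction m, hm using Nat.le_induction with
  | base => exact ha_one.ge
  | succ m hm ih =>
    have := ha (a := m) (b := m + 1) hm (Set.mem_Ici.2 (by omega)) (by omega)
    omega

lemma exists_block (ha_one : a 1 = 1) (ha : StrictMonoOn a (Set.Ici 1)) {i : ℕ} (hi : 1 ≤ i) :
    ∃ m, 1 ≤ m ∧ a m ≤ i ∧ i < a (m + 1) := by
  induction i, hi using Nat.le_induction with
  | base =>
    refine ⟨1, le_rfl, ha_one.le, ?_⟩
    have := ha (a := 1) (b := 1 + 1) (Set.mem_Ici.2 le_rfl) (Set.mem_Ici.2 (by omega)) (by omega)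
    omega
  | succ i hi ih =>
    obtain ⟨m, hm, h1, h2⟩ := ih
    rcases Nat.lt_or_ge (i + 1) (a (m + 1)) with h | h
    · exact ⟨m, hm, by omega, h⟩
    · refine ⟨m + 1, by omega, h, ?_⟩
      have := ha (a := m + 1) (b := m + 1 + 1) (Set.mem_Ici.2 (by omega))
        (Set.mem_Ici.2 (by omega)) (by omega)
      omega

lemma batchStart_eq (ha : StrictMonoOn a (Set.Ici 1)) {m i : ℕ} (hm : 1 ≤ m) (h1 : a m ≤ i)
    (h2 : i < a (m + 1)) : batchStart a i = a m := by
  refine IsGreatest.csSup_eq ⟨⟨h1, m, hm, rfl⟩, ?_⟩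
  rintro s ⟨hs, j, hj, rfl⟩
  by_contra! hlt
  have hmj : m < j := (ha.lt_iff_lt hm hj).1 hlt
  have := ha.monotoneOn (Set.mem_Ici.2 (by omega : 1 ≤ m + 1)) hj hmj
  omega

lemma batchStart_zero (ha_one : a 1 = 1) (ha : StrictMonoOn a (Set.Ici 1)) :
    batchStart a 0 = 0 := by
  have : {s : ℕ | s ≤ 0 ∧ ∃ m, 1 ≤ m ∧ a m = s} = ∅ := by
    ext s
    simp only [Set.mem_ofPred_eq, Set.mem_empty_iff_false, iff_false, not_and, not_exists]
    intro hs m hm hms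
    have := le_of_strictMonoOn_of_one ha_one ha hm
    omega
  rw [batchStart, this, csSup_empty]
  rfl

lemma isBatching_batchStart (ha_one : a 1 = 1) (ha : StrictMonoOn a (Set.Ici 1)) :
    IsBatching (batchStart a) where
  le i := by
    rcases Nat.eq_zero_or_pos i with rfl | hi
    · rw [batchStart_zero ha_one ha]
    · obtain ⟨m, hm, h1, h2⟩ := exists_block ha_one ha hi
      rwa [batchStart_eq ha hm h1 h2]
  eq_of_mem i k h1 h2 := by
    rcases Nat.eq_zero_or_pos i with rfl | hi
    · rw [Nat.le_zero.1 h2]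
    · obtain ⟨m, hm, h3, h4⟩ := exists_block ha_one ha hi
      rw [batchStart_eq ha hm h3 h4] at h1 ⊢
      exact batchStart_eq ha hm h1 (by omega)
  tendsto := by
    refine tendsto_atTop.2 fun b => ?_
    filter_upwards [eventually_ge_atTop (a (b + 1))] with i hi
    have hb := le_of_strictMonoOn_of_one ha_one ha (m := b + 1) (by omega)
    obtain ⟨m, hm, h1, h2⟩ := exists_block ha_one ha (i := i) (by omega)
    rw [batchStart_eq ha hm h1 h2]
    have h3 : b + 1 < m + 1 :=
      (ha.lt_iff_lt (Set.mem_Ici.2 (by omega)) (Set.mem_Ici.2 (by omega))).1 (by omega)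
    have := le_of_strictMonoOn_of_one ha_one ha hm
    omega

lemma sq_le_two_mul_sum_range (d : ℕ) :
    (d : ℝ) ^ 2 ≤ 2 * ∑ j ∈ Finset.range d, ((j : ℝ) + 1) := by
  induction d with
  | zero => simp
  | succ d ih =>
    rw [Finset.sum_range_succ]
    push_cast
    nlinarith [Nat.cast_nonneg (α := ℝ) d]

/-- By the Cauchy–Schwarz inequality the total batch length is smallest, for a given number of
blocks, when the blocks have equal lengths. -/
lemma sq_le_mul_sum_batchLength (ha_one : a 1 = 1) (ha : StrictMonoOn a (Set.Ici 1)) {m : ℕ}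
    (hm : 1 ≤ m) :
    ((a m : ℝ) - 1) ^ 2 ≤ 2 * m * ∑ i ∈ Finset.Ico 1 (a m), (batchLength a i : ℝ) := by
  induction m, hm using Nat.le_induction with
  | base => simp [ha_one]
  | succ m hm ih =>
    have h1 := le_of_strictMonoOn_of_one ha_one ha hm
    have h2 := ha (a := m) (b := m + 1) hm (Set.mem_Ici.2 (by omega)) (by omega)
    set T := ∑ i ∈ Finset.Ico 1 (a m), (batchLength a i : ℝ) with hT
    obtain ⟨d, hd⟩ := Nat.exists_eq_add_of_lt h2
    have h3 : ∑ i ∈ Finset.Ico (a m) (a (m + 1)), (batchLength a i : ℝ) =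
        ∑ j ∈ Finset.range (d + 1), ((j : ℝ) + 1) := by
      rw [Finset.sum_Ico_eq_sum_range]
      rw [show a (m + 1) - a m = d + 1 by omega]
      refine Finset.sum_congr rfl fun j hj => ?_
      rw [Finset.mem_range] at hj
      rw [batchLength, batchStart_eq ha hm (by omega) (by omega),
        show a m + j + 1 - a m = j + 1 by omega]
      push_cast
      rfl
    rw [← Finset.sum_Ico_consecutive _ (by omega : 1 ≤ a m) h2.le, h3]
    have h4 := sq_le_two_mul_sum_range (d + 1)
    set D := ∑ j ∈ Finset.range (d + 1), ((j : ℝ) + 1)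
    rw [hd]
    push_cast at h4 ⊢
    set A := (a m : ℝ) - 1
    rw [show (a m : ℝ) + d + 1 - 1 = A + (d + 1) by simp only [A]; ring]
    have hm0 : (0 : ℝ) < m := by exact_mod_cast hm
    have h5 : A ^ 2 / m ≤ 2 * T := by
      rw [div_le_iff₀ hm0]
      linarith
    have h6 : 2 * A * (d + 1) ≤ A ^ 2 / m + m * ((d : ℝ) + 1) ^ 2 := by
      have : 0 ≤ (A - m * ((d : ℝ) + 1)) ^ 2 / m := by positivity
      have e : (A - m * ((d : ℝ) + 1)) ^ 2 / m =
          A ^ 2 / m + m * ((d : ℝ) + 1) ^ 2 - 2 * A * (d + 1) := by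
        field_simp
        ring
      linarith
    have h7 := mul_le_mul_of_nonneg_left h4 hm0.le
    linarith

lemma exists_forall_le_mul_of_eventually {f g : ℕ → ℝ} {K : ℝ} (hg : ∀ m, 1 ≤ m → 0 < g m)
    (h : ∀ᶠ m in atTop, f m ≤ K * g m) : ∃ K', 0 < K' ∧ ∀ m, 1 ≤ m → f m ≤ K' * g m := by
  obtain ⟨N, hN⟩ := eventually_atTop.1 h
  refine ⟨|K| + 1 + ∑ m ∈ Finset.range N, |f m / g m|, by positivity, fun m hm => ?_⟩
  have hgm := hg m hm
  have hS : 0 ≤ ∑ m ∈ Finset.range N, |f m / g m| := by positivity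
  rcases le_or_gt N m with hNm | hNm
  · refine (hN m hNm).trans ?_
    gcongr
    linarith [le_abs_self K]
  · rw [← div_le_iff₀ hgm]
    have h1 := Finset.single_le_sum (f := fun m => |f m / g m|) (fun m _ => abs_nonneg _)
      (Finset.mem_range.2 hNm)
    have h2 := le_abs_self (f m / g m)
    have h3 := abs_nonneg K
    linarith

lemma add_one_rpow_sub_rpow_le {β : ℝ} (hβ : 1 ≤ β) (k : ℕ) :
    ((k : ℝ) + 1) ^ β - (k : ℝ) ^ β ≤ β * ((k : ℝ) + 1) ^ (β - 1) := by
  have hn : (0 : ℝ) < (k : ℝ) + 1 := by positivity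
  have hle : (1 : ℝ) / ((k : ℝ) + 1) ≤ 1 := by
    rw [div_le_one hn]
    linarith [Nat.cast_nonneg (α := ℝ) k]
  have h2 := one_add_mul_self_le_rpow_one_add (s := -(1 / ((k : ℝ) + 1))) (by linarith) hβ
  have h3 : (k : ℝ) = ((k : ℝ) + 1) * (1 + -(1 / ((k : ℝ) + 1))) := by
    field_simp
    ring
  have h4 : (k : ℝ) ^ β = ((k : ℝ) + 1) ^ β * (1 + -(1 / ((k : ℝ) + 1))) ^ β := by
    rw [← Real.mul_rpow hn.le (by linarith), ← h3]
  have h5 : ((k : ℝ) + 1) ^ (β - 1) = ((k : ℝ) + 1) ^ β * (1 / ((k : ℝ) + 1)) := by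
    rw [mul_one_div, ← Real.rpow_sub_one hn.ne']
  rw [h4, h5]
  have h6 := mul_le_mul_of_nonneg_left h2 (by positivity : 0 ≤ ((k : ℝ) + 1) ^ β)
  linarith

variable {C β : ℝ}

lemma exists_block_bounds (hC : 0 < C) (hβ : 1 < β)
    (ha : ∀ᶠ k : ℕ in atTop, a k = ⌊C * (k : ℝ) ^ β⌋₊) :
    (∃ K, 0 < K ∧ ∀ m : ℕ, 1 ≤ m → (a (m + 1) : ℝ) - a m ≤ K * (m : ℝ) ^ (β - 1)) ∧
    (∃ K, 0 < K ∧ ∀ m : ℕ, 1 ≤ m → (a (m + 1) : ℝ) ≤ K * (m : ℝ) ^ β) ∧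
    (∃ κ, 0 < κ ∧ ∀ᶠ m : ℕ in atTop, κ * (m : ℝ) ^ β ≤ (a m : ℝ) - 1) := by
  have hup : ∀ᶠ k : ℕ in atTop, (a (k + 1) : ℝ) ≤ C * ((k : ℝ) + 1) ^ β := by
    filter_upwards [(tendsto_add_atTop_nat 1).eventually ha] with k hk
    rw [hk]
    refine (Nat.floor_le (by positivity)).trans (le_of_eq ?_)
    push_cast
    rfl
  have hlow : ∀ᶠ k : ℕ in atTop, C * (k : ℝ) ^ β - 1 ≤ (a k : ℝ) := by
    filter_upwards [ha] with k hk
    rw [hk]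
    linarith [Nat.lt_floor_add_one (C * (k : ℝ) ^ β)]
  have h2k : ∀ k : ℕ, 1 ≤ k → (k : ℝ) + 1 ≤ 2 * k := fun k hk => by
    have : (1 : ℝ) ≤ k := by exact_mod_cast hk
    linarith
  refine ⟨?_, ?_, ?_⟩
  · refine exists_forall_le_mul_of_eventually (K := C * (β * 2 ^ (β - 1)) + 1)
      (fun m hm => Real.rpow_pos_of_pos (by exact_mod_cast hm) _) ?_
    filter_upwards [hup, hlow, eventually_ge_atTop 1] with k h1 h2 hk
    have h3 := add_one_rpow_sub_rpow_le hβ.le k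
    have h4 : ((k : ℝ) + 1) ^ (β - 1) ≤ 2 ^ (β - 1) * (k : ℝ) ^ (β - 1) := by
      rw [← Real.mul_rpow (by norm_num) (by positivity)]
      exact Real.rpow_le_rpow (by positivity) (h2k k hk) (by linarith)
    have h5 : 1 ≤ (k : ℝ) ^ (β - 1) := Real.one_le_rpow (by exact_mod_cast hk) (by linarith)
    have h6 : C * (((k : ℝ) + 1) ^ β - (k : ℝ) ^ β) ≤
        C * (β * (2 ^ (β - 1) * (k : ℝ) ^ (β - 1))) := by
      refine mul_le_mul_of_nonneg_left (h3.trans ?_) hC.le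
      exact mul_le_mul_of_nonneg_left h4 (by linarith)
    linarith
  · refine exists_forall_le_mul_of_eventually (K := C * 2 ^ β)
      (fun m hm => Real.rpow_pos_of_pos (by exact_mod_cast hm) _) ?_
    filter_upwards [hup, eventually_ge_atTop 1] with k h1 hk
    refine h1.trans ?_
    rw [mul_assoc, ← Real.mul_rpow (by norm_num) (by positivity)]
    gcongr
    exact h2k k hk
  · refine ⟨C / 2, by positivity, ?_⟩
    have h1 : Tendsto (fun k : ℕ => (k : ℝ) ^ β) atTop atTop :=
      (tendsto_rpow_atTop (by linarith)).comp tendsto_natCast_atTop_atTop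
    filter_upwards [hlow, h1.eventually_ge_atTop (4 / C)] with k h2 h3
    rw [div_le_iff₀ hC] at h3
    linarith

/-- For block boundaries of order `k ^ β` with `β > 1 / (1 - α)`, the squared maximal batch length
and the sum of `i ^ α` are negligible against the total batch length. -/
lemma exists_batchLength_bounds {α : ℝ} (hα : 0 < α) (hα' : α < 1) (hC : 0 < C)
    (hβ : 1 / (1 - α) < β) (ha_one : a 1 = 1) (ha_mono : StrictMonoOn a (Set.Ici 1))
    (ha : ∀ᶠ k : ℕ in atTop, a k = ⌊C * (k : ℝ) ^ β⌋₊) :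
    ∃ L : ℕ → ℝ, (∀ n, 0 ≤ L n) ∧ (∀ n, ∀ i ∈ Finset.Icc 1 n, (batchLength a i : ℝ) ≤ L n) ∧
      Tendsto (fun n => L n ^ 2 / ∑ i ∈ Finset.Icc 1 n, (batchLength a i : ℝ)) atTop (𝓝 0) ∧
      Tendsto (fun n : ℕ => (∑ i ∈ Finset.Icc 1 n, ((i : ℝ) + 1) ^ α) /
        ∑ i ∈ Finset.Icc 1 n, (batchLength a i : ℝ)) atTop (𝓝 0) := by
  have h1α : 0 < 1 - α := by linarith
  have hβ' : 1 < β * (1 - α) := by rwa [div_lt_iff₀ h1α] at hβ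
  have hβ1 : 1 < β := by nlinarith
  obtain ⟨⟨K, hK, hd⟩, ⟨K', hK', hup⟩, ⟨κ, hκ, hlow⟩⟩ := exists_block_bounds hC hβ1 ha
  have hex : ∀ n : ℕ, ∃ m, 1 ≤ n → 1 ≤ m ∧ a m ≤ n ∧ n < a (m + 1) := fun n => by
    by_cases hn : 1 ≤ n
    · obtain ⟨m, hm⟩ := exists_block ha_one ha_mono hn
      exact ⟨m, fun _ => hm⟩
    · exact ⟨0, fun h => absurd h hn⟩
  -- `b n` is the index of the block that contains `n`.
  choose b hb using hex
  have hbt : Tendsto b atTop atTop := by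
    refine tendsto_atTop.2 fun M => ?_
    filter_upwards [eventually_ge_atTop (a (M + 1)), eventually_ge_atTop 1] with n hn hn1
    obtain ⟨h1, h2, h3⟩ := hb n hn1
    have := (ha_mono.lt_iff_lt (Set.mem_Ici.2 (by omega : 1 ≤ M + 1))
      (Set.mem_Ici.2 (by omega : 1 ≤ b n + 1))).1 (by omega)
    omega
  set T : ℕ → ℝ := fun n => ∑ i ∈ Finset.Icc 1 n, (batchLength a i : ℝ) with hT
  have hTlow : ∀ᶠ n in atTop, κ ^ 2 * (b n : ℝ) ^ (2 * β - 1) / 2 ≤ T n := by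
    filter_upwards [hbt.eventually hlow, eventually_ge_atTop 1] with n hn hn1
    obtain ⟨h1, h2, h3⟩ := hb n hn1
    have hb0 : (0 : ℝ) < b n := by exact_mod_cast h1
    have h4 := sq_le_mul_sum_batchLength ha_one ha_mono h1
    have h5 : ∑ i ∈ Finset.Ico 1 (a (b n)), (batchLength a i : ℝ) ≤ T n := by
      refine Finset.sum_le_sum_of_subset_of_nonneg (fun i hi => ?_) fun i _ _ => Nat.cast_nonneg _
      rw [Finset.mem_Ico] at hi
      rw [Finset.mem_Icc]
      omega
    have h6 : (κ * (b n : ℝ) ^ β) ^ 2 ≤ 2 * b n * T n := by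
      calc _ ≤ ((a (b n) : ℝ) - 1) ^ 2 := by gcongr
        _ ≤ _ := h4
        _ ≤ _ := by gcongr
    have h7 : (κ * (b n : ℝ) ^ β) ^ 2 = κ ^ 2 * (b n : ℝ) ^ (2 * β - 1) * b n := by
      rw [mul_pow, mul_assoc, ← Real.rpow_add_one hb0.ne', ← Real.rpow_natCast ((b n : ℝ) ^ β),
        ← Real.rpow_mul hb0.le]
      push_cast
      congr 2
      ring
    rw [h7] at h6
    have h8 := le_of_mul_le_mul_right (by linarith : κ ^ 2 * (b n : ℝ) ^ (2 * β - 1) * b n ≤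
      2 * T n * b n) hb0
    linarith
  -- the maximal batch length up to `n`
  set L : ℕ → ℝ := fun n => ((Finset.Icc 1 n).sup (batchLength a) : ℕ) with hLdef
  have hL : ∀ n, ∀ i ∈ Finset.Icc 1 n, (batchLength a i : ℝ) ≤ L n := fun n i hi => by
    exact Nat.cast_le.2 (Finset.le_sup (f := batchLength a) hi)
  have hLup : ∀ n, 1 ≤ n → L n ≤ K * (b n : ℝ) ^ (β - 1) := by
    intro n hn
    obtain ⟨i, hi, hmax⟩ := Finset.exists_mem_eq_sup (Finset.Icc 1 n)
      ⟨1, Finset.mem_Icc.2 ⟨le_rfl, hn⟩⟩ (batchLength a)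
    simp only [hLdef]
    rw [hmax]
    rw [Finset.mem_Icc] at hi
    obtain ⟨h1, h2, h3⟩ := hb i hi.1
    obtain ⟨h4, h5, h6⟩ := hb n hn
    have h7 : (batchLength a i : ℝ) ≤ (a (b i + 1) : ℝ) - a (b i) := by
      rw [batchLength, batchStart_eq ha_mono h1 h2 h3, le_sub_iff_add_le]
      exact_mod_cast (by omega : i + 1 - a (b i) + a (b i) ≤ a (b i + 1))
    refine h7.trans ((hd _ h1).trans ?_)
    have h8 : b i ≤ b n := by
      have := (ha_mono.lt_iff_lt h1 (Set.mem_Ici.2 (by omega : 1 ≤ b n + 1))).1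
        (by omega : a (b i) < a (b n + 1))
      omega
    gcongr
  refine ⟨L, fun n => Nat.cast_nonneg _, hL, ?_, ?_⟩
  · have hbound : ∀ᶠ n in atTop, L n ^ 2 / T n ≤ 2 * K ^ 2 / κ ^ 2 * (b n : ℝ) ^ (-(1 : ℝ)) := by
      filter_upwards [hTlow, eventually_ge_atTop 1] with n h1 hn
      have hb0 : (0 : ℝ) < b n := by exact_mod_cast (hb n hn).1
      have h2 : 0 < κ ^ 2 * (b n : ℝ) ^ (2 * β - 1) / 2 := by positivity
      have h3 : L n ^ 2 ≤ (K * (b n : ℝ) ^ (β - 1)) ^ 2 :=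
        pow_le_pow_left₀ (Nat.cast_nonneg _) (hLup n hn) 2
      calc L n ^ 2 / T n ≤ (K * (b n : ℝ) ^ (β - 1)) ^ 2 /
            (κ ^ 2 * (b n : ℝ) ^ (2 * β - 1) / 2) := by gcongr
        _ = 2 * K ^ 2 / κ ^ 2 * (((b n : ℝ) ^ (β - 1)) ^ 2 / (b n : ℝ) ^ (2 * β - 1)) := by
            field_simp
        _ = _ := by
            rw [← Real.rpow_natCast ((b n : ℝ) ^ (β - 1)), ← Real.rpow_mul hb0.le, ← Real.rpow_sub hb0]
            push_cast
            congr 2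
            ring
    refine squeeze_zero' (.of_forall fun n => div_nonneg (sq_nonneg _)
      (Finset.sum_nonneg fun i _ => Nat.cast_nonneg _)) hbound ?_
    have h1 : Tendsto (fun n => (b n : ℝ) ^ (-(1 : ℝ))) atTop (𝓝 0) :=
      (tendsto_rpow_neg_atTop one_pos).comp (tendsto_natCast_atTop_atTop.comp hbt)
    simpa using h1.const_mul (2 * K ^ 2 / κ ^ 2)
  · have hbound : ∀ᶠ n : ℕ in atTop, (∑ i ∈ Finset.Icc 1 n, ((i : ℝ) + 1) ^ α) / T n ≤
        2 * K' ^ (1 + α) / κ ^ 2 * (b n : ℝ) ^ (-(β * (1 - α) - 1)) := by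
      filter_upwards [hTlow, eventually_ge_atTop 1] with n h1 hn
      obtain ⟨hb1, _, hb3⟩ := hb n hn
      have hb0 : (0 : ℝ) < b n := by exact_mod_cast hb1
      have h2 : 0 < κ ^ 2 * (b n : ℝ) ^ (2 * β - 1) / 2 := by positivity
      have hn1 : (n : ℝ) + 1 ≤ K' * (b n : ℝ) ^ β := by
        refine le_trans ?_ (hup _ hb1)
        exact_mod_cast hb3
      have h3 : ∑ i ∈ Finset.Icc 1 n, ((i : ℝ) + 1) ^ α ≤ (K' * (b n : ℝ) ^ β) ^ (1 + α) := by
        calc ∑ i ∈ Finset.Icc 1 n, ((i : ℝ) + 1) ^ α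
            ≤ ∑ _i ∈ Finset.Icc 1 n, ((n : ℝ) + 1) ^ α := by
              gcongr with i hi
              exact (Finset.mem_Icc.1 hi).2
          _ = n * ((n : ℝ) + 1) ^ α := by simp
          _ ≤ ((n : ℝ) + 1) * ((n : ℝ) + 1) ^ α := by
              gcongr
              linarith
          _ = ((n : ℝ) + 1) ^ (1 + α) := by
              rw [Real.rpow_add (by positivity), Real.rpow_one]
          _ ≤ _ := Real.rpow_le_rpow (by positivity) hn1 (by linarith)
      calc (∑ i ∈ Finset.Icc 1 n, ((i : ℝ) + 1) ^ α) / T n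
          ≤ (K' * (b n : ℝ) ^ β) ^ (1 + α) / (κ ^ 2 * (b n : ℝ) ^ (2 * β - 1) / 2) := by gcongr
        _ = 2 * K' ^ (1 + α) / κ ^ 2 * (((b n : ℝ) ^ β) ^ (1 + α) /
              (b n : ℝ) ^ (2 * β - 1)) := by
            rw [Real.mul_rpow hK'.le (by positivity)]
            field_simp
        _ = _ := by
            rw [← Real.rpow_mul hb0.le, ← Real.rpow_sub hb0]
            congr 2
            ring
    refine squeeze_zero' (.of_forall fun n => div_nonneg
      (Finset.sum_nonneg fun i _ => by positivity)
      (Finset.sum_nonneg fun i _ => Nat.cast_nonneg _)) hbound ?_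
    have h1 : Tendsto (fun n => (b n : ℝ) ^ (-(β * (1 - α) - 1))) atTop (𝓝 0) :=
      (tendsto_rpow_neg_atTop (by linarith)).comp (tendsto_natCast_atTop_atTop.comp hbt)
    simpa using h1.const_mul (2 * K' ^ (1 + α) / κ ^ 2)

end PolynomialBatches

/-! ### Differentiation of the objective under the integral -/

section LossGradient

variable {d : ℕ} {Ξ : Type*} {f : EuclideanSpace ℝ (Fin d) → Ξ → ℝ}

lemma hasFDerivAt_loss (hf : ∀ z, ContDiff ℝ 1 fun x => f x z) (x : EuclideanSpace ℝ (Fin d))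
    (z : Ξ) :
    HasFDerivAt (fun y => f y z) (InnerProductSpace.toDual ℝ _ (lossGrad f x z)) x :=
  ((hf z).differentiable one_ne_zero x).hasGradientAt.hasFDerivAt

lemma continuous_lossGrad (hf : ∀ z, ContDiff ℝ 1 fun x => f x z) (z : Ξ) :
    Continuous fun x => lossGrad f x z := by
  have h := (hf z).continuous_fderiv one_ne_zero
  exact (InnerProductSpace.toDual ℝ (EuclideanSpace ℝ (Fin d))).symm.continuous.comp h

/-- A difference quotient of the loss is an average of directional derivatives. -/
lemma enorm_smul_loss_sub_le (hf : ∀ z, ContDiff ℝ 1 fun x => f x z)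
    (x v : EuclideanSpace ℝ (Fin d)) {r : ℝ} (hr : r ≠ 0) (z : Ξ) :
    ‖r • (f (x + r⁻¹ • v) z - f x z)‖ₑ ≤
      ∫⁻ s in Set.Ioc (0 : ℝ) 1, ‖lossGrad f (x + s • r⁻¹ • v) z‖ₑ * ‖v‖ₑ := by
  have hcont : Continuous fun s : ℝ => inner ℝ (lossGrad f (x + s • r⁻¹ • v) z) (r⁻¹ • v) := by
    have := continuous_lossGrad hf z
    fun_prop
  have h1 : f (x + r⁻¹ • v) z - f x z =
      ∫ s in (0 : ℝ)..1, inner ℝ (lossGrad f (x + s • r⁻¹ • v) z) (r⁻¹ • v) := by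
    rw [intervalIntegral.integral_eq_sub_of_hasDerivAt (f := fun s : ℝ => f (x + s • r⁻¹ • v) z)
      (fun s _ => ?_) (hcont.intervalIntegrable _ _)]
    · simp
    · have h2 : HasDerivAt (fun s : ℝ => x + s • r⁻¹ • v) (r⁻¹ • v) s := by
        simpa using ((hasDerivAt_id s).smul_const (r⁻¹ • v)).const_add x
      exact (hasFDerivAt_loss hf (x + s • r⁻¹ • v) z).comp_hasDerivAt s h2
  rw [h1, ← intervalIntegral.integral_smul, intervalIntegral.integral_of_le zero_le_one]
  refine (enorm_integral_le_lintegral_enorm _).trans (lintegral_mono fun s => ?_)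
  have h3 : r • inner ℝ (lossGrad f (x + s • r⁻¹ • v) z) (r⁻¹ • v) =
      inner ℝ (lossGrad f (x + s • r⁻¹ • v) z) v := by
    rw [inner_smul_right, smul_eq_mul, mul_inv_cancel_left₀ hr]
  rw [h3, ← ofReal_norm, ← ofReal_norm, ← ofReal_norm,
    ← ENNReal.ofReal_mul (norm_nonneg _)]
  exact ENNReal.ofReal_le_ofReal (norm_inner_le_norm _ _)

variable [MeasurableSpace Ξ] {P : Measure Ξ}

lemma measurable_lossGrad (hf : ∀ z, ContDiff ℝ 1 fun x => f x z)
    (hmeas : ∀ x, Measurable (f x)) (x : EuclideanSpace ℝ (Fin d)) :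
    Measurable (lossGrad f x) := by
  have h1 : ∀ v : EuclideanSpace ℝ (Fin d), Measurable fun z => inner ℝ (lossGrad f x z) v := by
    intro v
    have h2 : Tendsto (fun n : ℕ => fun z => ((n : ℝ) + 1) • (f (x + ((n : ℝ) + 1)⁻¹ • v) z - f x z))
        atTop (𝓝 fun z => inner ℝ (lossGrad f x z) v) := by
      rw [tendsto_pi_nhds]
      intro z
      have h3 := (hasFDerivAt_loss hf x z).lim v (c := fun n : ℕ => (n : ℝ) + 1) (l := atTop)
        (tendsto_norm_atTop_atTop.comp
          (tendsto_atTop_add_const_right _ _ tendsto_natCast_atTop_atTop))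
      simpa using h3
    exact measurable_of_tendsto_metrizable
      (fun n => by have h4 := hmeas (x + ((n : ℝ) + 1)⁻¹ • v); have h5 := hmeas x; fun_prop) h2
  have h2 : Measurable fun z => WithLp.toLp 2 fun i => lossGrad f x z i := by
    refine (WithLp.measurable_toLp 2 _).comp (measurable_pi_iff.2 fun i => ?_)
    have := h1 (EuclideanSpace.single i 1)
    simpa [EuclideanSpace.inner_single_right] using this
  exact h2

lemma measurable_uncurry_lossGrad (hf : ∀ z, ContDiff ℝ 1 fun x => f x z)
    (hmeas : ∀ x, Measurable (f x)) : Measurable (Function.uncurry (lossGrad f)) :=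
  measurable_uncurry_of_continuous_of_measurable (continuous_lossGrad hf)
    (measurable_lossGrad hf hmeas)

/-- The gradients at a point are integrable because they belong to a uniformly integrable family. -/
lemma memLp_one_lossGrad
    (hUI : ∀ x, ∃ U : Set (EuclideanSpace ℝ (Fin d)), U ∈ 𝓝 x ∧
      UniformIntegrable (fun (y : U) z => lossGrad f (y : EuclideanSpace ℝ (Fin d)) z) 1 P)
    (x : EuclideanSpace ℝ (Fin d)) : MemLp (lossGrad f x) 1 P := by
  obtain ⟨U, hU, hUI⟩ := hUI x
  exact hUI.memLp ⟨x, mem_of_mem_nhds hU⟩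

/-- Local uniform integrability of the gradients passes to the difference quotients, which are
averages of gradients along segments. -/
lemma unifIntegrable_difference_quotients [IsProbabilityMeasure P]
    (hf : ∀ z, ContDiff ℝ 1 fun x => f x z) (hmeas : ∀ x, Measurable (f x))
    {x v : EuclideanSpace ℝ (Fin d)} {U : Set (EuclideanSpace ℝ (Fin d))}
    (hUI : UniformIntegrable (fun (y : U) z => lossGrad f (y : EuclideanSpace ℝ (Fin d)) z) 1 P)
    {r : ℕ → ℝ} (hr : ∀ n, r n ≠ 0)
    (hU : ∀ n, ∀ s ∈ Set.Ioc (0 : ℝ) 1, x + s • (r n)⁻¹ • v ∈ U) :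
    UnifIntegrable (fun n z => r n • (f (x + (r n)⁻¹ • v) z - f x z)) 1 P := by
  intro ε hε
  obtain ⟨δ, hδ, h⟩ := hUI.2.1 (ε := ε / (‖v‖ + 1)) (by positivity)
  refine ⟨δ, hδ, fun n s hs hPs => ?_⟩
  have hm : Measurable (Function.uncurry fun (z : Ξ) (t : ℝ) =>
      ‖lossGrad f (x + t • (r n)⁻¹ • v) z‖ₑ * ‖v‖ₑ) := by
    have h1 : Measurable fun p : Ξ × ℝ => (x + p.2 • (r n)⁻¹ • v, p.1) := by fun_prop
    exact (((measurable_uncurry_lossGrad hf hmeas).comp h1).enorm).mul_const _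
  have key : ∀ t ∈ Set.Ioc (0 : ℝ) 1,
      ∫⁻ z in s, ‖lossGrad f (x + t • (r n)⁻¹ • v) z‖ₑ ∂P ≤
        ENNReal.ofReal (ε / (‖v‖ + 1)) := by
    intro t ht
    have := h ⟨_, hU n t ht⟩ s hs hPs
    rwa [eLpNorm_indicator_eq_eLpNorm_restrict hs, eLpNorm_one_eq_lintegral_enorm] at this
  rw [eLpNorm_indicator_eq_eLpNorm_restrict hs, eLpNorm_one_eq_lintegral_enorm]
  calc ∫⁻ z in s, ‖r n • (f (x + (r n)⁻¹ • v) z - f x z)‖ₑ ∂P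
      ≤ ∫⁻ z in s, (∫⁻ t in Set.Ioc (0 : ℝ) 1,
          ‖lossGrad f (x + t • (r n)⁻¹ • v) z‖ₑ * ‖v‖ₑ) ∂P :=
        lintegral_mono fun z => enorm_smul_loss_sub_le hf x v (hr n) z
    _ = ∫⁻ t in Set.Ioc (0 : ℝ) 1, (∫⁻ z in s,
          ‖lossGrad f (x + t • (r n)⁻¹ • v) z‖ₑ * ‖v‖ₑ ∂P) :=
        lintegral_lintegral_swap hm.aemeasurable
    _ ≤ ∫⁻ t in Set.Ioc (0 : ℝ) 1, ENNReal.ofReal ε := by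
        refine setLIntegral_mono measurable_const fun t ht => ?_
        rw [lintegral_mul_const' _ _ enorm_ne_top]
        refine (mul_le_mul_left (key t ht) _).trans ?_
        rw [← ofReal_norm, ← ENNReal.ofReal_mul (by positivity)]
        refine ENNReal.ofReal_le_ofReal ?_
        rw [div_mul_eq_mul_div, div_le_iff₀ (by positivity)]
        nlinarith [norm_nonneg v]
    _ = ENNReal.ofReal ε := by simp

/-- The gradient of the objective is the mean of the gradients of the loss: Vitali's convergence
theorem applies to the difference quotients. -/
lemma gradient_objective [IsProbabilityMeasure P]
    (hf : ∀ z, ContDiff ℝ 1 fun x => f x z) (hmeas : ∀ x, Measurable (f x))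
    (hint : ∀ x, Integrable (f x) P)
    (hUI : ∀ x, ∃ U : Set (EuclideanSpace ℝ (Fin d)), U ∈ 𝓝 x ∧
      UniformIntegrable (fun (y : U) z => lossGrad f (y : EuclideanSpace ℝ (Fin d)) z) 1 P)
    {x : EuclideanSpace ℝ (Fin d)} (hF : DifferentiableAt ℝ (objective f P) x) :
    gradient (objective f P) x = ∫ z, lossGrad f x z ∂P := by
  have hgint : Integrable (lossGrad f x) P := memLp_one_iff_integrable.1 (memLp_one_lossGrad hUI x)
  refine ext_inner_right ℝ fun v => ?_
  obtain ⟨U, hU, hUx⟩ := hUI x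
  obtain ⟨ρ, hρ, hball⟩ := Metric.mem_nhds_iff.1 hU
  obtain ⟨N, hN⟩ := exists_nat_gt (‖v‖ / ρ)
  set r : ℕ → ℝ := fun n => (n : ℝ) + (N + 1) with hr
  have hr0 : ∀ n, 0 < r n := fun n => by positivity
  have hrt : Tendsto (fun n => ‖r n‖) atTop atTop :=
    tendsto_norm_atTop_atTop.comp
      (tendsto_atTop_add_const_right _ _ tendsto_natCast_atTop_atTop)
  have hseg : ∀ n, ∀ s ∈ Set.Ioc (0 : ℝ) 1, x + s • (r n)⁻¹ • v ∈ U := by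
    intro n s hs
    apply hball
    rw [Metric.mem_ball, dist_eq_norm, add_sub_cancel_left, norm_smul, norm_smul, norm_inv,
      Real.norm_of_nonneg hs.1.le, Real.norm_of_nonneg (hr0 n).le]
    have h1 : (r n)⁻¹ * ‖v‖ < ρ := by
      rw [inv_mul_lt_iff₀ (hr0 n)]
      rw [div_lt_iff₀ hρ] at hN
      have : (0 : ℝ) ≤ n * ρ := by positivity
      simp only [hr]
      nlinarith
    have h2 : 0 ≤ (r n)⁻¹ * ‖v‖ := mul_nonneg (inv_nonneg.2 (hr0 n).le) (norm_nonneg v)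
    nlinarith [hs.1, hs.2]
  have hvitali := tendsto_Lp_finite_of_tendsto_ae (μ := P) le_rfl ENNReal.one_ne_top
    (f := fun n z => r n • (f (x + (r n)⁻¹ • v) z - f x z))
    (g := fun z => inner ℝ (lossGrad f x z) v)
    (fun n => by
      have h4 := hmeas (x + (r n)⁻¹ • v)
      have h5 := hmeas x
      exact Measurable.aestronglyMeasurable (by fun_prop))
    (memLp_one_iff_integrable.2 (hgint.inner_const v))
    (unifIntegrable_difference_quotients hf hmeas hUx (fun n => (hr0 n).ne') hseg)
    (ae_of_all _ fun z => (hasFDerivAt_loss hf x z).lim v hrt)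
  have h1 := tendsto_integral_of_L1' _ (hgint.inner_const v).1
    (.of_forall fun n => ((hint _).sub (hint _)).smul (r n)) hvitali
  have h2 := hF.hasGradientAt.hasFDerivAt.lim v hrt
  have h3 : ∀ n, ∫ z, r n • (f (x + (r n)⁻¹ • v) z - f x z) ∂P =
      r n • (objective f P (x + (r n)⁻¹ • v) - objective f P x) := by
    intro n
    rw [integral_smul, integral_sub (hint _) (hint _)]
    rfl
  have h4 := tendsto_nhds_unique h2 (h1.congr h3)
  rw [InnerProductSpace.toDual_apply_apply] at h4
  rw [h4, real_inner_comm, ← integral_inner hgint]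
  exact integral_congr_ae (ae_of_all _ fun z => real_inner_comm _ _)

end LossGradient

/-! ### Stochastic gradient descent as a Robbins–Monro recursion -/

namespace RegularObjective

variable {d : ℕ} {F : EuclideanSpace ℝ (Fin d) → ℝ} {xs : EuclideanSpace ℝ (Fin d)}

lemma gradient_minimizer (h : RegularObjective F xs) : gradient F xs = 0 := by
  have h1 : IsLocalMin F xs := .of_forall h.minimizer
  rw [gradient, h1.fderiv_eq_zero, map_zero]

lemma continuous_gradient (h : RegularObjective F xs) : Continuous (gradient F) :=
  (InnerProductSpace.toDual ℝ (EuclideanSpace ℝ (Fin d))).symm.continuous.comp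
    (h.contDiff.continuous_fderiv one_ne_zero)

lemma coercive (h : RegularObjective F xs) :
    ∃ c, 0 < c ∧ ∀ v, c * ‖v‖ ^ 2 ≤ inner ℝ (gradient F (xs + v)) v := by
  obtain ⟨c, hc, hconv⟩ := h.strongConvex
  refine ⟨c, hc, fun v => ?_⟩
  have h1 := hconv (xs + v) xs
  have h2 := hconv xs (xs + v)
  rw [h.gradient_minimizer, inner_zero_left] at h2
  rw [show xs - (xs + v) = -v by abel, inner_neg_right, add_sub_cancel_left] at h1
  rw [show xs - (xs + v) = -v by abel, norm_neg] at h2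
  linarith

lemma exists_norm_le (h : RegularObjective F xs) :
    ∃ L, 0 < L ∧ ∀ v, ‖gradient F (xs + v)‖ ≤ L * ‖v‖ := by
  obtain ⟨L, hL, hlip⟩ := h.lipschitz
  refine ⟨L, hL, fun v => ?_⟩
  simpa [h.gradient_minimizer] using hlip (xs + v) xs

/-- Because the gradient grows linearly, the quadratic bound on the Taylor remainder near the
minimizer holds globally. -/
lemma exists_sub_le (h : RegularObjective F xs) :
    ∃ K, ∀ v, ‖gradient F (xs + v) - fderiv ℝ (gradient F) xs v‖ ≤ K * ‖v‖ ^ 2 := by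
  obtain ⟨L, hL, hnorm⟩ := h.exists_norm_le
  obtain ⟨K, hK⟩ := h.taylor.bound
  obtain ⟨ρ, hρ, hball⟩ := Metric.eventually_nhds_iff_ball.1 hK
  set H := fderiv ℝ (gradient F) xs
  refine ⟨max K ((L + ‖H‖) / ρ), fun v => ?_⟩
  rcases lt_or_ge ‖v‖ ρ with hv | hv
  · have h1 := hball (xs + v) (by simpa using hv)
    rw [h.gradient_minimizer, sub_zero, add_sub_cancel_left, norm_pow, norm_norm] at h1
    exact h1.trans (by gcongr; exact le_max_left _ _)
  · have h1 : ‖gradient F (xs + v) - H v‖ ≤ (L + ‖H‖) * ‖v‖ := by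
      refine (norm_sub_le _ _).trans ?_
      linarith [hnorm v, H.le_opNorm v]
    have h2 : (L + ‖H‖) * ‖v‖ ≤ (L + ‖H‖) / ρ * ‖v‖ ^ 2 := by
      have h3 : 0 ≤ (L + ‖H‖) * ‖v‖ := by positivity
      rw [div_mul_eq_mul_div, le_div_iff₀ hρ]
      nlinarith
    exact (h1.trans h2).trans (by gcongr; exact le_max_right _ _)

end RegularObjective

section Samples

variable {Ω Ξ : Type*} {m mΩ : MeasurableSpace Ω} [mΞ : MeasurableSpace Ξ] {μ : Measure Ω}
  {P : Measure Ξ}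

/-- The filtration generated by a sequence of samples; `n` samples are known at time `n`. -/
def sampleFiltration (ξ : ℕ → Ω → Ξ) (hξ : ∀ n, Measurable (ξ n)) : Filtration ℕ mΩ where
  seq := pastSigma ξ
  mono' _ _ hij := biSup_mono fun _ hk => lt_of_lt_of_le hk hij
  le' _ := iSup₂_le fun i _ => (hξ i).comap_le

omit mΩ in
lemma measurable_sample (ξ : ℕ → Ω → Ξ) (n : ℕ) : Measurable[pastSigma ξ (n + 1)] (ξ n) :=
  Measurable.mono (comap_measurable (ξ n))
    (le_iSup₂ (f := fun i (_ : i < n + 1) => MeasurableSpace.comap (ξ i) mΞ) n n.lt_succ_self)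
    le_rfl

omit mΩ in
lemma pastSigma_le_succ (ξ : ℕ → Ω → Ξ) (n : ℕ) : pastSigma ξ n ≤ pastSigma ξ (n + 1) :=
  biSup_mono fun _ hk => lt_of_lt_of_le hk n.le_succ

lemma indep_pastSigma_sample {ξ : ℕ → Ω → Ξ} (hξ : ∀ n, Measurable (ξ n)) (hind : iIndepFun ξ μ)
    (n : ℕ) : Indep (pastSigma ξ n) (MeasurableSpace.comap (ξ n) mΞ) μ := by
  have h := indep_iSup_of_disjoint (fun i => (hξ i).comap_le) hind.iIndep (S := {i | i < n})
    (T := {n}) (by simp)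
  rw [iSup_singleton] at h
  exact h

/-- If `Z` is independent of `m`, `X` is `m`-measurable and `g x Z` is centred for every fixed `x`,
then `g X Z` has conditional mean zero given `m`. -/
lemma condExp_eq_zero_of_indep [IsProbabilityMeasure μ] {E E' : Type*} [MeasurableSpace E]
    [NormedAddCommGroup E'] [NormedSpace ℝ E'] [CompleteSpace E'] (hm : m ≤ mΩ) {X : Ω → E}
    (hX : Measurable[m] X) {Z : Ω → Ξ} (hZ : Measurable Z)
    (hind : Indep m (MeasurableSpace.comap Z mΞ) μ) (hlaw : μ.map Z = P) {g : E → Ξ → E'}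
    (hg : StronglyMeasurable (Function.uncurry g))
    (hint : Integrable (fun ω => g (X ω) (Z ω)) μ) (h0 : ∀ x, ∫ z, g x z ∂P = 0) :
    μ[fun ω => g (X ω) (Z ω) | m] =ᵐ[μ] 0 := by
  refine (ae_eq_condExp_of_forall_setIntegral_eq hm hint (fun s _ _ => integrableOn_zero)
    (fun s hs _ => ?_) aestronglyMeasurable_zero).symm
  have : IsProbabilityMeasure P := hlaw ▸ Measure.isProbabilityMeasure_map hZ.aemeasurable
  -- the pair of `X` and the indicator of `s` is `m`-measurable, hence independent of `Z`
  set Y : Ω → E × ℝ := fun ω => (X ω, s.indicator (fun _ => 1) ω) with hYdef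
  have hYm : Measurable[m] Y := hX.prodMk (measurable_const.indicator hs)
  have hY : Measurable Y := hYm.mono hm le_rfl
  have hYZ : IndepFun Y Z μ :=
    (IndepFun_iff_Indep _ _ _).2 (indep_of_indep_of_le_left hind hYm.comap_le)
  have hlawYZ := (indepFun_iff_map_prod_eq_prod_map_map hY.aemeasurable hZ.aemeasurable).1 hYZ
  set ψ : (E × ℝ) × Ξ → E' := fun y => y.1.2 • g y.1.1 y.2
  have hψ : StronglyMeasurable ψ := by
    have h1 : Measurable fun y : (E × ℝ) × Ξ => (y.1.1, y.2) := by fun_prop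
    have h2 : Measurable fun y : (E × ℝ) × Ξ => y.1.2 := by fun_prop
    exact h2.stronglyMeasurable.smul (hg.comp_measurable h1)
  have hψY : ∀ ω, ψ (Y ω, Z ω) = s.indicator (fun ω => g (X ω) (Z ω)) ω := by
    intro ω
    by_cases hω : ω ∈ s <;> simp [ψ, Y, hω]
  have hψint : Integrable ψ ((μ.map Y).prod (μ.map Z)) := by
    rw [← hlawYZ, integrable_map_measure hψ.aestronglyMeasurable
      (hY.prodMk hZ).aemeasurable]
    exact (hint.indicator (hm s hs)).congr (ae_of_all _ fun ω => (hψY ω).symm)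
  have : IsProbabilityMeasure (μ.map Y) := Measure.isProbabilityMeasure_map hY.aemeasurable
  rw [← integral_indicator (hm s hs), ← integral_indicator (hm s hs)]
  simp only [Set.indicator_zero, integral_zero]
  symm
  calc ∫ ω, s.indicator (fun ω => g (X ω) (Z ω)) ω ∂μ = ∫ ω, ψ (Y ω, Z ω) ∂μ :=
        integral_congr_ae (ae_of_all _ fun ω => (hψY ω).symm)
    _ = ∫ y, ψ y ∂(μ.map fun ω => (Y ω, Z ω)) :=
        (integral_map (hY.prodMk hZ).aemeasurable hψ.aestronglyMeasurable).symm
    _ = 0 := by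
        rw [hlawYZ, integral_prod _ hψint, hlaw]
        simp [ψ, integral_smul, h0]

end Samples

section StochasticGradientDescent

variable {d : ℕ} {Ω Ξ : Type*} {mΩ : MeasurableSpace Ω} [MeasurableSpace Ξ]
  {f : EuclideanSpace ℝ (Fin d) → Ξ → ℝ} {μ : Measure Ω} {P : Measure Ξ} {ξ : ℕ → Ω → Ξ}
  {η α : ℝ} {x₀ xs : EuclideanSpace ℝ (Fin d)}

omit mΩ in
lemma measurable_sgd (hg : Measurable (Function.uncurry (lossGrad f))) (n : ℕ) :
    Measurable[pastSigma ξ n] fun ω => sgd f η α x₀ (fun k => ξ k ω) n := by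
  induction n with
  | zero => exact measurable_const
  | succ n ih =>
    have h1 : Measurable[pastSigma ξ (n + 1)] fun ω => sgd f η α x₀ (fun k => ξ k ω) n :=
      ih.mono (pastSigma_le_succ ξ n) le_rfl
    have h2 := hg.comp (h1.prodMk (measurable_sample ξ n))
    exact h1.sub (h2.const_smul (η * ((n : ℝ) + 1) ^ (-α)))

omit mΩ in
lemma measurable_gradNoise (hg : Measurable (Function.uncurry (lossGrad f)))
    (hF : Continuous (gradient (objective f P))) (n : ℕ) :
    Measurable[pastSigma ξ (n + 1)] (gradNoise f P η α x₀ ξ n) := by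
  have h1 : Measurable[pastSigma ξ (n + 1)] fun ω => sgd f η α x₀ (fun k => ξ k ω) n :=
    (measurable_sgd hg n).mono (pastSigma_le_succ ξ n) le_rfl
  exact (hF.measurable.comp h1).sub (hg.comp (h1.prodMk (measurable_sample ξ n)))

/-- The quadratic form of the conditional second moment matrix of the noise. -/
lemma condExp_inner_gradNoise_sq (hLp : ∀ n, MemLp (gradNoise f P η α x₀ ξ n) 4 μ)
    [IsProbabilityMeasure μ] (p : EuclideanSpace ℝ (Fin d)) (n : ℕ) :
    ∀ᵐ ω ∂μ, (μ[fun ω' => inner ℝ p (gradNoise f P η α x₀ ξ n ω') ^ 2 | pastSigma ξ n]) ω =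
      inner ℝ p (Matrix.toEuclideanCLM (𝕜 := ℝ) (condNoiseCov μ f P η α x₀ ξ n ω) p) := by
  set e := gradNoise f P η α x₀ ξ n
  have hc : ∀ i, MemLp (fun ω => e ω i) 2 μ := fun i =>
    ((hLp n).mono_exponent (by norm_num)).of_le
      ((EuclideanSpace.proj (𝕜 := ℝ) i).continuous.comp_aestronglyMeasurable (hLp n).1)
      (ae_of_all _ fun ω => PiLp.norm_apply_le _ _)
  have hij : ∀ i j, Integrable (fun ω => e ω i * e ω j) μ := fun i j => (hc i).integrable_mul (hc j)
  have h1 : (fun ω => inner ℝ p (e ω) ^ 2) =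
      ∑ i, ∑ j, (p i * p j) • fun ω => e ω i * e ω j := by
    funext ω
    simp only [PiLp.inner_apply, Finset.sum_apply, Pi.smul_apply, smul_eq_mul, sq,
      Finset.sum_mul_sum, RCLike.inner_apply, conj_trivial]
    exact Finset.sum_congr rfl fun i _ => Finset.sum_congr rfl fun j _ => by ring
  have h2 : ∀ i, Integrable (∑ j, (p i * p j) • fun ω => e ω i * e ω j) μ := fun i =>
    integrable_finsetSum' _ fun j _ => (hij i j).smul _
  have h3 : ∀ i, ∀ᵐ ω ∂μ, (μ[∑ j, (p i * p j) • fun ω => e ω i * e ω j | pastSigma ξ n]) ω =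
      ∑ j, p i * p j * condNoiseCov μ f P η α x₀ ξ n ω i j := by
    intro i
    have h4 : ∀ᵐ ω ∂μ, ∀ j, (μ[(p i * p j) • fun ω => e ω i * e ω j | pastSigma ξ n]) ω =
        p i * p j * condNoiseCov μ f P η α x₀ ξ n ω i j :=
      ae_all_iff.2 fun j => condExp_smul (p i * p j) (fun ω => e ω i * e ω j) (pastSigma ξ n)
    filter_upwards [h4, condExp_finsetSum (fun j _ => (hij i j).smul (p i * p j))
      (pastSigma ξ n)] with ω h5 h6
    rw [h6, Finset.sum_apply]
    exact Finset.sum_congr rfl fun j _ => h5 j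
  rw [h1]
  filter_upwards [ae_all_iff.2 h3, condExp_finsetSum (fun i _ => h2 i) (pastSigma ξ n)]
    with ω h5 h6
  rw [h6, Finset.sum_apply]
  simp only [h5, PiLp.inner_apply, Matrix.ofLp_toEuclideanCLM, Matrix.mulVec, dotProduct,
    RCLike.inner_apply, conj_trivial, Finset.sum_mul]
  exact Finset.sum_congr rfl fun i _ => Finset.sum_congr rfl fun j _ => by ring

/-- Under the assumptions on objective and noise, the errors of stochastic gradient descent form a
Robbins–Monro recursion. -/
lemma isRobbinsMonro_sgd [IsProbabilityMeasure μ] [IsProbabilityMeasure P]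
    (hξ_meas : ∀ n, Measurable (ξ n)) (hξ_indep : iIndepFun ξ μ)
    (hξ_law : ∀ n, Measure.map (ξ n) μ = P) (hf_meas : ∀ x, Measurable (f x))
    (hf_int : ∀ x, Integrable (f x) P) (hη : 0 < η) (hα : 1 / 2 < α) (hα' : α < 1)
    (h_obj : RegularObjective (objective f P) xs) (h_noise : RegularNoise μ f P η α x₀ xs ξ) :
    IsRobbinsMonro μ (sampleFiltration ξ hξ_meas) (fun v => gradient (objective f P) (xs + v))
      (fderiv ℝ (gradient (objective f P)) xs)
      (fun p => inner ℝ p (Matrix.toEuclideanCLM (𝕜 := ℝ) (gradSecondMoment f P xs) p)) η α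
      (fun n ω => sgd f η α x₀ (fun k => ξ k ω) n - xs) (gradNoise f P η α x₀ ξ) := by
  have hg := measurable_uncurry_lossGrad h_noise.contDiff hf_meas
  have hF := h_obj.continuous_gradient
  have hLp : ∀ n, MemLp (gradNoise f P η α x₀ ξ n) 4 μ := by
    intro n
    have h1 : Measurable (gradNoise f P η α x₀ ξ n) :=
      (measurable_gradNoise hg hF n).mono ((sampleFiltration ξ hξ_meas).le _) le_rfl
    refine (integrable_norm_rpow_iff h1.aestronglyMeasurable (by norm_num) (by norm_num)).1 ?_
    refine (h_noise.integrable_four n).congr (ae_of_all _ fun ω => ?_)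
    beta_reduce
    rw [show (4 : ENNReal).toReal = ((4 : ℕ) : ℝ) by norm_num, Real.rpow_natCast]
  have hstep : ∀ n ω, sgd f η α x₀ (fun k => ξ k ω) (n + 1) - xs =
      sgd f η α x₀ (fun k => ξ k ω) n - xs - (η * ((n : ℝ) + 1) ^ (-α)) •
        (gradient (objective f P) (xs + (sgd f η α x₀ (fun k => ξ k ω) n - xs)) -
          gradNoise f P η α x₀ ξ n ω) := by
    intro n ω
    rw [sgd, gradNoise, add_sub_cancel, sub_sub_cancel]
    abel
  have hδ : ∀ n, MemLp (fun ω => sgd f η α x₀ (fun k => ξ k ω) n - xs) 4 μ := by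
    intro n
    induction n with
    | zero => exact memLp_const (x₀ - xs)
    | succ n ih =>
      obtain ⟨L, -, hL⟩ := h_obj.exists_norm_le
      simp only [hstep]
      refine ih.sub (MemLp.const_smul (f := fun ω => gradient (objective f P)
        (xs + (sgd f η α x₀ (fun k => ξ k ω) n - xs)) - gradNoise f P η α x₀ ξ n ω)
        (MemLp.sub ?_ (hLp n)) (η * ((n : ℝ) + 1) ^ (-α)))
      exact ih.of_le_mul ((hF.comp (continuous_const.add continuous_id)).comp_aestronglyMeasurable
        ih.1) (ae_of_all _ fun ω => hL _)
  exact
  { step_pos := hη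
    half_lt := hα
    lt_one := hα'
    step := hstep
    adapted := fun n => ((measurable_sgd hg n).sub_const xs).stronglyMeasurable
    adapted_noise := fun n => (measurable_gradNoise hg hF n).stronglyMeasurable
    memLp_zero := hδ 0
    memLp_noise := hLp
    condExp_noise := fun n => by
      refine condExp_eq_zero_of_indep ((sampleFiltration ξ hξ_meas).le n) (measurable_sgd hg n)
        (hξ_meas n) (indep_pastSigma_sample hξ_meas hξ_indep n) (hξ_law n)
        (g := fun x z => gradient (objective f P) x - lossGrad f x z) ?_
        ((hLp n).integrable (by norm_num)) fun x => ?_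
      · exact ((hF.measurable.comp measurable_fst).sub hg).stronglyMeasurable
      · rw [integral_sub (integrable_const _)
          (memLp_one_iff_integrable.1 (memLp_one_lossGrad h_noise.uniformIntegrable x)),
          gradient_objective h_noise.contDiff hf_meas hf_int h_noise.uniformIntegrable
          (h_obj.contDiff.differentiable one_ne_zero x)]
        simp
    exists_noise_le := by
      obtain ⟨C, hC⟩ := h_noise.fourthMoment
      refine ⟨C, fun n => ?_⟩
      have h1 := integrable_norm_pow_of_memLp_four (hδ n) (a := 4) le_rfl
      rw [← integral_condExp ((sampleFiltration ξ hξ_meas).le n)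
        (f := fun ω => ‖gradNoise f P η α x₀ ξ n ω‖ ^ 4)]
      calc _ ≤ ∫ ω, C * (1 + ‖sgd f η α x₀ (fun k => ξ k ω) n - xs‖ ^ 4) ∂μ :=
            integral_mono_ae integrable_condExp (((integrable_const 1).add h1).const_mul C) (hC n)
        _ = _ := by
            rw [integral_const_mul, integral_add (integrable_const 1) h1]
            simp
    exists_condExp_le := fun p => by
      obtain ⟨C, hC⟩ := h_noise.covariance
      refine ⟨‖p‖ ^ 2 * C, fun n => ?_⟩
      filter_upwards [hC n, condExp_inner_gradNoise_sq hLp p n] with ω h1 h2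
      change |(μ[fun ω' => inner ℝ p (gradNoise f P η α x₀ ξ n ω') ^ 2 | pastSigma ξ n]) ω - _| ≤ _
      rw [h2, ← inner_sub_right, ← sub_apply, ← map_sub]
      refine (abs_real_inner_le_norm _ _).trans ?_
      calc _ ≤ ‖p‖ * (‖Matrix.toEuclideanCLM (𝕜 := ℝ)
            (condNoiseCov μ f P η α x₀ ξ n ω - gradSecondMoment f P xs)‖ * ‖p‖) := by
            gcongr
            exact ContinuousLinearMap.le_opNorm _ _
        _ ≤ ‖p‖ * ((C * (‖sgd f η α x₀ (fun k => ξ k ω) n - xs‖ +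
              ‖sgd f η α x₀ (fun k => ξ k ω) n - xs‖ ^ 2)) * ‖p‖) := by gcongr
        _ = _ := by ring
    continuous := hF.comp (by fun_prop)
    coercive := h_obj.coercive
    exists_norm_le := h_obj.exists_norm_le
    exists_sub_le := h_obj.exists_sub_le }

end StochasticGradientDescent

/-! ### Quantiles -/

section Quantiles

lemma cdf_neg_of_map_neg {ν : Measure ℝ} [IsProbabilityMeasure ν] [NullSingletonClass ν]
    (hν : ν.map (fun x => -x) = ν) (z : ℝ) : cdf ν (-z) = 1 - cdf ν z := by
  rw [cdf_eq_real, cdf_eq_real]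
  conv_lhs => rw [← hν]
  rw [map_measureReal_apply measurable_neg measurableSet_Iic]
  have h1 : (fun x : ℝ => -x) ⁻¹' Set.Iic (-z) = (Set.Iio z)ᶜ := by ext x; simp
  rw [h1, probReal_compl_eq_one_sub measurableSet_Iio, measureReal_congr Iio_ae_eq_Iic]

/-- The distribution function of a law without atoms attains the level of the quantile exactly. -/
lemma cdf_quantile {ν : Measure ℝ} [IsProbabilityMeasure ν] [NullSingletonClass ν] {p : ℝ}
    (hp : 0 < p) (hp' : p < 1) : cdf ν (quantile ν p) = p := by
  have hmono : Monotone (cdf ν) := monotone_cdf ν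
  have hcont : Continuous (cdf ν) := by
    refine continuous_iff_continuousAt.2 fun x => ?_
    rw [hmono.continuousAt_iff_leftLim_eq_rightLim, (cdf ν).rightLim_eq]
    refine le_antisymm (hmono.leftLim_le le_rfl) ?_
    have h1 := (cdf ν).measure_singleton x
    rw [measure_cdf, measure_singleton, eq_comm, ENNReal.ofReal_eq_zero] at h1
    linarith
  have hlow : ∃ x, cdf ν x < p := ((tendsto_cdf_atBot ν).eventually_lt_const hp).exists
  have hhigh : ∃ x, p < cdf ν x := ((tendsto_cdf_atTop ν).eventually_const_lt hp').exists
  obtain ⟨x, hx⟩ := hlow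
  obtain ⟨y, hy⟩ := hhigh
  obtain ⟨t, ht⟩ := mem_range_of_exists_le_of_exists_ge hcont ⟨x, hx.le⟩ ⟨y, hy.le⟩
  have hbdd : BddBelow {t | p ≤ cdf ν t} := by
    refine ⟨x, fun s hs => ?_⟩
    by_contra! hlt
    exact absurd (hmono hlt.le) (not_le.2 (hx.trans_le hs))
  have hclosed : IsClosed {t | p ≤ cdf ν t} := isClosed_le continuous_const hcont
  exact le_antisymm ((hmono (csInf_le hbdd ht.ge)).trans ht.le)
    (hclosed.csInf_mem ⟨t, ht.ge⟩ hbdd)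

/-- The symmetric interval bounded by the `1 - q / 2` quantile of the standard normal law has
probability `1 - q`. -/
lemma gaussianReal_abs_le_quantile {q : ℝ} (hq : 0 < q) (hq' : q < 1) :
    (gaussianReal 0 1).real {x | |x| ≤ quantile (gaussianReal 0 1) (1 - q / 2)} = 1 - q := by
  have : NullSingletonClass (gaussianReal 0 1) := nullSingletonClass_gaussianReal one_ne_zero
  set z := quantile (gaussianReal 0 1) (1 - q / 2)
  have hz : cdf (gaussianReal 0 1) z = 1 - q / 2 := cdf_quantile (by linarith) (by linarith)
  have hneg := cdf_neg_of_map_neg (ν := gaussianReal 0 1) (by simp [gaussianReal_map_neg])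
  have h0 : cdf (gaussianReal 0 1) 0 = 1 / 2 := by
    have := hneg 0
    rw [neg_zero] at this
    linarith
  have hz0 : 0 < z := by
    by_contra! hle
    have := monotone_cdf (gaussianReal 0 1) hle
    linarith
  have h1 : {x : ℝ | |x| ≤ z} = Set.Iic z \ Set.Iio (-z) := by
    ext x
    simp only [Set.mem_ofPred_eq, abs_le, Set.mem_sdiff, Set.mem_Iic, Set.mem_Iio, not_lt]
    exact and_comm
  have h2 : Set.Iio (-z) ⊆ Set.Iic z := fun x hx => by
    rw [Set.mem_Iio] at hx
    rw [Set.mem_Iic]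
    linarith
  rw [h1, measureReal_sdiff h2 measurableSet_Iio, measureReal_congr Iio_ae_eq_Iic, ← cdf_eq_real,
    ← cdf_eq_real, hneg, hz]
  ring

lemma measurable_sum_sq (d : ℕ) : Measurable fun v : Fin d → ℝ => ∑ i, v i ^ 2 := by fun_prop

instance isProbabilityMeasure_chiSquare (d : ℕ) : IsProbabilityMeasure (chiSquare d) :=
  Measure.isProbabilityMeasure_map (measurable_sum_sq d).aemeasurable

/-- The chi-square law has no atoms: on every line in the direction of the first coordinate, the sum
of squares takes a given value at most twice. -/
lemma nullSingletonClass_chiSquare {d : ℕ} (hd : 1 ≤ d) : NullSingletonClass (chiSquare d) := by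
  refine ⟨fun c => ?_⟩
  obtain ⟨k, rfl⟩ : ∃ k, d = k + 1 := ⟨d - 1, by omega⟩
  have : NullSingletonClass (gaussianReal 0 1) := nullSingletonClass_gaussianReal one_ne_zero
  rw [chiSquare, Measure.map_apply (measurable_sum_sq _) (measurableSet_singleton c)]
  have hmp := (measurePreserving_piFinSuccAbove (fun _ : Fin (k + 1) => gaussianReal 0 1) 0)
  set B : Set (ℝ × (Fin k → ℝ)) := {y | y.1 ^ 2 + ∑ i, y.2 i ^ 2 = c}
  have hB : MeasurableSet B := measurableSet_eq_fun (by fun_prop) (by fun_prop)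
  have h1 : (fun v : Fin (k + 1) → ℝ => ∑ i, v i ^ 2) ⁻¹' {c} =
      (MeasurableEquiv.piFinSuccAbove (fun _ => ℝ) 0) ⁻¹' B := by
    ext v
    simp [B, Fin.sum_univ_succ, Fin.tail]
  rw [h1, hmp.measure_preimage hB.nullMeasurableSet, Measure.prod_apply_symm hB]
  refine lintegral_eq_zero_of_ae_eq_zero (ae_of_all _ fun w => ?_)
  refine Set.Finite.measure_zero ?_ _
  refine (Set.toFinite ({√(c - ∑ i, w i ^ 2), -√(c - ∑ i, w i ^ 2)} : Set ℝ)).subset fun x hx => ?_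
  have hx' : x ^ 2 = c - ∑ i, w i ^ 2 := by
    have : x ^ 2 + ∑ i, w i ^ 2 = c := hx
    linarith
  rw [← hx', Real.sqrt_sq_eq_abs]
  rcases abs_choice x with h | h <;> simp [h]

lemma pi_gaussianReal_sum_sq_le_quantile {d : ℕ} (hd : 1 ≤ d) {q : ℝ} (hq : 0 < q) (hq' : q < 1) :
    (Measure.pi fun _ : Fin d => gaussianReal 0 1).real
      {v | ∑ i, v i ^ 2 ≤ quantile (chiSquare d) (1 - q)} = 1 - q := by
  have := nullSingletonClass_chiSquare hd
  have h := cdf_quantile (ν := chiSquare d) (p := 1 - q) (by linarith) (by linarith)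
  rw [cdf_eq_real] at h
  conv_lhs at h => rw [chiSquare]
  rwa [map_measureReal_apply (measurable_sum_sq d) measurableSet_Iic] at h

lemma pi_gaussianReal_sum_sq_eq {d : ℕ} (hd : 1 ≤ d) (c : ℝ) :
    (Measure.pi fun _ : Fin d => gaussianReal 0 1) {v | ∑ i, v i ^ 2 = c} = 0 := by
  have := nullSingletonClass_chiSquare hd
  have h : chiSquare d {c} = 0 := measure_singleton c
  rwa [chiSquare, Measure.map_apply (measurable_sum_sq _) (measurableSet_singleton c)] at h

end Quantiles

/-! ### Confidence regions from a central limit theorem and a consistent covariance estimator -/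

section ConfidenceRegions

variable {Ω Ω' : Type*} {mΩ : MeasurableSpace Ω} {mΩ' : MeasurableSpace Ω'} {μ : Measure Ω}
  {μ' : Measure Ω'} [IsProbabilityMeasure μ] [IsProbabilityMeasure μ']

lemma tendstoInDistribution_of_tendsto_integral_exp {E : Type*} [NormedAddCommGroup E]
    [InnerProductSpace ℝ E] [FiniteDimensional ℝ E] [MeasurableSpace E] [BorelSpace E]
    {X : ℕ → Ω → E} {Z : Ω' → E} (hX : ∀ n, Measurable (X n)) (hZ : Measurable Z)
    (h : ∀ u, Tendsto (fun n => ∫ ω, Complex.exp ((inner ℝ u (X n ω) : ℝ) * Complex.I) ∂μ) atTop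
      (𝓝 (∫ ω, Complex.exp ((inner ℝ u (Z ω) : ℝ) * Complex.I) ∂μ'))) :
    TendstoInDistribution X atTop Z (fun _ => μ) μ' where
  forall_aemeasurable n := (hX n).aemeasurable
  aemeasurable_limit := hZ.aemeasurable
  tendsto := by
    refine ProbabilityMeasure.tendsto_iff_tendsto_charFun.2 fun u => ?_
    have hm : Continuous fun x : E => Complex.exp ((inner ℝ x u : ℝ) * Complex.I) := by fun_prop
    simp only [ProbabilityMeasure.coe_mk, charFun_apply]
    rw [integral_map hZ.aemeasurable hm.aestronglyMeasurable]
    simp_rw [fun n => integral_map (μ := μ) (hX n).aemeasurable hm.aestronglyMeasurable,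
      real_inner_comm u]
    exact h u

lemma tendsto_measureReal_nonpos {Y : ℕ → Ω → ℝ} {Z : Ω' → ℝ}
    (h : TendstoInDistribution Y atTop Z (fun _ => μ) μ') (h0 : μ' {ω | Z ω = 0} = 0) :
    Tendsto (fun n => μ.real {ω | Y n ω ≤ 0}) atTop (𝓝 (μ'.real {ω | Z ω ≤ 0})) := by
  have h1 := ProbabilityMeasure.tendsto_measure_of_null_frontier_of_tendsto' h.tendsto
    (E := Set.Iic 0) (by
      rw [frontier_Iic, ProbabilityMeasure.coe_mk,
        Measure.map_apply_of_aemeasurable h.aemeasurable_limit (measurableSet_singleton _)]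
      exact h0)
  simp only [ProbabilityMeasure.coe_mk] at h1
  rw [Measure.map_apply_of_aemeasurable h.aemeasurable_limit measurableSet_Iic] at h1
  exact (ENNReal.tendsto_toReal (measure_ne_top _ _)).comp (h1.congr fun n =>
    Measure.map_apply_of_aemeasurable (h.forall_aemeasurable n) measurableSet_Iic)

/-- A studentized statistic yields asymptotically exact two-sided normal bounds. -/
lemma tendsto_measureReal_abs_le_quantile_mul_sqrt {X V : ℕ → Ω → ℝ} {s : ℝ} (hs : 0 < s)
    (hX : ∀ n, Measurable (X n)) (hV : ∀ n, Measurable (V n))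
    (hchar : ∀ t : ℝ, Tendsto (fun n => ∫ ω, Complex.exp ((t * X n ω : ℝ) * Complex.I) ∂μ) atTop
      (𝓝 (Complex.exp (-(t ^ 2 * s / 2 : ℝ)))))
    (hVs : TendstoInMeasure μ V atTop fun _ => s) {q : ℝ} (hq : 0 < q) (hq' : q < 1) :
    Tendsto (fun n => μ.real {ω | |X n ω| ≤
      quantile (gaussianReal 0 1) (1 - q / 2) * √(V n ω)}) atTop (𝓝 (1 - q)) := by
  set z := quantile (gaussianReal 0 1) (1 - q / 2)
  have hs' : 0 < √s := Real.sqrt_pos.2 hs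
  have hdist : TendstoInDistribution X atTop (fun g : ℝ => √s * g) (fun _ => μ)
      (gaussianReal 0 1) := by
    refine tendstoInDistribution_of_tendsto_integral_exp hX (by fun_prop) fun t => ?_
    have h1 : ∫ g, Complex.exp ((inner ℝ t (√s * g) : ℝ) * Complex.I) ∂gaussianReal 0 1 =
        Complex.exp (-(t ^ 2 * s / 2 : ℝ)) := by
      have h2 := charFun_gaussianReal (μ := 0) (v := 1) (√s * t)
      rw [charFun_apply_real] at h2
      calc _ = ∫ g, Complex.exp (((√s * t : ℝ) : ℂ) * (g : ℂ) * Complex.I) ∂gaussianReal 0 1 := by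
            refine integral_congr_ae (ae_of_all _ fun g => ?_)
            simp only [RCLike.inner_apply, conj_trivial]
            push_cast
            ring_nf
        _ = _ := by
            rw [h2]
            have h3 : ((√s : ℝ) : ℂ) ^ 2 = s := by
              rw [← Complex.ofReal_pow, Real.sq_sqrt hs.le]
            push_cast
            rw [mul_pow, h3]
            congr 1
            ring
    rw [h1]
    refine (hchar t).congr fun n => ?_
    refine integral_congr_ae (ae_of_all _ fun ω => ?_)
    simp [mul_comm]
  have hpair := hdist.continuous_comp_prodMk_of_tendstoInMeasure_const
    (g := fun p : ℝ × ℝ => |p.1| - z * √p.2) (by fun_prop) hVs fun n => (hV n).aemeasurable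
  have : NullSingletonClass (gaussianReal 0 1) := nullSingletonClass_gaussianReal one_ne_zero
  have hlim := tendsto_measureReal_nonpos hpair (by
    refine Set.Finite.measure_zero ((Set.toFinite ({z, -z} : Set ℝ)).subset fun g hg => ?_) _
    have h1 : |√s * g| - z * √s = 0 := hg
    rw [abs_mul, abs_of_pos hs', mul_comm, ← sub_mul, mul_eq_zero] at h1
    have h2 : |g| = z := by
      rcases h1 with h1 | h1
      · linarith
      · exact absurd h1 hs'.ne'
    rw [← h2]
    rcases abs_choice g with h | h <;> simp [h])
  have h1 : {g : ℝ | |√s * g| - z * √s ≤ 0} = {g | |g| ≤ z} := by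
    ext g
    simp only [Set.mem_ofPred_eq, abs_mul, abs_of_pos hs', sub_nonpos]
    rw [mul_comm, mul_le_mul_iff_left₀ hs']
  rw [h1, gaussianReal_abs_le_quantile hq hq'] at hlim
  refine hlim.congr fun n => ?_
  simp only [sub_nonpos]

open scoped MatrixOrder Matrix.Norms.L2Operator in
lemma exists_isUnit_eq_mul_transpose {d : ℕ} {M : Matrix (Fin d) (Fin d) ℝ} (hM : M.PosDef) :
    ∃ R : Matrix (Fin d) (Fin d) ℝ, IsUnit R ∧ M = R * R.transpose :=
  CStarAlgebra.isStrictlyPositive_iff_eq_mul_star_self.1 hM.isStrictlyPositive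

variable {d : ℕ} {X : ℕ → Ω → EuclideanSpace ℝ (Fin d)} {V : ℕ → Ω → Fin d → Fin d → ℝ}
  {M : Matrix (Fin d) (Fin d) ℝ}

open Matrix in
/-- A normal vector with covariance `R Rᵀ` is the image under `R` of a standard normal one. -/
lemma tendstoInDistribution_pi_gaussianReal {R : Matrix (Fin d) (Fin d) ℝ}
    (hX : ∀ n, Measurable (X n))
    (hchar : ∀ u, Tendsto (fun n => ∫ ω, Complex.exp ((inner ℝ u (X n ω) : ℝ) * Complex.I) ∂μ)
      atTop (𝓝 (Complex.exp (-(u.ofLp ⬝ᵥ (R * Rᵀ) *ᵥ u.ofLp / 2 : ℝ))))) :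
    TendstoInDistribution X atTop (fun w : Fin d → ℝ => WithLp.toLp 2 (R *ᵥ w)) (fun _ => μ)
      (Measure.pi fun _ => gaussianReal 0 1) := by
  have hcont : Continuous fun w : Fin d → ℝ =>
      (WithLp.toLp 2 (R *ᵥ w) : EuclideanSpace ℝ (Fin d)) :=
    (PiLp.continuous_toLp 2 _).comp (continuous_const.matrix_mulVec continuous_id)
  refine tendstoInDistribution_of_tendsto_integral_exp hX hcont.measurable fun u => ?_
  have h1 : ∫ w, Complex.exp ((inner ℝ u (WithLp.toLp 2 (R *ᵥ w)) : ℝ) * Complex.I)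
      ∂(Measure.pi fun _ => gaussianReal 0 1) =
      Complex.exp (-(u.ofLp ⬝ᵥ (R * Rᵀ) *ᵥ u.ofLp / 2 : ℝ)) := by
    set p : EuclideanSpace ℝ (Fin d) := WithLp.toLp 2 (Rᵀ *ᵥ u.ofLp)
    have h2 := charFun_stdGaussian p
    have hm : Continuous fun x : EuclideanSpace ℝ (Fin d) =>
      Complex.exp ((inner ℝ x p : ℝ) * Complex.I) := by fun_prop
    rw [← map_pi_eq_stdGaussian, charFun_apply, integral_map
      (PiLp.continuous_toLp 2 _).measurable.aemeasurable hm.aestronglyMeasurable] at h2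
    have h3 : ‖p‖ ^ 2 = u.ofLp ⬝ᵥ (R * Rᵀ) *ᵥ u.ofLp := by
      rw [← real_inner_self_eq_norm_sq, EuclideanSpace.inner_eq_star_dotProduct, star_trivial]
      simp only [p]
      rw [← mulVec_mulVec, dotProduct_mulVec u.ofLp R, ← mulVec_transpose]
    calc _ = ∫ w, Complex.exp ((inner ℝ (WithLp.toLp 2 w) p : ℝ) * Complex.I)
          ∂(Measure.pi fun _ => gaussianReal 0 1) := by
          refine integral_congr_ae (ae_of_all _ fun w => ?_)
          have h4 : inner ℝ u (WithLp.toLp 2 (R *ᵥ w)) = inner ℝ (WithLp.toLp 2 w) p := by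
            simp only [EuclideanSpace.inner_eq_star_dotProduct, star_trivial, p]
            rw [dotProduct_comm, dotProduct_mulVec, mulVec_transpose]
          beta_reduce
          rw [h4]
      _ = _ := by
          rw [h2, ← h3]
          push_cast
          congr 1
          ring
  rw [h1]
  exact hchar u

open Matrix in
/-- A covariance estimator that is consistent for a positive definite matrix is invertible with
probability tending to one, and the Wald statistic formed with it is asymptotically chi-square. -/
lemma tendsto_measureReal_dotProduct_inv_mulVec_le (hd : 1 ≤ d) (hM : M.PosDef)
    (hX : ∀ n, Measurable (X n)) (hV : ∀ n, Measurable (V n))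
    (hchar : ∀ u, Tendsto (fun n => ∫ ω, Complex.exp ((inner ℝ u (X n ω) : ℝ) * Complex.I) ∂μ)
      atTop (𝓝 (Complex.exp (-(u.ofLp ⬝ᵥ M *ᵥ u.ofLp / 2 : ℝ)))))
    (hVM : TendstoInMeasure μ V atTop fun _ => M) {q : ℝ} (hq : 0 < q) (hq' : q < 1) :
    Tendsto (fun n => μ.real {ω | IsUnit (Matrix.of (V n ω)).det}) atTop (𝓝 1) ∧
    Tendsto (fun n => μ.real {ω | (X n ω).ofLp ⬝ᵥ (Matrix.of (V n ω))⁻¹ *ᵥ (X n ω).ofLp ≤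
      quantile (chiSquare d) (1 - q)}) atTop (𝓝 (1 - q)) := by
  set χ := quantile (chiSquare d) (1 - q)
  obtain ⟨R, hR, rfl⟩ := exists_isUnit_eq_mul_transpose hM
  have hdetM : 0 < (R * Rᵀ).det := hM.det_pos
  have hdist := tendstoInDistribution_pi_gaussianReal hX hchar
  have hdet : Tendsto (fun n => μ.real {ω | (Matrix.of (V n ω)).det ≤ 0}) atTop (𝓝 0) := by
    have h1 := tendsto_measureReal_nonpos (hdist.continuous_comp_prodMk_of_tendstoInMeasure_const
      (g := fun p : EuclideanSpace ℝ (Fin d) × (Fin d → Fin d → ℝ) => (Matrix.of p.2).det)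
      (Continuous.matrix_det continuous_snd) hVM fun n => (hV n).aemeasurable) (by
        have : {w : Fin d → ℝ | (Matrix.of (R * Rᵀ)).det = 0} = ∅ :=
          Set.eq_empty_of_forall_notMem fun w hw => hdetM.ne' hw
        rw [this, measure_empty])
    have h2 : {w : Fin d → ℝ | (Matrix.of (R * Rᵀ)).det ≤ 0} = ∅ :=
      Set.eq_empty_of_forall_notMem fun w hw => not_le.2 hdetM hw
    rwa [h2, measureReal_empty] at h1
  have hmeas : ∀ n, MeasurableSet {ω | (Matrix.of (V n ω)).det ≤ 0} := fun n => by
    have h1 : Continuous fun v : Fin d → Fin d → ℝ => (Matrix.of v).det :=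
      Continuous.matrix_det continuous_id
    exact measurableSet_le (h1.measurable.comp (hV n)) measurable_const
  refine ⟨?_, ?_⟩
  · refine tendsto_of_tendsto_of_tendsto_of_le_of_le (by simpa using hdet.const_sub 1)
      tendsto_const_nhds (fun n => ?_) fun n => measureReal_le_one
    beta_reduce
    rw [← probReal_compl_eq_one_sub (hmeas n)]
    refine measureReal_mono fun ω hω => ?_
    have hω' : ¬(Matrix.of (V n ω)).det ≤ 0 := hω
    exact isUnit_iff_ne_zero.2 (not_le.1 hω').ne'
  -- multiplying by the determinant turns the inverse into the adjugate, which is continuous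
  · have hinv : ∀ w : Fin d → ℝ, (R *ᵥ w) ⬝ᵥ (R * Rᵀ).adjugate *ᵥ (R *ᵥ w) =
        (R * Rᵀ).det * ∑ i, w i ^ 2 := by
      intro w
      have h1 : Rᵀ * (R * Rᵀ).adjugate * R = (R * Rᵀ).det • (1 : Matrix (Fin d) (Fin d) ℝ) := by
        rw [← hR.mul_right_inj, ← mul_assoc, ← mul_assoc, mul_adjugate]
        simp
      have h2 : (R *ᵥ w) ⬝ᵥ (R * Rᵀ).adjugate *ᵥ (R *ᵥ w) =
          w ⬝ᵥ (Rᵀ * (R * Rᵀ).adjugate * R) *ᵥ w := by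
        rw [← mulVec_mulVec w _ R, ← mulVec_mulVec _ Rᵀ, dotProduct_mulVec w Rᵀ, vecMul_transpose]
      rw [h2, h1, smul_mulVec, one_mulVec, dotProduct_smul, smul_eq_mul]
      simp [dotProduct, sq]
    have h1 := hdist.continuous_comp_prodMk_of_tendstoInMeasure_const
      (g := fun p : EuclideanSpace ℝ (Fin d) × (Fin d → Fin d → ℝ) =>
        p.1.ofLp ⬝ᵥ (Matrix.of p.2).adjugate *ᵥ p.1.ofLp - χ * (Matrix.of p.2).det)
      (by
        have h2 : Continuous fun p : EuclideanSpace ℝ (Fin d) × (Fin d → Fin d → ℝ) =>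
          Matrix.of p.2 := continuous_snd
        have h3 : Continuous fun p : EuclideanSpace ℝ (Fin d) × (Fin d → Fin d → ℝ) =>
          p.1.ofLp := (PiLp.continuous_ofLp 2 _).comp continuous_fst
        exact (h3.dotProduct (h2.matrix_adjugate.matrix_mulVec h3)).sub
          (continuous_const.mul h2.matrix_det)) hVM fun n => (hV n).aemeasurable
    have h2 : ∀ w : Fin d → ℝ, (R *ᵥ w) ⬝ᵥ (Matrix.of (R * Rᵀ)).adjugate *ᵥ (R *ᵥ w) -
        χ * (Matrix.of (R * Rᵀ)).det = (R * Rᵀ).det * (∑ i, w i ^ 2 - χ) := fun w => by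
      have := hinv w
      change (R *ᵥ w) ⬝ᵥ (R * Rᵀ).adjugate *ᵥ (R *ᵥ w) - χ * (R * Rᵀ).det = _
      rw [this]
      ring
    simp only [h2] at h1
    have h3 := tendsto_measureReal_nonpos h1 (by
      refine measure_mono_null (fun w hw => ?_) (pi_gaussianReal_sum_sq_eq hd χ)
      have h4 : (R * Rᵀ).det * (∑ i, w i ^ 2 - χ) = 0 := hw
      exact sub_eq_zero.1 ((mul_eq_zero.1 h4).resolve_left hdetM.ne'))
    have h4 : {w : Fin d → ℝ | (R * Rᵀ).det * (∑ i, w i ^ 2 - χ) ≤ 0} =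
        {w | ∑ i, w i ^ 2 ≤ χ} := by
      ext w
      simp only [Set.mem_ofPred_eq]
      rw [← not_lt, mul_pos_iff_of_pos_left hdetM, not_lt, sub_nonpos]
    rw [h4, pi_gaussianReal_sum_sq_le_quantile hd hq hq'] at h3
    -- the two events agree where the determinant is positive
    have h5 : ∀ n ω, 0 < (Matrix.of (V n ω)).det →
        ((X n ω).ofLp ⬝ᵥ (Matrix.of (V n ω))⁻¹ *ᵥ (X n ω).ofLp ≤ χ ↔
        (X n ω).ofLp ⬝ᵥ (Matrix.of (V n ω)).adjugate *ᵥ (X n ω).ofLp -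
          χ * (Matrix.of (V n ω)).det ≤ 0) := by
      intro n ω hpos
      rw [Matrix.inv_def, Ring.inverse_eq_inv', smul_mulVec, dotProduct_smul, smul_eq_mul,
        inv_mul_le_iff₀ hpos, sub_nonpos, mul_comm χ]
    refine tendsto_of_tendsto_of_tendsto_of_le_of_le (by simpa only [sub_zero] using h3.sub hdet)
      (by simpa only [add_zero] using h3.add hdet) (fun n => ?_) fun n => ?_
    · rw [sub_le_iff_le_add]
      refine (measureReal_mono fun ω hω => ?_).trans (measureReal_union_le _ _)
      rcases le_or_gt (Matrix.of (V n ω)).det 0 with h6 | h6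
      · exact Or.inr h6
      · exact Or.inl ((h5 n ω h6).2 hω)
    · refine (measureReal_mono fun ω hω => ?_).trans (measureReal_union_le _ _)
      rcases le_or_gt (Matrix.of (V n ω)).det 0 with h6 | h6
      · exact Or.inr h6
      · exact Or.inl ((h5 n ω h6).1 hω)

end ConfidenceRegions

/-! ### The Hessian at the minimizer and the sandwich matrix -/

namespace RegularObjective

variable {d : ℕ} {F : EuclideanSpace ℝ (Fin d) → ℝ} {xs : EuclideanSpace ℝ (Fin d)}

lemma inner_fderiv_gradient_comm (h : RegularObjective F xs) (v w : EuclideanSpace ℝ (Fin d)) :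
    inner ℝ (fderiv ℝ (gradient F) xs v) w = inner ℝ (fderiv ℝ (gradient F) xs w) v := by
  set T : EuclideanSpace ℝ (Fin d) →L[ℝ] StrongDual ℝ (EuclideanSpace ℝ (Fin d)) :=
    LinearMap.toContinuousLinearMap
      { toFun := InnerProductSpace.toDual ℝ (EuclideanSpace ℝ (Fin d))
        map_add' := fun y z => map_add _ y z
        map_smul' := fun r y => by simp }
  have h1 : ∀ y, HasFDerivAt F (T (gradient F y)) y := fun y =>
    (h.contDiff.differentiable one_ne_zero y).hasGradientAt.hasFDerivAt
  have h2 : HasFDerivAt (fun y => T (gradient F y)) (T.comp (fderiv ℝ (gradient F) xs)) xs :=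
    T.hasFDerivAt.comp xs h.hessian.hasFDerivAt
  exact second_derivative_symmetric_of_eventually_of_real (.of_forall h1) h2 v w

lemma exists_le_inner_fderiv_gradient (h : RegularObjective F xs) :
    ∃ c, 0 < c ∧ ∀ v, c * ‖v‖ ^ 2 ≤ inner ℝ (fderiv ℝ (gradient F) xs v) v := by
  obtain ⟨c, hc, hcoer⟩ := h.coercive
  refine ⟨c, hc, fun v => ?_⟩
  have h1 := h.hessian.hasFDerivAt.lim v (c := fun n : ℕ => (n : ℝ) + 1) (l := atTop)
    (tendsto_norm_atTop_atTop.comp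
      (tendsto_atTop_add_const_right _ _ tendsto_natCast_atTop_atTop))
  refine ge_of_tendsto (h1.inner tendsto_const_nhds) (.of_forall fun n => ?_)
  have hn : (0 : ℝ) < (n : ℝ) + 1 := by positivity
  have h2 := hcoer (((n : ℝ) + 1)⁻¹ • v)
  rw [norm_smul, Real.norm_of_nonneg (inv_nonneg.2 hn.le), inner_smul_right] at h2
  rw [h.gradient_minimizer, sub_zero, real_inner_smul_left]
  calc c * ‖v‖ ^ 2 = ((n : ℝ) + 1) ^ 2 * (c * (((n : ℝ) + 1)⁻¹ * ‖v‖) ^ 2) := by field_simp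
    _ ≤ ((n : ℝ) + 1) ^ 2 * (((n : ℝ) + 1)⁻¹ *
        inner ℝ (gradient F (xs + ((n : ℝ) + 1)⁻¹ • v)) v) := by gcongr
    _ = _ := by field_simp

end RegularObjective

section Sandwich

open Matrix

variable {d : ℕ} {F : EuclideanSpace ℝ (Fin d) → ℝ} {xs : EuclideanSpace ℝ (Fin d)}

lemma hessianMatrix_mulVec (v : EuclideanSpace ℝ (Fin d)) :
    hessianMatrix F xs *ᵥ v.ofLp = (fderiv ℝ (gradient F) xs v).ofLp := by
  funext i
  conv_rhs => rw [← (EuclideanSpace.basisFun (Fin d) ℝ).sum_repr v]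
  simp [hessianMatrix, mulVec, dotProduct, mul_comm]

lemma transpose_hessianMatrix (h : RegularObjective F xs) :
    (hessianMatrix F xs)ᵀ = hessianMatrix F xs := by
  ext i j
  have := h.inner_fderiv_gradient_comm (EuclideanSpace.single i 1) (EuclideanSpace.single j 1)
  simpa [hessianMatrix, EuclideanSpace.inner_single_right] using this

lemma isUnit_hessianMatrix (h : RegularObjective F xs) : IsUnit (hessianMatrix F xs) := by
  obtain ⟨c, hc, hcoer⟩ := h.exists_le_inner_fderiv_gradient
  refine mulVec_injective_iff_isUnit.1 fun v w hvw => ?_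
  have h1 := hessianMatrix_mulVec (F := F) (xs := xs) (WithLp.toLp 2 (v - w))
  rw [WithLp.ofLp_toLp, mulVec_sub, sub_eq_zero.2 hvw] at h1
  have h2 : fderiv ℝ (gradient F) xs (WithLp.toLp 2 (v - w)) = 0 := by
    ext i
    exact (congrFun h1 i).symm
  have h3 := hcoer (WithLp.toLp 2 (v - w))
  rw [h2, inner_zero_left] at h3
  have h4 : ‖(WithLp.toLp 2 (v - w) : EuclideanSpace ℝ (Fin d))‖ = 0 := by
    by_contra hne
    have : 0 < ‖(WithLp.toLp 2 (v - w) : EuclideanSpace ℝ (Fin d))‖ :=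
      lt_of_le_of_ne (norm_nonneg _) (Ne.symm hne)
    exact absurd h3 (not_le.2 (by positivity))
  rw [norm_eq_zero] at h4
  exact sub_eq_zero.1 (congrArg WithLp.ofLp h4)

lemma transpose_inv_hessianMatrix (h : RegularObjective F xs) :
    ((hessianMatrix F xs)⁻¹)ᵀ = (hessianMatrix F xs)⁻¹ := by
  rw [transpose_nonsing_inv, transpose_hessianMatrix h]

lemma inner_inv_hessianMatrix_mulVec (h : RegularObjective F xs)
    (u y : EuclideanSpace ℝ (Fin d)) :
    inner ℝ (WithLp.toLp 2 ((hessianMatrix F xs)⁻¹ *ᵥ u.ofLp)) (fderiv ℝ (gradient F) xs y) =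
      inner ℝ u y := by
  rw [EuclideanSpace.inner_eq_star_dotProduct, EuclideanSpace.inner_eq_star_dotProduct,
    star_trivial, star_trivial, ← hessianMatrix_mulVec]
  change (hessianMatrix F xs *ᵥ y.ofLp) ⬝ᵥ ((hessianMatrix F xs)⁻¹ *ᵥ u.ofLp) = _
  rw [dotProduct_mulVec, ← mulVec_transpose, transpose_inv_hessianMatrix h, mulVec_mulVec,
    nonsing_inv_mul _ ((isUnit_iff_isUnit_det _).1 (isUnit_hessianMatrix h)), one_mulVec]

variable {Ξ : Type*} [MeasurableSpace Ξ] {f : EuclideanSpace ℝ (Fin d) → Ξ → ℝ} {P : Measure Ξ}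

lemma transpose_gradSecondMoment :
    (gradSecondMoment f P xs)ᵀ = gradSecondMoment f P xs := by
  ext i j
  simp [gradSecondMoment, mul_comm]

lemma transpose_sandwich (h : RegularObjective (objective f P) xs) :
    (sandwich f P xs)ᵀ = sandwich f P xs := by
  rw [sandwich, transpose_mul, transpose_mul, transpose_inv_hessianMatrix h,
    transpose_gradSecondMoment, mul_assoc]

lemma posDef_sandwich (h : RegularObjective (objective f P) xs)
    (hS : (gradSecondMoment f P xs).PosDef) : (sandwich f P xs).PosDef := by
  have h1 := hS.conjTranspose_mul_mul_same (B := (hessianMatrix (objective f P) xs)⁻¹)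
    (mulVec_injective_iff_isUnit.2 ((isUnit_nonsing_inv_iff).2 (isUnit_hessianMatrix h)))
  rwa [conjTranspose_eq_transpose_of_trivial, transpose_inv_hessianMatrix h] at h1

lemma inner_gradSecondMoment_eq_dotProduct_sandwich (h : RegularObjective (objective f P) xs)
    (u : EuclideanSpace ℝ (Fin d)) :
    inner ℝ (WithLp.toLp 2 ((hessianMatrix (objective f P) xs)⁻¹ *ᵥ u.ofLp))
      (Matrix.toEuclideanCLM (𝕜 := ℝ) (gradSecondMoment f P xs)
        (WithLp.toLp 2 ((hessianMatrix (objective f P) xs)⁻¹ *ᵥ u.ofLp))) =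
      u.ofLp ⬝ᵥ sandwich f P xs *ᵥ u.ofLp := by
  rw [EuclideanSpace.inner_eq_star_dotProduct, star_trivial, ofLp_toEuclideanCLM, dotProduct_comm,
    sandwich, ← mulVec_mulVec, ← mulVec_mulVec, dotProduct_mulVec u.ofLp, ← mulVec_transpose,
    transpose_inv_hessianMatrix h]

lemma inner_gradSecondMoment_nonneg (hL : MemLp (lossGrad f xs) 2 P)
    (p : EuclideanSpace ℝ (Fin d)) :
    0 ≤ inner ℝ p (Matrix.toEuclideanCLM (𝕜 := ℝ) (gradSecondMoment f P xs) p) := by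
  have hc : ∀ i, MemLp (fun z => lossGrad f xs z i) 2 P := fun i =>
    hL.of_le ((EuclideanSpace.proj (𝕜 := ℝ) i).continuous.comp_aestronglyMeasurable hL.1)
      (ae_of_all _ fun z => PiLp.norm_apply_le _ _)
  have hij : ∀ i j, Integrable (fun z => lossGrad f xs z i * lossGrad f xs z j) P := fun i j =>
    (hc i).integrable_mul (hc j)
  have h1 : inner ℝ p (Matrix.toEuclideanCLM (𝕜 := ℝ) (gradSecondMoment f P xs) p) =
      ∫ z, inner ℝ p (lossGrad f xs z) ^ 2 ∂P := by
    have h2 : ∀ z, inner ℝ p (lossGrad f xs z) ^ 2 =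
        ∑ i, ∑ j, p i * p j * (lossGrad f xs z i * lossGrad f xs z j) := by
      intro z
      simp only [PiLp.inner_apply, sq, Finset.sum_mul_sum, RCLike.inner_apply, conj_trivial]
      exact Finset.sum_congr rfl fun i _ => Finset.sum_congr rfl fun j _ => by ring
    simp_rw [h2]
    rw [integral_finsetSum _ fun i _ => integrable_finsetSum _ fun j _ => (hij i j).const_mul _]
    simp_rw [fun i => integral_finsetSum (μ := P) Finset.univ
      fun j (_ : j ∈ Finset.univ) => (hij i j).const_mul (p i * p j), integral_const_mul]
    simp only [PiLp.inner_apply, ofLp_toEuclideanCLM, mulVec, dotProduct, RCLike.inner_apply,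
      conj_trivial, Finset.sum_mul]
    exact Finset.sum_congr rfl fun i _ => Finset.sum_congr rfl fun j _ => by
      simp only [gradSecondMoment, of_apply]
      ring
  rw [h1]
  exact integral_nonneg fun z => sq_nonneg _

end Sandwich

/-! ### Averages and batch means of the iterates -/

section Iterates

open Matrix

variable {d : ℕ} {xs : EuclideanSpace ℝ (Fin d)}

lemma sum_sub_eq_smul_iterateAverage_sub (x : ℕ → EuclideanSpace ℝ (Fin d)) {n : ℕ} (hn : n ≠ 0) :
    ∑ k ∈ Finset.Icc 1 n, (x k - xs) = (n : ℝ) • (iterateAverage x n - xs) := by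
  have hn' : (n : ℝ) ≠ 0 := Nat.cast_ne_zero.2 hn
  rw [Finset.sum_sub_distrib, Finset.sum_const, Nat.card_Icc, Nat.add_sub_cancel, iterateAverage,
    smul_sub, smul_inv_smul₀ hn', ← Nat.cast_smul_eq_nsmul ℝ]

lemma centredBatchSum_eq (a : ℕ → ℕ) (x : ℕ → EuclideanSpace ℝ (Fin d)) {n : ℕ} (hn : n ≠ 0)
    (i : ℕ) :
    centredBatchSum a x n i = ∑ k ∈ Finset.Icc (batchStart a i) i, (x k - xs) -
      (batchLength a i : ℝ) • ((n : ℝ)⁻¹ • ∑ k ∈ Finset.Icc 1 n, (x k - xs)) := by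
  have hn' : (n : ℝ) ≠ 0 := Nat.cast_ne_zero.2 hn
  rw [sum_sub_eq_smul_iterateAverage_sub x hn, inv_smul_smul₀ hn', Finset.sum_sub_distrib,
    Finset.sum_const, Nat.card_Icc, centredBatchSum, smul_sub, ← batchLength,
    Nat.cast_smul_eq_nsmul ℝ, Nat.cast_smul_eq_nsmul ℝ]
  abel

lemma covEstimator_apply (a : ℕ → ℕ) (x : ℕ → EuclideanSpace ℝ (Fin d)) (n : ℕ) (j k : Fin d) :
    covEstimator a x n j k = (∑ i ∈ Finset.Icc 1 n, (batchLength a i : ℝ))⁻¹ *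
      ∑ i ∈ Finset.Icc 1 n, centredBatchSum a x n i j * centredBatchSum a x n i k := by
  simp [covEstimator, Matrix.sum_apply]

lemma transpose_covEstimator (a : ℕ → ℕ) (x : ℕ → EuclideanSpace ℝ (Fin d)) (n : ℕ) :
    (covEstimator a x n)ᵀ = covEstimator a x n := by
  ext j k
  simp [covEstimator_apply, mul_comm]

lemma dotProduct_covEstimator_mulVec (a : ℕ → ℕ) (x : ℕ → EuclideanSpace ℝ (Fin d)) (n : ℕ)
    (u : EuclideanSpace ℝ (Fin d)) :
    u.ofLp ⬝ᵥ covEstimator a x n *ᵥ u.ofLp =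
      (∑ i ∈ Finset.Icc 1 n, (batchLength a i : ℝ))⁻¹ *
        ∑ i ∈ Finset.Icc 1 n, inner ℝ u (centredBatchSum a x n i) ^ 2 := by
  rw [covEstimator, smul_mulVec, dotProduct_smul, smul_eq_mul, sum_mulVec, dotProduct_sum]
  congr 1
  refine Finset.sum_congr rfl fun i _ => ?_
  simp only [PiLp.inner_apply, RCLike.inner_apply, conj_trivial, dotProduct, mulVec, of_apply]
  rw [sq, Finset.sum_mul_sum]
  simp only [Finset.mul_sum]
  exact Finset.sum_congr rfl fun j _ => Finset.sum_congr rfl fun k _ => by ring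

variable {Ω : Type*} {mΩ : MeasurableSpace Ω} {μ : Measure Ω} [IsProbabilityMeasure μ]
  {ℱ : Filtration ℕ mΩ} {G : EuclideanSpace ℝ (Fin d) → EuclideanSpace ℝ (Fin d)}
  {H : EuclideanSpace ℝ (Fin d) →L[ℝ] EuclideanSpace ℝ (Fin d)}
  {Q : EuclideanSpace ℝ (Fin d) → ℝ} {η α : ℝ} {x e : ℕ → Ω → EuclideanSpace ℝ (Fin d)}
  {u p : EuclideanSpace ℝ (Fin d)} {a : ℕ → ℕ}

/-- The central limit theorem for the averaged iterates in a direction `u`, the functional `⟪u, ·⟫`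
being represented as `⟪p, H ·⟫`. -/
lemma IsRobbinsMonro.tendsto_integral_exp_iterateAverage
    (h : IsRobbinsMonro μ ℱ G H Q η α (fun n ω => x n ω - xs) e)
    (hup : ∀ y, inner ℝ p (H y) = inner ℝ u y) (hQ : 0 ≤ Q p) :
    Tendsto (fun n : ℕ => ∫ ω, Complex.exp ((inner ℝ u
      (√n • (iterateAverage (fun k => x k ω) n - xs)) : ℝ) * Complex.I) ∂μ) atTop
      (𝓝 (Complex.exp (-(Q p / 2 : ℝ)))) := by
  refine (h.tendsto_integral_exp_average hQ).congr' ?_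
  filter_upwards [eventually_ne_atTop 0] with n hn
  refine integral_congr_ae (ae_of_all _ fun ω => ?_)
  have hn' : (0 : ℝ) < n := Nat.cast_pos.2 (Nat.pos_of_ne_zero hn)
  beta_reduce
  rw [hup, sum_sub_eq_smul_iterateAverage_sub (fun k => x k ω) hn, inner_smul_right,
    inner_smul_right, ← mul_assoc, inv_mul_eq_div, Real.div_sqrt]

lemma IsRobbinsMonro.tendsto_integral_abs_covEstimator_sub
    (h : IsRobbinsMonro μ ℱ G H Q η α (fun n ω => x n ω - xs) e)
    (hup : ∀ y, inner ℝ p (H y) = inner ℝ u y) (ht : IsBatching (batchStart a)) {L : ℕ → ℝ}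
    (hL0 : ∀ n, 0 ≤ L n) (hL : ∀ n, ∀ i ∈ Finset.Icc 1 n, (batchLength a i : ℝ) ≤ L n)
    (hLT : Tendsto (fun n => L n ^ 2 / ∑ i ∈ Finset.Icc 1 n, (batchLength a i : ℝ)) atTop (𝓝 0))
    (hαT : Tendsto (fun n : ℕ => (∑ i ∈ Finset.Icc 1 n, ((i : ℝ) + 1) ^ α) /
      ∑ i ∈ Finset.Icc 1 n, (batchLength a i : ℝ)) atTop (𝓝 0)) :
    Tendsto (fun n : ℕ => ∫ ω, |u.ofLp ⬝ᵥ covEstimator a (fun k => x k ω) n *ᵥ u.ofLp - Q p| ∂μ)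
      atTop (𝓝 0) := by
  refine (h.tendsto_integral_abs_batchMeans_sub p ht hL0 hL hLT hαT).congr' ?_
  filter_upwards [eventually_ne_atTop 0] with n hn
  refine integral_congr_ae (ae_of_all _ fun ω => ?_)
  beta_reduce
  rw [dotProduct_covEstimator_mulVec]
  simp_rw [hup, centredBatchSum_eq (xs := xs) a (fun k => x k ω) hn]
  rfl

lemma two_mul_apply_eq_of_transpose_eq {W : Matrix (Fin d) (Fin d) ℝ} (hW : Wᵀ = W) (j k : Fin d) :
    2 * W j k =
      (EuclideanSpace.single j 1 + EuclideanSpace.single k 1 : EuclideanSpace ℝ (Fin d)).ofLp ⬝ᵥ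
        W *ᵥ (EuclideanSpace.single j 1 + EuclideanSpace.single k 1 :
          EuclideanSpace ℝ (Fin d)).ofLp -
      (EuclideanSpace.single j 1 : EuclideanSpace ℝ (Fin d)).ofLp ⬝ᵥ
        W *ᵥ (EuclideanSpace.single j 1 : EuclideanSpace ℝ (Fin d)).ofLp -
      (EuclideanSpace.single k 1 : EuclideanSpace ℝ (Fin d)).ofLp ⬝ᵥ
        W *ᵥ (EuclideanSpace.single k 1 : EuclideanSpace ℝ (Fin d)).ofLp := by
  have h1 : W k j = W j k := congrFun (congrFun hW j) k
  simp [mulVec_add, dotProduct_add, add_dotProduct, h1]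
  ring

/-- Consistency of all quadratic forms gives consistency of the entries, by polarization. -/
lemma tendsto_integral_abs_apply_sub {V : ℕ → Ω → Matrix (Fin d) (Fin d) ℝ}
    {M : Matrix (Fin d) (Fin d) ℝ} (hVs : ∀ n ω, (V n ω)ᵀ = V n ω) (hMs : Mᵀ = M)
    (hint : ∀ n j k, Integrable (fun ω => V n ω j k) μ)
    (h : ∀ u : EuclideanSpace ℝ (Fin d),
      Tendsto (fun n => ∫ ω, |u.ofLp ⬝ᵥ V n ω *ᵥ u.ofLp - u.ofLp ⬝ᵥ M *ᵥ u.ofLp| ∂μ) atTop (𝓝 0))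
    (j k : Fin d) : Tendsto (fun n => ∫ ω, |V n ω j k - M j k| ∂μ) atTop (𝓝 0) := by
  have hDint : ∀ n (u : EuclideanSpace ℝ (Fin d)),
      Integrable (fun ω => |u.ofLp ⬝ᵥ V n ω *ᵥ u.ofLp - u.ofLp ⬝ᵥ M *ᵥ u.ofLp|) μ := by
    intro n u
    refine (Integrable.sub ?_ (integrable_const _)).abs
    simp only [dotProduct, mulVec]
    exact integrable_finsetSum _ fun j _ =>
      (integrable_finsetSum _ fun k _ => (hint n j k).mul_const _).const_mul _
  have hlim := ((h (EuclideanSpace.single j 1 + EuclideanSpace.single k 1)).add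
    (h (EuclideanSpace.single j 1))).add (h (EuclideanSpace.single k 1))
  rw [add_zero, add_zero] at hlim
  refine tendsto_of_tendsto_of_tendsto_of_le_of_le tendsto_const_nhds hlim
    (fun n => integral_nonneg fun ω => abs_nonneg _) fun n => ?_
  beta_reduce
  rw [← integral_add (hDint n _) (hDint n _), ← integral_add ((hDint n _).fun_add (hDint n _))
    (hDint n _)]
  refine integral_mono (((hint n j k).sub (integrable_const _)).abs)
    (((hDint n _).fun_add (hDint n _)).fun_add (hDint n _)) fun ω => ?_
  have h2 := two_mul_apply_eq_of_transpose_eq (hVs n ω) j k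
  have h3 := two_mul_apply_eq_of_transpose_eq hMs j k
  beta_reduce
  generalize EuclideanSpace.single j (1 : ℝ) + EuclideanSpace.single k 1 = s at *
  generalize EuclideanSpace.single j (1 : ℝ) = t at *
  generalize EuclideanSpace.single k (1 : ℝ) = r at *
  have h4 : 2 * (V n ω j k - M j k) = (s.ofLp ⬝ᵥ V n ω *ᵥ s.ofLp - s.ofLp ⬝ᵥ M *ᵥ s.ofLp) -
      (t.ofLp ⬝ᵥ V n ω *ᵥ t.ofLp - t.ofLp ⬝ᵥ M *ᵥ t.ofLp) -
      (r.ofLp ⬝ᵥ V n ω *ᵥ r.ofLp - r.ofLp ⬝ᵥ M *ᵥ r.ofLp) := by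
    rw [mul_sub, h2, h3]
    ring
  generalize s.ofLp ⬝ᵥ V n ω *ᵥ s.ofLp - s.ofLp ⬝ᵥ M *ᵥ s.ofLp = s' at *
  generalize t.ofLp ⬝ᵥ V n ω *ᵥ t.ofLp - t.ofLp ⬝ᵥ M *ᵥ t.ofLp = t' at *
  generalize r.ofLp ⬝ᵥ V n ω *ᵥ r.ofLp - r.ofLp ⬝ᵥ M *ᵥ r.ofLp = r' at *
  rw [show V n ω j k - M j k = (s' - t' - r') / 2 by linarith, abs_div, abs_two]
  have h5 := abs_sub (s' - t') r'
  have h6 := abs_sub s' t'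
  linarith [abs_nonneg (s' - t' - r')]

lemma tendstoInMeasure_of_tendsto_integral_abs_apply {V : ℕ → Ω → Fin d → Fin d → ℝ}
    {M : Fin d → Fin d → ℝ} (hint : ∀ n j k, Integrable (fun ω => V n ω j k) μ)
    (h : ∀ j k, Tendsto (fun n => ∫ ω, |V n ω j k - M j k| ∂μ) atTop (𝓝 0)) :
    TendstoInMeasure μ V atTop fun _ => M := by
  have habs : ∀ n j k, Integrable (fun ω => |V n ω j k - M j k|) μ := fun n j k =>
    ((hint n j k).sub (integrable_const _)).abs
  have hB0 : Tendsto (fun n => ∫ ω, ∑ j, ∑ k, |V n ω j k - M j k| ∂μ) atTop (𝓝 0) := by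
    have h1 := tendsto_finsetSum (Finset.univ : Finset (Fin d)) fun j _ =>
      tendsto_finsetSum (Finset.univ : Finset (Fin d)) fun k _ => h j k
    simp only [Finset.sum_const_zero] at h1
    refine h1.congr fun n => ?_
    rw [integral_finsetSum _ fun j _ => integrable_finsetSum _ fun k _ => habs n j k]
    exact Finset.sum_congr rfl fun j _ => (integral_finsetSum _ fun k _ => habs n j k).symm
  have hle : ∀ n ω, ‖V n ω - M‖ ≤ ∑ j, ∑ k, |V n ω j k - M j k| := by
    intro n ω
    have hB : 0 ≤ ∑ j, ∑ k, |V n ω j k - M j k| :=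
      Finset.sum_nonneg fun j _ => Finset.sum_nonneg fun k _ => abs_nonneg _
    refine (pi_norm_le_iff_of_nonneg hB).2 fun j => (pi_norm_le_iff_of_nonneg hB).2 fun k => ?_
    refine (Finset.single_le_sum (f := fun k => |V n ω j k - M j k|)
      (fun k _ => abs_nonneg _) (Finset.mem_univ k)).trans ?_
    exact Finset.single_le_sum (f := fun j => ∑ k, |V n ω j k - M j k|)
      (fun j _ => Finset.sum_nonneg fun k _ => abs_nonneg _) (Finset.mem_univ j)
  refine tendstoInMeasure_of_tendsto_eLpNorm one_ne_zero (fun n => ?_)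
    aestronglyMeasurable_const ?_
  · exact (aemeasurable_pi_iff.2 fun j => aemeasurable_pi_iff.2 fun k =>
      (hint n j k).1.aemeasurable).aestronglyMeasurable
  · have h1 := ENNReal.tendsto_ofReal hB0
    rw [ENNReal.ofReal_zero] at h1
    refine tendsto_of_tendsto_of_tendsto_of_le_of_le tendsto_const_nhds h1
      (fun n => bot_le) fun n => ?_
    beta_reduce
    rw [eLpNorm_one_eq_lintegral_enorm, ofReal_integral_eq_lintegral_ofReal
      (integrable_finsetSum _ fun j _ => integrable_finsetSum _ fun k _ => habs n j k)
      (ae_of_all _ fun ω => (norm_nonneg _).trans (hle n ω))]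
    refine lintegral_mono fun ω => ?_
    rw [← ofReal_norm]
    exact ENNReal.ofReal_le_ofReal (hle n ω)

omit [IsProbabilityMeasure μ] in
lemma integrable_covEstimator (hx : ∀ k, MemLp (x k) 2 μ) (n : ℕ) (j k : Fin d) :
    Integrable (fun ω => covEstimator a (fun k => x k ω) n j k) μ := by
  have hs : ∀ s : Finset ℕ, MemLp (fun ω => ∑ k ∈ s, x k ω) 2 μ := fun s =>
    memLp_finsetSum s fun k _ => hx k
  have hc : ∀ i j, MemLp (fun ω => centredBatchSum a (fun k => x k ω) n i j) 2 μ := by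
    intro i j
    have h1 : MemLp (fun ω => centredBatchSum a (fun k => x k ω) n i) 2 μ :=
      (hs _).sub (((hs (Finset.Icc 1 n)).const_smul (n : ℝ)⁻¹).const_smul (batchLength a i : ℝ))
    exact h1.of_le ((EuclideanSpace.proj (𝕜 := ℝ) j).continuous.comp_aestronglyMeasurable h1.1)
      (ae_of_all _ fun ω => PiLp.norm_apply_le _ _)
  simp only [covEstimator_apply]
  exact (integrable_finsetSum _ fun i _ => (hc i j).integrable_mul (hc i k)).const_mul _

lemma measurable_iterateAverage (hx : ∀ k, Measurable (x k)) (n : ℕ) :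
    Measurable fun ω => iterateAverage (fun k => x k ω) n :=
  (Finset.measurable_fun_sum _ fun k _ => hx k).const_smul (n : ℝ)⁻¹

lemma measurable_covEstimator (hx : ∀ k, Measurable (x k)) (n : ℕ) (j k : Fin d) :
    Measurable fun ω => covEstimator a (fun k => x k ω) n j k := by
  have hc : ∀ i j, Measurable fun ω => centredBatchSum a (fun k => x k ω) n i j := by
    intro i j
    have h1 : Measurable fun ω => centredBatchSum a (fun k => x k ω) n i :=
      (Finset.measurable_fun_sum _ fun k _ => hx k).sub
        ((measurable_iterateAverage hx n).const_smul (batchLength a i : ℝ))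
    exact (EuclideanSpace.proj (𝕜 := ℝ) j).continuous.measurable.comp h1
  simp only [covEstimator_apply]
  exact (Finset.measurable_fun_sum _ fun i _ => (hc i j).mul (hc i k)).const_mul _

end Iterates

/-! ### Asymptotic validity of the confidence regions -/

theorem corollary2 {d : ℕ} (hd : 1 ≤ d)
    {Ω Ξ : Type*} [MeasurableSpace Ω] [MeasurableSpace Ξ]
    (μ : Measure Ω) [IsProbabilityMeasure μ]
    (P : Measure Ξ) [IsProbabilityMeasure P]
    (ξ : ℕ → Ω → Ξ) (hξ_meas : ∀ n, Measurable (ξ n)) (hξ_indep : iIndepFun ξ μ)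
    (hξ_law : ∀ n, Measure.map (ξ n) μ = P)
    (f : EuclideanSpace ℝ (Fin d) → Ξ → ℝ)
    (hf_meas : ∀ x, Measurable (f x)) (hf_int : ∀ x, Integrable (f x) P)
    (x₀ xs : EuclideanSpace ℝ (Fin d))
    (η α : ℝ) (hη : 0 < η) (hα : 1 / 2 < α) (hα' : α < 1)
    (h_obj : RegularObjective (objective f P) xs)
    (h_noise : RegularNoise μ f P η α x₀ xs ξ)
    (C β : ℝ) (hC : 0 < C) (hβ : 1 / (1 - α) < β)
    (a : ℕ → ℕ) (ha_one : a 1 = 1) (ha_mono : StrictMonoOn a (Set.Ici 1))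
    (ha : ∀ᶠ k : ℕ in atTop, a k = ⌊C * (k : ℝ) ^ β⌋₊)
    (q : ℝ) (hq : 0 < q) (hq' : q < 1) :
    (∀ i : Fin d, 0 < sandwich f P xs i i →
      Tendsto
        (fun n : ℕ => μ.real {ω |
          xs i ∈ Set.Icc
            (iterateAverage (sgd f η α x₀ fun k => ξ k ω) n i -
              quantile (gaussianReal 0 1) (1 - q / 2) *
                √(covEstimator a (sgd f η α x₀ fun k => ξ k ω) n i i / n))
            (iterateAverage (sgd f η α x₀ fun k => ξ k ω) n i +
              quantile (gaussianReal 0 1) (1 - q / 2) *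
                √(covEstimator a (sgd f η α x₀ fun k => ξ k ω) n i i / n))})
        atTop (𝓝 (1 - q))) ∧
    ((gradSecondMoment f P xs).PosDef →
      Tendsto
        (fun n : ℕ => μ.real {ω |
          IsUnit (covEstimator a (sgd f η α x₀ fun k => ξ k ω) n).det})
        atTop (𝓝 1) ∧
      Tendsto
        (fun n : ℕ => μ.real {ω |
          (n : ℝ) *
            ((iterateAverage (sgd f η α x₀ fun k => ξ k ω) n - xs).ofLp ⬝ᵥ
              ((covEstimator a (sgd f η α x₀ fun k => ξ k ω) n)⁻¹).mulVec
                (iterateAverage (sgd f η α x₀ fun k => ξ k ω) n - xs).ofLp) ≤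
          quantile (chiSquare d) (1 - q)})
        atTop (𝓝 (1 - q))) := by
  have hSGD := isRobbinsMonro_sgd hξ_meas hξ_indep hξ_law hf_meas hf_int hη hα hα' h_obj h_noise
  set x : ℕ → Ω → EuclideanSpace ℝ (Fin d) := fun k ω => sgd f η α x₀ (fun k => ξ k ω) k with hx
  set A := hessianMatrix (objective f P) xs with hA
  have hxm : ∀ k, Measurable (x k) := fun k =>
    (measurable_sgd (measurable_uncurry_lossGrad h_noise.contDiff hf_meas) k).mono
      ((sampleFiltration ξ hξ_meas).le k) le_rfl
  have hxLp : ∀ k, MemLp (x k) 2 μ := fun k => by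
    have h1 := (hSGD.memLp k).add (memLp_const xs)
    refine (h1.mono_exponent (by norm_num : (2 : ENNReal) ≤ 4)).congr_norm
      (hxm k).aestronglyMeasurable (ae_of_all _ fun ω => ?_)
    simp [x]
  obtain ⟨L, hL0, hL, hLT, hαT⟩ := exists_batchLength_bounds (by linarith) hα' hC hβ ha_one ha_mono
    ha
  -- Testing the average against `u` means testing the noise against `A⁻¹ u`.
  have hdual : ∀ u y : EuclideanSpace ℝ (Fin d), inner ℝ (WithLp.toLp 2 (A⁻¹.mulVec u.ofLp))
      (fderiv ℝ (gradient (objective f P)) xs y) = inner ℝ u y := fun u y =>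
    inner_inv_hessianMatrix_mulVec h_obj u y
  have hchar : ∀ u : EuclideanSpace ℝ (Fin d), Tendsto (fun n : ℕ => ∫ ω, Complex.exp ((inner ℝ u
      (√n • (iterateAverage (fun k => x k ω) n - xs)) : ℝ) * Complex.I) ∂μ) atTop
      (𝓝 (Complex.exp (-(u.ofLp ⬝ᵥ (sandwich f P xs).mulVec u.ofLp / 2 : ℝ)))) := by
    intro u
    rw [← inner_gradSecondMoment_eq_dotProduct_sandwich h_obj u]
    exact hSGD.tendsto_integral_exp_iterateAverage (hdual u)
      (inner_gradSecondMoment_nonneg h_noise.memLp_two _)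
  have hcov : ∀ u : EuclideanSpace ℝ (Fin d), Tendsto (fun n : ℕ => ∫ ω,
      |u.ofLp ⬝ᵥ (covEstimator a (fun k => x k ω) n).mulVec u.ofLp -
        u.ofLp ⬝ᵥ (sandwich f P xs).mulVec u.ofLp| ∂μ) atTop (𝓝 0) := by
    intro u
    rw [← inner_gradSecondMoment_eq_dotProduct_sandwich h_obj u]
    exact hSGD.tendsto_integral_abs_covEstimator_sub (hdual u)
      (isBatching_batchStart ha_one ha_mono) hL0 hL hLT hαT
  have hVint : ∀ n j k, Integrable (fun ω => covEstimator a (fun k => x k ω) n j k) μ :=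
    integrable_covEstimator hxLp
  have hentry := tendsto_integral_abs_apply_sub (fun n ω => transpose_covEstimator a
    (fun k => x k ω) n) (transpose_sandwich h_obj) hVint hcov
  have hVM : TendstoInMeasure μ (fun n ω j k => covEstimator a (fun k => x k ω) n j k) atTop
      fun _ => fun j k => sandwich f P xs j k :=
    tendstoInMeasure_of_tendsto_integral_abs_apply hVint hentry
  refine ⟨fun i hi => ?_, fun hS => ?_⟩
  · have hVi : TendstoInMeasure μ (fun n ω => covEstimator a (fun k => x k ω) n i i) atTop
        fun _ => sandwich f P xs i i := by
      intro ε hε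
      refine tendsto_of_tendsto_of_tendsto_of_le_of_le tendsto_const_nhds (hVM ε hε)
        (fun n => bot_le) fun n => measure_mono fun ω hω => ?_
      exact le_trans hω ((edist_le_pi_edist (fun k => covEstimator a (fun k => x k ω) n i k)
        (fun k => sandwich f P xs i k) i).trans (edist_le_pi_edist
        (fun j k => covEstimator a (fun k => x k ω) n j k) (fun j k => sandwich f P xs j k) i))
    have hlim := tendsto_measureReal_abs_le_quantile_mul_sqrt (μ := μ)
      (X := fun n ω => √(n : ℝ) * (iterateAverage (fun k => x k ω) n i - xs i)) hi
      (fun n => by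
        have h1 := (measurable_iterateAverage hxm n)
        have h2 := (EuclideanSpace.proj (𝕜 := ℝ) i).continuous.measurable.comp h1
        exact (h2.sub_const _).const_mul _)
      (fun n => measurable_covEstimator hxm n i i) (fun t => ?_) hVi hq hq'
    · refine hlim.congr' ?_
      filter_upwards [eventually_ne_atTop 0] with n hn
      have hn' : (0 : ℝ) < √n := Real.sqrt_pos.2 (Nat.cast_pos.2 (Nat.pos_of_ne_zero hn))
      congr 1
      ext ω
      simp only [Set.mem_ofPred_eq, Set.mem_Icc]
      change _ ↔ iterateAverage (fun k => x k ω) n i - quantile (gaussianReal 0 1) (1 - q / 2) *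
        √(covEstimator a (fun k => x k ω) n i i / n) ≤ xs i ∧
        xs i ≤ iterateAverage (fun k => x k ω) n i + quantile (gaussianReal 0 1) (1 - q / 2) *
        √(covEstimator a (fun k => x k ω) n i i / n)
      rw [Real.sqrt_div' _ (Nat.cast_nonneg n), abs_mul, abs_of_pos hn', ← le_div_iff₀' hn',
        mul_div_assoc, abs_le]
      constructor
      · rintro ⟨h1, h2⟩
        constructor <;> linarith
      · rintro ⟨h1, h2⟩
        constructor <;> linarith
    · have h1 := hchar (EuclideanSpace.single i t)
      have h2 : (EuclideanSpace.single i t : EuclideanSpace ℝ (Fin d)).ofLp ⬝ᵥ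
          (sandwich f P xs).mulVec (EuclideanSpace.single i t : EuclideanSpace ℝ (Fin d)).ofLp =
          t ^ 2 * sandwich f P xs i i := by
        simp
        ring
      rw [h2] at h1
      refine h1.congr fun n => integral_congr_ae (ae_of_all _ fun ω => ?_)
      simp [EuclideanSpace.inner_single_left]
  · have hXm : ∀ n : ℕ, Measurable fun ω => √(n : ℝ) • (iterateAverage (fun k => x k ω) n - xs) :=
      fun n => ((measurable_iterateAverage hxm n).sub_const xs).const_smul √(n : ℝ)
    obtain ⟨hunit, hwald⟩ := tendsto_measureReal_dotProduct_inv_mulVec_le hd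
      (posDef_sandwich h_obj hS) hXm (fun n => measurable_pi_iff.2 fun j => measurable_pi_iff.2
        fun k => measurable_covEstimator hxm n j k) hchar hVM hq hq'
    refine ⟨hunit, hwald.congr fun n => ?_⟩
    congr 1
    ext ω
    simp only [Set.mem_ofPred_eq]
    rw [WithLp.ofLp_smul, Matrix.mulVec_smul, dotProduct_smul, smul_dotProduct, smul_smul,
      Real.mul_self_sqrt (Nat.cast_nonneg n), smul_eq_mul]
    rfl
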